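/- Let $\mathbb F$ be an algebraically closed field, $\Gamma=(V,E,s,t)$ an arbitrary digraph, and $L(\Gamma)=L_{\mathbb F}(\Gamma)$ its Leavitt path algebra with its standard $\mathbb Z$-grading ($\deg v=0$, $\deg e=1$, $\deg e^*=-1$). For a (two-sided) ideal $J$ of $L(\Gamma)$ let $H=J\cap V$, let $B_H$ be the set of breaking vertices of $H$ (infinite emitters that emit a nonzero finite number of arrows to $V\setminus H$), and let $S_J=\{v\in B_H : v-\sum_{s(e)=v,\ t(e)\notin H} ee^*\in J\}$. The digraph $\Gamma/J$ is obtained from $\Gamma$ by deleting $H$ and adding, for each $v\in B_H\setminus S_J$, a new sink $v'$ and, for each arrow $e$ with $t(e)=v$, a new arrow $e'$ from $s(e)$ to $v'$. A geometric cycle is a cycle (with distinct vertices) up to rotation. A geometric cycle $C$ of $\Gamma$ contributes the canonical polynomial generator $f_C(C)$ to $J$ if $J\cap\mathbb F[C]$ is a nonzero proper ideal of $\mathbb F[C]\cong\mathbb F[x]$ (the constant term being multiplied by the vertex $s(C)$) and $f_C\in\mathbb F[x]$ is its generator with $f_C(0)=1$. The ideal $J$ is dlf if all its canonical polynomials $f_C$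 are products of distinct linear factors. Let $I$ be a graded ideal of $L(\Gamma)$ and $\beta$ a set of geometric cycles with no exit in $\Gamma/I$. Let $\mathcal J(I,\beta)$ be the set of ideals $J$ such that $I$ is the largest graded ideal contained in $J$ and $\beta$ is the set of cycles with no exit in $\Gamma/I$ that contribute a canonical polynomial generator to $J$. For $d:\beta\to\{1,2,3,\dots\}$ let $\mathcal J(I,\beta,d)$ be the set of $J\in\mathcal J(I,\beta)$ with $\deg f_C=d(C)$ for all $C\in\beta$. Let $A_n=\{(a_1,\dots,a_n)\in\mathbb F^n: a_n\neq 0\}$, with the Zariski topology, and identify $(a_1,\dots,a_n)\in A_n$ with the polynomial $1+a_1x+\cdots+a_nx^n$. Then the following hold. 1. For each $d$, mapping $J$ to the coefficients of its canonical polynomials is a bijection $\mathcal J(I,\beta,d)\to\prod_{C\in\beta}A_{d(C)}$; the sets $A_{d(C)}$ are called the affine factors. 2. An ideal $J\in\mathcal J(I,\beta,d)$ is dlf if and only if the discriminant of $f_C$ is nonzero for every $C\in\beta$. 3. For each $d$ and $C\in\beta$, the image of the set of dlf ideals of $\mathcal J(I,\beta,d)$ in the affine factor $A_{d(C)}$ is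 the set of all polynomials in $A_{d(C)}$ with nonzero discriminant, and it is open and dense in $A_{d(C)}$. 4. The set of dlf ideals is open and dense in $\mathcal J(I,\beta,d)$ for the topology with basis $\{\prod_{C\in\beta}U_C : U_C\subseteq A_{d(C)}\text{ open}\}$. It is also dense in $\mathcal J(I,\beta,d)$ for the Zariski topology defined by polynomials in all the coefficients, and open for this topology if $\beta$ is finite. 5. Give $\mathcal J(I,\beta)$ the topology in which a subset is open if and only if its intersection with $\mathcal J(I,\beta,d)$ is open for every $d$. Then, for either choice of the topologies on the $\mathcal J(I,\beta,d)$ in 4, the set of dlf ideals is dense in $\mathcal J(I,\beta)$; it is open for the first choice, and also for the second if $\beta$ is finite. 6. If $\mathbb F=\mathbb C$, then 3 and the statements in 4 and 5 about the first topology also hold with the Euclidean topology on the affine factors in place of the Zariski topology (if $\beta$ is finite, the topology on $\mathcal J(I,\beta,d)$ is then the Euclidean topology of $\prod_{C\in\beta} A_{d(C)}$). 7. For every dlf ideal $J\in\mathcal J(I,\beta)$, the quotient $L(\Gamma)/J$ is isomorphic, as an $\mathbb F$-algebra, to the Leavitt path algebra over $\mathbb F$ of some digraph. Hence a generic quotient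 of a Leavitt path algebra is a Leavitt path algebra. -/

import Mathlib

open Polynomial
open scoped Topology

universe u v w

namespace LPA

noncomputable section

/-! ## Digraphs and geometric cycles -/

/-- A digraph: vertices `V`, arrows `E`, source and target maps. -/
structure DiGraph where
  V : Type u
  E : Type v
  src : E → V
  tgt : E → V

namespace DiGraph

/-- A geometric cycle: a nonempty closed path with pairwise distinct sources of arrows, taken up to
rotation (`Cycle` is the type of lists modulo rotation). -/
def IsGeomCycle (Γ : DiGraph.{u, v}) (C : Cycle Γ.E) : Prop :=
  C ≠ Cycle.nil ∧ C.Chain (fun e f => Γ.tgt e = Γ.src f) ∧ (C.map Γ.src).Nodup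

/-- `e` is an exit of `C`: it is not on `C` but its source is. -/
def IsExit (Γ : DiGraph.{u, v}) (C : Cycle Γ.E) (e : Γ.E) : Prop :=
  e ∉ C ∧ Γ.src e ∈ C.map Γ.src

/-- The geometric cycles with no exit. -/
def noExitCycles (Γ : DiGraph.{u, v}) : Set (Cycle Γ.E) :=
  {C | Γ.IsGeomCycle C ∧ ∀ e, ¬ Γ.IsExit C e}

/-- `v` is a breaking vertex of `H`: an infinite emitter that emits a nonzero finite number of
arrows with target outside `H`. -/
def IsBreaking (Γ : DiGraph.{u, v}) (H : Set Γ.V) (x : Γ.V) : Prop :=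
  {e | Γ.src e = x}.Infinite ∧ {e | Γ.src e = x ∧ Γ.tgt e ∉ H}.Finite ∧
    {e | Γ.src e = x ∧ Γ.tgt e ∉ H}.Nonempty

/-- The quotient digraph `Γ / (H, S)`: delete `H`, and for every breaking vertex `x ∈ B_H \ S`
add a sink `x'` and an arrow `e'` from `src e` to `x'` for each arrow `e` with target `x`.
(For `H` hereditary, `tgt e ∉ H` implies `src e ∉ H`, and `B_H` is disjoint from `H`.) -/
def quotient (Γ : DiGraph.{u, v}) (H S : Set Γ.V) : DiGraph.{u, v} where
  V := {x : Γ.V // x ∉ H} ⊕ {x : Γ.V // Γ.IsBreaking H x ∧ x ∉ S}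
  E := {e : Γ.E // Γ.src e ∉ H ∧ Γ.tgt e ∉ H} ⊕
    {e : Γ.E // Γ.src e ∉ H ∧ Γ.IsBreaking H (Γ.tgt e) ∧ Γ.tgt e ∉ S}
  src := Sum.elim (fun e => Sum.inl ⟨Γ.src e.1, e.2.1⟩) (fun e => Sum.inl ⟨Γ.src e.1, e.2.1⟩)
  tgt := Sum.elim (fun e => Sum.inl ⟨Γ.tgt e.1, e.2.2⟩) (fun e => Sum.inr ⟨Γ.tgt e.1, e.2.2⟩)

/-- The arrow of `Γ` from which an arrow of `Γ / (H, S)` comes. A cycle of `Γ / (H, S)` avoids the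
added sinks, so it consists of arrows of `Γ` and is a cycle of `Γ`. -/
def baseArrow (Γ : DiGraph.{u, v}) (H S : Set Γ.V) : (Γ.quotient H S).E → Γ.E :=
  Sum.elim Subtype.val Subtype.val

end DiGraph

/-! ## Leavitt path algebras -/

/-- The generators: vertices, arrows `e` and dual arrows `e*`. -/
inductive Gen (Γ : DiGraph.{u, v}) : Type (max u v)
  | vertex : Γ.V → Gen Γ
  | arrow : Γ.E → Gen Γ
  | dual : Γ.E → Gen Γ

section Algebra

variable (F : Type w) [Field F] (Γ : DiGraph.{u, v})

/-- A generator in the free unital algebra on all generators. -/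
abbrev freeGen (x : Gen Γ) : FreeAlgebra F (Gen Γ) := FreeAlgebra.ι F x

/-- The defining relations of the Leavitt path algebra. -/
inductive Rel : FreeAlgebra F (Gen Γ) → FreeAlgebra F (Gen Γ) → Prop
  | vertex_idem (x : Γ.V) :
      Rel (freeGen F Γ (.vertex x) * freeGen F Γ (.vertex x)) (freeGen F Γ (.vertex x))
  | vertex_orth (x y : Γ.V) (h : x ≠ y) :
      Rel (freeGen F Γ (.vertex x) * freeGen F Γ (.vertex y)) 0
  | src_arrow (e : Γ.E) :
      Rel (freeGen F Γ (.vertex (Γ.src e)) * freeGen F Γ (.arrow e)) (freeGen F Γ (.arrow e))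
  | arrow_tgt (e : Γ.E) :
      Rel (freeGen F Γ (.arrow e) * freeGen F Γ (.vertex (Γ.tgt e))) (freeGen F Γ (.arrow e))
  | tgt_dual (e : Γ.E) :
      Rel (freeGen F Γ (.vertex (Γ.tgt e)) * freeGen F Γ (.dual e)) (freeGen F Γ (.dual e))
  | dual_src (e : Γ.E) :
      Rel (freeGen F Γ (.dual e) * freeGen F Γ (.vertex (Γ.src e))) (freeGen F Γ (.dual e))
  | ck1_same (e : Γ.E) :
      Rel (freeGen F Γ (.dual e) * freeGen F Γ (.arrow e)) (freeGen F Γ (.vertex (Γ.tgt e)))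
  | ck1_diff (e f : Γ.E) (h : e ≠ f) :
      Rel (freeGen F Γ (.dual e) * freeGen F Γ (.arrow f)) 0
  | ck2 (x : Γ.V) (T : Finset Γ.E) (hT : ∀ e, e ∈ T ↔ Γ.src e = x) (hne : T.Nonempty) :
      Rel (freeGen F Γ (.vertex x))
        (∑ e ∈ T, freeGen F Γ (.arrow e) * freeGen F Γ (.dual e))

/-- The unital algebra with the same generators and relations. -/
abbrev UnitalLPA : Type (max u v w) := RingQuot (Rel F Γ)

/-- A generator in `UnitalLPA`. -/
def unitalGen (x : Gen Γ) : UnitalLPA F Γ := RingQuot.mkAlgHom F (Rel F Γ) (freeGen F Γ x)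

/-- The Leavitt path algebra `L_F(Γ)`, as an algebra that need not have a unit: since no relation
has a constant term, the non-unital algebra with the given generators and relations is the
non-unital subalgebra of `UnitalLPA` generated by the vertices, arrows and dual arrows. -/
abbrev L : Type (max u v w) := ↥(NonUnitalAlgebra.adjoin F (Set.range (unitalGen F Γ)))

variable {Γ}

/-- A generator in the Leavitt path algebra. -/
def gen (x : Gen Γ) : L F Γ :=
  ⟨unitalGen F Γ x, NonUnitalAlgebra.subset_adjoin F (Set.mem_range_self x)⟩

variable {F}

/-- `IsMonomial n a`: `a` is a nonempty product of generators of total degree `n`, where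
vertices, arrows and dual arrows have degree `0`, `1`, `-1`. -/
inductive IsMonomial : ℤ → L F Γ → Prop
  | vertex (x : Γ.V) : IsMonomial 0 (gen F (.vertex x))
  | arrow (e : Γ.E) : IsMonomial 1 (gen F (.arrow e))
  | dual (e : Γ.E) : IsMonomial (-1) (gen F (.dual e))
  | mul {m n : ℤ} {a b : L F Γ} (ha : IsMonomial m a) (hb : IsMonomial n b) :
      IsMonomial (m + n) (a * b)

variable (F Γ) in
/-- The homogeneous component of degree `n` of the standard grading. -/
def homogeneous (n : ℤ) : Submodule F (L F Γ) := Submodule.span F {a | IsMonomial n a}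

/-- A two-sided ideal is graded if each of its elements is a sum of homogeneous elements
of the ideal. -/
def IsGraded (I : TwoSidedIdeal (L F Γ)) : Prop :=
  ∀ a ∈ I, a ∈ AddSubmonoid.closure {b : L F Γ | b ∈ I ∧ ∃ n, b ∈ homogeneous F Γ n}

/-- `L_F(Γ) / J` is isomorphic, as an `F`-algebra, to the Leavitt path algebra over `F` of some
digraph. (The scalar action on the quotient is `c • [a] = [c • a]`.) -/
def QuotientIsLPA (J : TwoSidedIdeal (L F Γ)) : Prop :=
  ∃ (Λ : DiGraph.{u, v}) (φ : J.ringCon.Quotient ≃+* L F Λ),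
    ∀ (c : F) (a : L F Γ), φ (RingCon.toQuotient (c • a)) = c • φ (RingCon.toQuotient a)

/-! ## The data attached to an ideal -/

/-- `H = J ∩ V`. -/
def vertexSet (J : TwoSidedIdeal (L F Γ)) : Set Γ.V := {x | gen F (.vertex x) ∈ J}

/-- `S_J`: the breaking vertices `x` of `H = J ∩ V` with
`x^H = x - ∑ e e* ∈ J`, the sum over the (finitely many) arrows `e` from `x` to a vertex
outside `H`. -/
def breakingSet (J : TwoSidedIdeal (L F Γ)) : Set Γ.V :=
  {x | Γ.IsBreaking (vertexSet J) x ∧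
    gen F (.vertex x) - ∑ᶠ e ∈ {e : Γ.E | Γ.src e = x ∧ Γ.tgt e ∉ vertexSet J},
      gen F (.arrow e) * gen F (.dual e) ∈ J}

/-- The digraph `Γ / J`. -/
abbrev quotientGraph (J : TwoSidedIdeal (L F Γ)) : DiGraph.{u, v} :=
  Γ.quotient (vertexSet J) (breakingSet J)

/-- The geometric cycle of `Γ` given by a cycle of `Γ / J`. -/
def baseCycle (J : TwoSidedIdeal (L F Γ)) (C : Cycle (quotientGraph J).E) : Cycle Γ.E :=
  C.map (Γ.baseArrow (vertexSet J) (breakingSet J))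

variable (F) in
/-- The element `e₁ e₂ ⋯ eₙ` of the Leavitt path algebra, for `n > 0`. -/
def pathElem : List Γ.E → L F Γ
  | [] => 0
  | [e] => gen F (.arrow e)
  | e :: f :: l => gen F (.arrow e) * pathElem (f :: l)

variable (F) in
/-- The powers of a closed path `p`, with `p ^ 0 = s(p)`. -/
def pathPow (p : List Γ.E) : ℕ → L F Γ
  | 0 => match p with
    | [] => 0
    | e :: _ => gen F (.vertex (Γ.src e))
  | n + 1 => pathPow p n * pathElem F p

/-- The value `f(p) ∈ F[p]` of a polynomial at a closed path; the constant term of `f` is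
multiplied by the vertex `s(p)`. -/
def pathEval (p : List Γ.E) (f : F[X]) : L F Γ := f.sum fun n a => a • pathPow F p n

/-- `f(C)` is the canonical polynomial generator of `J` at the geometric cycle `C`: for each closed
path `p` in the class `C`, the ideal of `F[x]` that corresponds to `J ∩ F[p]` is proper and
nonzero, and `f` is its generator with `f(0) = 1`. -/
def IsCanonicalPoly (J : TwoSidedIdeal (L F Γ)) (C : Cycle Γ.E) (f : F[X]) : Prop :=
  f.coeff 0 = 1 ∧ 0 < f.natDegree ∧
    ∀ p : List Γ.E, (p : Cycle Γ.E) = C → ∀ g : F[X], pathEval p g ∈ J ↔ f ∣ g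

/-- A canonical polynomial is unique. -/
theorem IsCanonicalPoly.unique {J : TwoSidedIdeal (L F Γ)} {C : Cycle Γ.E} {f g : F[X]}
    (hf : IsCanonicalPoly J C f) (hg : IsCanonicalPoly J C g) : f = g := by
  obtain ⟨p, rfl⟩ := Quotient.exists_rep C
  have h1 : f ∣ g := (hf.2.2 p rfl g).1 ((hg.2.2 p rfl g).2 dvd_rfl)
  have h2 : g ∣ f := (hg.2.2 p rfl f).1 ((hf.2.2 p rfl f).2 dvd_rfl)
  obtain ⟨a, ha, rfl⟩ : ∃ a : F, IsUnit a ∧ g = f * Polynomial.C a := by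
    obtain ⟨c, hc⟩ := associated_of_dvd_dvd h1 h2
    obtain ⟨r, hr, hrc⟩ := Polynomial.isUnit_iff.1 c.isUnit
    exact ⟨r, hr, by rw [hrc, hc]⟩
  have h3 := hg.1
  rw [Polynomial.coeff_mul_C, hf.1, one_mul] at h3
  simp [h3]

open Classical in
/-- The canonical polynomial `f_C` of `J` at `C` (and `1` if there is none). -/
def canonicalPoly (J : TwoSidedIdeal (L F Γ)) (C : Cycle Γ.E) : F[X] :=
  if h : ∃ f, IsCanonicalPoly J C f then h.choose else 1

theorem canonicalPoly_eq {J : TwoSidedIdeal (L F Γ)} {C : Cycle Γ.E} {f : F[X]}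
    (hf : IsCanonicalPoly J C f) : canonicalPoly J C = f := by
  have h : ∃ f, IsCanonicalPoly J C f := ⟨f, hf⟩
  rw [canonicalPoly, dif_pos h]
  exact h.choose_spec.unique hf

/-- `f` is a product of distinct linear factors. -/
def HasDistinctLinearFactors (f : F[X]) : Prop := f.Splits ∧ f.roots.Nodup

/-- `J` is a dlf ideal: all its canonical polynomial generators are products of distinct
linear factors. -/
def IsDlf (J : TwoSidedIdeal (L F Γ)) : Prop :=
  ∀ C : Cycle Γ.E, Γ.IsGeomCycle C → ∀ f, IsCanonicalPoly J C f → HasDistinctLinearFactors f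

/-! ## The strata and their parametrization -/

/-- The stratum `𝒥(I, β)`: the ideals `J` such that `I` is the largest graded ideal contained
in `J` and `β` is the set of cycles with no exit in `Γ / I` that contribute a canonical polynomial
generator to `J`. -/
def stratum (I : TwoSidedIdeal (L F Γ)) (β : Set (Cycle (quotientGraph I).E)) :
    Set (TwoSidedIdeal (L F Γ)) :=
  {J | IsGreatest {K | IsGraded K ∧ K ≤ J} I ∧
    {C | C ∈ (quotientGraph I).noExitCycles ∧ ∃ f, IsCanonicalPoly J (baseCycle I C) f} = β}

/-- The stratum `𝒥(I, β, d)`: moreover the canonical polynomial at `C ∈ β` has degree `d C`. -/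
def stratumDeg (I : TwoSidedIdeal (L F Γ)) (β : Set (Cycle (quotientGraph I).E)) (d : β → ℕ+) :
    Set (TwoSidedIdeal (L F Γ)) :=
  {J | J ∈ stratum I β ∧ ∀ C : β, (canonicalPoly J (baseCycle I C)).natDegree = d C}

variable (F) in
/-- The affine factor of degree `n`: the tuples `(a₁, …, aₙ)` with `aₙ ≠ 0`; here `a i` stands
for `a_{i+1}`. -/
def Factor (n : ℕ) : Type w := {a : Fin n → F // ∀ i : Fin n, (i : ℕ) + 1 = n → a i ≠ 0}

/-- The polynomial `1 + a₁ x + ⋯ + aₙ xⁿ`. -/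
def Factor.poly {n : ℕ} (a : Factor F n) : F[X] := 1 + ∑ i : Fin n, C (a.1 i) * X ^ ((i : ℕ) + 1)

/-- The parameter space of `𝒥(I, β, d)`. -/
abbrev Param (I : TwoSidedIdeal (L F Γ)) (β : Set (Cycle (quotientGraph I).E)) (d : β → ℕ+) :
    Type (max v w) := ∀ C : β, Factor F (d C : ℕ)

/-- The parametrization of `𝒥(I, β, d)`: the coefficients of the canonical polynomials. -/
def coeffMap (I : TwoSidedIdeal (L F Γ)) (β : Set (Cycle (quotientGraph I).E)) (d : β → ℕ+)
    (J : stratumDeg I β d) : Param I β d := fun C =>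
  ⟨fun i => (canonicalPoly J.1 (baseCycle I C)).coeff ((i : ℕ) + 1), fun i hi => by
    have h := J.2.2 C
    have h0 : canonicalPoly J.1 (baseCycle I C) ≠ 0 := by
      intro h0
      rw [h0, natDegree_zero] at h
      exact (d C).ne_zero h.symm
    change (canonicalPoly J.1 (baseCycle I C)).coeff ((i : ℕ) + 1) ≠ 0
    rw [hi, ← h]
    exact leadingCoeff_ne_zero.2 h0⟩

/-! ## Topologies -/

/-- `U` is open and dense for the topology `τ`. -/
def OpenDense {X : Type*} (τ : TopologicalSpace X) (U : Set X) : Prop :=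
  IsOpen[τ] U ∧ @Dense X τ U

/-- The Zariski topology on the affine space `F^σ`: the closed sets are the zero loci of sets of
polynomials, i.e. the sets `{a | p(a) ≠ 0}` are a basis of open sets. -/
@[reducible] def zariski (F : Type w) [Field F] (σ : Type*) : TopologicalSpace (σ → F) :=
  TopologicalSpace.generateFrom
    {U | ∃ p : MvPolynomial σ F, U = {a | MvPolynomial.eval a p ≠ 0}}

/-- The box topology on a product, with the products of open sets as a basis. It is the product
topology if the index set is finite. -/
@[reducible] def boxTopology {ι : Type*} {X : ι → Type*} (τ : ∀ i, TopologicalSpace (X i)) :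
    TopologicalSpace (∀ i, X i) :=
  TopologicalSpace.generateFrom
    {U | ∃ W : ∀ i, Set (X i), (∀ i, IsOpen[τ i] (W i)) ∧ U = Set.univ.pi W}

/-- The Zariski topology on an affine factor, as a subspace of `F^n`. -/
@[reducible] def factorZariski (F : Type w) [Field F] (n : ℕ) : TopologicalSpace (Factor F n) :=
  (zariski F (Fin n)).induced Subtype.val

/-- The Euclidean topology on an affine factor, as a subspace of `F^n = ℂ^n`, when `F` is
identified with `ℂ`. -/
@[reducible] def factorEuclidean {F : Type w} [Field F] (ι : F ≃+* ℂ) (n : ℕ) : TopologicalSpace (Factor F n) :=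
  TopologicalSpace.induced (fun (a : Factor F n) (i : Fin n) => ι (a.1 i))
    (inferInstance : TopologicalSpace (Fin n → ℂ))

/-- The topology on `𝒥(I, β, d)` given by the box topology on the product of the affine
factors. -/
@[reducible] def boxStratum (τ : ∀ n, TopologicalSpace (Factor F n)) (I : TwoSidedIdeal (L F Γ))
    (β : Set (Cycle (quotientGraph I).E)) (d : β → ℕ+) : TopologicalSpace (stratumDeg I β d) :=
  (boxTopology fun C : β => τ (d C)).induced (coeffMap I β d)

/-- The Zariski topology on `𝒥(I, β, d)`, as a subspace of the affine space of all
coefficients of all canonical polynomials. -/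
@[reducible] def zariskiStratum (I : TwoSidedIdeal (L F Γ)) (β : Set (Cycle (quotientGraph I).E))
    (d : β → ℕ+) : TopologicalSpace (stratumDeg I β d) :=
  (zariski F (Σ C : β, Fin (d C))).induced fun J x => (coeffMap I β d J x.1).1 x.2

/-- The topology on `𝒥(I, β)` generated by topologies on the subsets `𝒥(I, β, d)`: a subset is
open if and only if its intersection with each `𝒥(I, β, d)` is open. -/
@[reducible] def glue {I : TwoSidedIdeal (L F Γ)} {β : Set (Cycle (quotientGraph I).E)}
    (τ : ∀ d : β → ℕ+, TopologicalSpace (stratumDeg I β d)) : TopologicalSpace (stratum I β) where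
  IsOpen U := ∀ d, IsOpen[τ d] {J : stratumDeg I β d | (⟨J.1, J.2.1⟩ : stratum I β) ∈ U}
  isOpen_univ d := by simpa using (τ d).isOpen_univ
  isOpen_inter U W hU hW d := (τ d).isOpen_inter _ _ (hU d) (hW d)
  isOpen_sUnion S hS d := by
    have h : {J : stratumDeg I β d | (⟨J.1, J.2.1⟩ : stratum I β) ∈ ⋃₀ S} =
        ⋃₀ ((fun U => {J : stratumDeg I β d | (⟨J.1, J.2.1⟩ : stratum I β) ∈ U}) '' S) := by
      ext J; simp
    rw [h]
    apply (τ d).isOpen_sUnion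
    rintro _ ⟨U, hU, rfl⟩
    exact hS U hU d

end Algebra

end

end LPA

/-!
Strata of ideals of a Leavitt path algebra, and the genericity of the dlf ideals.

Uniqueness. An ideal `J` is determined by its vertices `H`, its elements `x^H` for breaking vertices
`x`, and the polynomials in cycles with no exit in `Γ / J` that it contains (`le_of_generators`). To
see this, multiplication on the right by arrows reduces an element of `J` to a combination of paths
with a common end `x`, and peeling off first arrows reduces it further to a combination of `x` and
closed paths at `x`. If the coefficient of `x` is not zero and `x ∉ J`, then conjugation by arrows
would remove closed paths at every branching, so that nothing can branch off from `x`
(`isLinear_of_mem`), and the combination is a polynomial in a cycle with no exit. If moreover `J`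
and `J'` contain the same largest graded ideal, they have the same `H` and the same `x^H`, hence an
ideal in a stratum is determined by its canonical polynomials (`eq_of_canonicalPoly_eq`).

Existence. The Leavitt path algebra of a digraph acts on a free module over a commutative algebra
`B`, with arbitrary units of `B` as weights of the arrows, in such a way that no vertex acts as zero
and a cycle with no exit acts as the product of its weights (`rep_pathEval_eq_zero_iff`). For
`Γ / I` and suitable weights, the kernel of this representation, pulled back to the Leavitt path
algebra of `Γ`, is the ideal with given canonical polynomials (`kerIdeal_mem_stratum`,
`exists_mem_stratum`). Together this gives `coeffMap_bijective`.

Quotients by dlf ideals. If `f_C` is the product of distinct factors `1 - x / r_i` for `i < d`, one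
replaces `C` by `d` copies and removes one arrow from each copy. In the resulting digraph that
arrow can be represented by `r_i` times the inverse of the rest of the copy, which gives a
homomorphism from the Leavitt path algebra of `Γ / I` (`cutCopiesHom`). By the Chinese remainder
theorem, in the form of Lagrange interpolation, it is surjective (`cutCopiesHom_image`), and its
kernel, pulled back to the Leavitt path algebra of `Γ`, has the canonical polynomials `f_C`, so that
it is `J` by uniqueness (`IsDlf.quotientIsLPA`).

Genericity. Over an algebraically closed field, a polynomial of positive degree has distinct roots
if and only if its discriminant does not vanish, and on an affine factor the nonvanishing of the
discriminant is the nonvanishing of a nonzero polynomial in the coefficients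
(`exists_discriminant_polynomial`). The statements on open dense sets follow for the affine factors
and then for the box topologies. A polynomial in all coefficients involves only finitely many of
them, which gives density for the Zariski topology of the whole parameter space
(`dense_zariskiStratum`).
-/

namespace LPA

noncomputable section

section Relations

variable {F : Type w} [Field F] {Γ : DiGraph.{u, v}}

/-! ### Defining relations -/

/-- The additive group of `L F Γ` that underlies its ring structure. The instances found otherwise
come from `AddSubgroupClass`, and with them lemmas such as `mul_sub` cannot be used for
rewriting. -/
instance instAddCommGroupL : AddCommGroup (L F Γ) :=
  (inferInstance : NonUnitalRing (L F Γ)).toAddCommGroup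

/-- See `instAddCommGroupL`. -/
instance instAddGroupL : AddGroup (L F Γ) := instAddCommGroupL.toAddGroup

/-- See `instAddCommGroupL`. -/
instance instSubL : Sub (L F Γ) := instAddGroupL.toSub

theorem unitalGen_rel {a b : FreeAlgebra F (Gen Γ)} (h : Rel F Γ a b) :
    RingQuot.mkAlgHom F (Rel F Γ) a = RingQuot.mkAlgHom F (Rel F Γ) b :=
  RingQuot.mkAlgHom_rel F h

@[simp] theorem coe_gen (x : Gen Γ) : (gen F x : UnitalLPA F Γ) = unitalGen F Γ x := rfl

theorem vertex_mul_self (x : Γ.V) :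
    gen F (.vertex x) * gen F (.vertex x) = gen F (.vertex x) :=
  Subtype.ext (by simpa [unitalGen] using unitalGen_rel (Rel.vertex_idem (F := F) x))

theorem vertex_mul_of_ne {x y : Γ.V} (h : x ≠ y) :
    gen F (.vertex x) * gen F (.vertex y) = 0 :=
  Subtype.ext (by simpa [unitalGen] using unitalGen_rel (Rel.vertex_orth (F := F) x y h))

theorem src_mul_arrow (e : Γ.E) :
    gen F (.vertex (Γ.src e)) * gen F (.arrow e) = gen F (.arrow e) :=
  Subtype.ext (by simpa [unitalGen] using unitalGen_rel (Rel.src_arrow (F := F) e))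

theorem arrow_mul_tgt (e : Γ.E) :
    gen F (.arrow e) * gen F (.vertex (Γ.tgt e)) = gen F (.arrow e) :=
  Subtype.ext (by simpa [unitalGen] using unitalGen_rel (Rel.arrow_tgt (F := F) e))

theorem tgt_mul_dual (e : Γ.E) :
    gen F (.vertex (Γ.tgt e)) * gen F (.dual e) = gen F (.dual e) :=
  Subtype.ext (by simpa [unitalGen] using unitalGen_rel (Rel.tgt_dual (F := F) e))

theorem dual_mul_src (e : Γ.E) :
    gen F (.dual e) * gen F (.vertex (Γ.src e)) = gen F (.dual e) :=
  Subtype.ext (by simpa [unitalGen] using unitalGen_rel (Rel.dual_src (F := F) e))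

theorem dual_mul_arrow_self (e : Γ.E) :
    gen F (.dual e) * gen F (.arrow e) = gen F (.vertex (Γ.tgt e)) :=
  Subtype.ext (by simpa [unitalGen] using unitalGen_rel (Rel.ck1_same (F := F) e))

theorem dual_mul_arrow_of_ne {e f : Γ.E} (h : e ≠ f) :
    gen F (.dual e) * gen F (.arrow f) = 0 :=
  Subtype.ext (by simpa [unitalGen] using unitalGen_rel (Rel.ck1_diff (F := F) e f h))

theorem vertex_eq_sum (x : Γ.V) (T : Finset Γ.E) (hT : ∀ e, e ∈ T ↔ Γ.src e = x)
    (hne : T.Nonempty) :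
    gen F (.vertex x) = ∑ e ∈ T, gen F (.arrow e) * gen F (.dual e) :=
  Subtype.ext (by
    simpa [unitalGen, map_sum] using unitalGen_rel (Rel.ck2 (F := F) x T hT hne))

open Classical in
theorem vertex_mul_vertex (x y : Γ.V) : gen F (.vertex x) * gen F (.vertex y) =
    if x = y then gen F (.vertex x) else 0 := by
  split_ifs with h
  · rw [h, vertex_mul_self]
  · exact vertex_mul_of_ne h

open Classical in
theorem dual_mul_arrow (e f : Γ.E) : gen F (.dual e) * gen F (.arrow f) =
    if e = f then gen F (.vertex (Γ.tgt e)) else 0 := by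
  split_ifs with h
  · rw [h, dual_mul_arrow_self]
  · exact dual_mul_arrow_of_ne h

open Classical in
theorem vertex_mul_arrow (x : Γ.V) (e : Γ.E) : gen F (.vertex x) * gen F (.arrow e) =
    if x = Γ.src e then gen F (.arrow e) else 0 := by
  rw [← src_mul_arrow, ← mul_assoc, vertex_mul_vertex]
  split_ifs with h <;> simp [h]

open Classical in
theorem arrow_mul_vertex (x : Γ.V) (e : Γ.E) : gen F (.arrow e) * gen F (.vertex x) =
    if Γ.tgt e = x then gen F (.arrow e) else 0 := by
  rw [← arrow_mul_tgt, mul_assoc, vertex_mul_vertex]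
  split_ifs with h <;> simp

open Classical in
theorem vertex_mul_dual (x : Γ.V) (e : Γ.E) : gen F (.vertex x) * gen F (.dual e) =
    if x = Γ.tgt e then gen F (.dual e) else 0 := by
  rw [← tgt_mul_dual, ← mul_assoc, vertex_mul_vertex]
  split_ifs with h <;> simp [h]

open Classical in
theorem dual_mul_vertex (x : Γ.V) (e : Γ.E) : gen F (.dual e) * gen F (.vertex x) =
    if Γ.src e = x then gen F (.dual e) else 0 := by
  rw [← dual_mul_src, mul_assoc, vertex_mul_vertex]
  split_ifs with h <;> simp

/-- Induction principle: `L_F(Γ)` is spanned by products of generators. -/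
theorem L_induction {P : L F Γ → Prop} (hgen : ∀ x, P (gen F x))
    (hadd : ∀ a b, P a → P b → P (a + b))
    (h0 : P 0) (hmul : ∀ a b, P a → P b → P (a * b)) (hsmul : ∀ (c : F) a, P a → P (c • a))
    (a : L F Γ) : P a := by
  obtain ⟨a, ha⟩ := a
  induction ha using NonUnitalAlgebra.adjoin_induction with
  | mem x hx => obtain ⟨x, rfl⟩ := hx; exact hgen x
  | add x y hx hy h1 h2 => exact hadd _ _ h1 h2
  | zero => exact h0
  | mul x y hx hy h1 h2 => exact hmul _ _ h1 h2
  | smul c x hx h => exact hsmul c _ h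

end Relations

/-! ### The universal property -/

section Lift

variable {F : Type w} [Field F] {Γ : DiGraph.{u, v}} {A : Type*} [Ring A] [Algebra F A]

/-- Elements `P x`, `S e`, `S' e` of an algebra that satisfy the defining relations of the Leavitt
path algebra of `Γ`, with `S' e` in the role of `e*`. -/
structure IsFamily (Γ : DiGraph.{u, v}) (P : Γ.V → A) (S S' : Γ.E → A) : Prop where
  idem : ∀ x, P x * P x = P x
  orth : ∀ x y, x ≠ y → P x * P y = 0
  src_mul : ∀ e, P (Γ.src e) * S e = S e
  mul_tgt : ∀ e, S e * P (Γ.tgt e) = S e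
  tgt_mul : ∀ e, P (Γ.tgt e) * S' e = S' e
  mul_src : ∀ e, S' e * P (Γ.src e) = S' e
  same : ∀ e, S' e * S e = P (Γ.tgt e)
  diff : ∀ e f, e ≠ f → Γ.src e = Γ.src f → S' e * S f = 0
  ck2 : ∀ x (T : Finset Γ.E), (∀ e, e ∈ T ↔ Γ.src e = x) → T.Nonempty →
    P x = ∑ e ∈ T, S e * S' e

/-- The values of a family on the generators. -/
def familyFun (P : Γ.V → A) (S S' : Γ.E → A) : Gen Γ → A
  | .vertex x => P x
  | .arrow e => S e
  | .dual e => S' e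

theorem IsFamily.lift_rel {P : Γ.V → A} {S S' : Γ.E → A} (h : IsFamily Γ P S S')
    ⦃a b : FreeAlgebra F (Gen Γ)⦄ (hab : Rel F Γ a b) :
    FreeAlgebra.lift F (familyFun P S S') a = FreeAlgebra.lift F (familyFun P S S') b := by
  cases hab with
  | vertex_idem x => simpa [familyFun] using h.idem x
  | vertex_orth x y hxy => simpa [familyFun] using h.orth x y hxy
  | src_arrow e => simpa [familyFun] using h.src_mul e
  | arrow_tgt e => simpa [familyFun] using h.mul_tgt e
  | tgt_dual e => simpa [familyFun] using h.tgt_mul e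
  | dual_src e => simpa [familyFun] using h.mul_src e
  | ck1_same e => simpa [familyFun] using h.same e
  | ck1_diff e f hef =>
    by_cases hs : Γ.src e = Γ.src f
    · simpa [familyFun] using h.diff e f hef hs
    · have : S' e * S f = 0 := by
        rw [← h.mul_src e, ← h.src_mul f, mul_assoc, ← mul_assoc (P _), h.orth _ _ hs]
        simp
      simpa [familyFun] using this
  | ck2 x T hT hne => simpa [familyFun, map_sum] using h.ck2 x T hT hne

/-- The algebra homomorphism given by a family. -/
def IsFamily.lift (F : Type w) [Field F] [Algebra F A] {P : Γ.V → A} {S S' : Γ.E → A}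
    (h : IsFamily Γ P S S') :
    UnitalLPA F Γ →ₐ[F] A :=
  RingQuot.liftAlgHom F ⟨FreeAlgebra.lift F (familyFun P S S'), h.lift_rel⟩

theorem IsFamily.lift_gen {P : Γ.V → A} {S S' : Γ.E → A} (h : IsFamily Γ P S S') (x : Gen Γ) :
    h.lift F (unitalGen F Γ x) = familyFun P S S' x := by
  simp [IsFamily.lift, unitalGen]

/-- The kernel in `L_F(Γ)` of a homomorphism defined on the unital algebra. -/
def kerIdeal (φ : UnitalLPA F Γ →ₐ[F] A) : TwoSidedIdeal (L F Γ) :=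
  TwoSidedIdeal.ker ((φ : UnitalLPA F Γ →ₙₐ[F] A).comp
    (NonUnitalSubalgebraClass.subtype (NonUnitalAlgebra.adjoin F (Set.range (unitalGen F Γ)))))

theorem mem_kerIdeal {φ : UnitalLPA F Γ →ₐ[F] A} {a : L F Γ} : a ∈ kerIdeal φ ↔ φ a = 0 :=
  TwoSidedIdeal.mem_ker _

end Lift

/-! ### Ideals: scalars, local units, hereditary and saturated sets -/

section Ideals

variable {F : Type w} [Field F] {Γ : DiGraph.{u, v}}

/-- Local units: every element is fixed by a finite sum of vertices on either side. -/
theorem exists_local_unit (a : L F Γ) : ∃ T : Finset Γ.V, ∀ T', T ⊆ T' →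
    (∑ x ∈ T', gen F (.vertex x)) * a = a ∧ a * (∑ x ∈ T', gen F (.vertex x)) = a := by
  classical
  have key : ∀ (x y : Γ.V) (a : L F Γ), gen F (.vertex x) * a = a → a * gen F (.vertex y) = a →
      ∃ T : Finset Γ.V, ∀ T', T ⊆ T' →
        (∑ x ∈ T', gen F (.vertex x)) * a = a ∧ a * (∑ x ∈ T', gen F (.vertex x)) = a := by
    intro x y a hx hy
    refine ⟨{x, y}, fun T' hT => ⟨?_, ?_⟩⟩
    · rw [← hx, ← mul_assoc, Finset.sum_mul, Finset.sum_eq_single_of_mem x (hT (by simp))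
        (fun z _ hz => vertex_mul_of_ne hz), vertex_mul_self]
    · rw [← hy, mul_assoc, Finset.mul_sum, Finset.sum_eq_single_of_mem y (hT (by simp))
        (fun z _ hz => vertex_mul_of_ne hz.symm), vertex_mul_self]
  induction a using L_induction with
  | hgen g =>
    cases g with
    | vertex x => exact key x x _ (vertex_mul_self x) (vertex_mul_self x)
    | arrow e => exact key _ _ _ (src_mul_arrow e) (arrow_mul_tgt e)
    | dual e => exact key _ _ _ (tgt_mul_dual e) (dual_mul_src e)
  | hadd a b ha hb =>
    obtain ⟨T, hT⟩ := ha
    obtain ⟨U, hU⟩ := hb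
    refine ⟨T ∪ U, fun T' h => ?_⟩
    have h1 := hT T' (Finset.union_subset_left h)
    have h2 := hU T' (Finset.union_subset_right h)
    exact ⟨by rw [mul_add, h1.1, h2.1], by rw [add_mul, h1.2, h2.2]⟩
  | h0 => exact ⟨∅, by simp⟩
  | hmul a b ha hb =>
    obtain ⟨T, hT⟩ := ha
    obtain ⟨U, hU⟩ := hb
    refine ⟨T ∪ U, fun T' h => ?_⟩
    have h1 := hT T' (Finset.union_subset_left h)
    have h2 := hU T' (Finset.union_subset_right h)
    exact ⟨by rw [← mul_assoc, h1.1], by rw [mul_assoc, h2.2]⟩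
  | hsmul c a ha =>
    obtain ⟨T, hT⟩ := ha
    refine ⟨T, fun T' h => ?_⟩
    have h1 := hT T' h
    exact ⟨by rw [mul_smul_comm, h1.1], by rw [smul_mul_assoc, h1.2]⟩

/-- Two-sided ideals are closed under scalars, because of the local units. -/
theorem smul_mem_ideal (J : TwoSidedIdeal (L F Γ)) (c : F) {a : L F Γ} (ha : a ∈ J) :
    c • a ∈ J := by
  obtain ⟨T, hT⟩ := exists_local_unit a
  have h : c • a = (c • ∑ x ∈ T, gen F (.vertex x)) * a := by
    rw [smul_mul_assoc, (hT T subset_rfl).1]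
  rw [h]
  exact J.mul_mem_left _ _ ha

theorem mem_of_smul_mem {J : TwoSidedIdeal (L F Γ)} {c : F} (hc : c ≠ 0) {a : L F Γ}
    (ha : c • a ∈ J) : a ∈ J := by
  simpa [smul_smul, inv_mul_cancel₀ hc] using smul_mem_ideal J c⁻¹ ha

theorem mem_of_forall_mul_vertex {J : TwoSidedIdeal (L F Γ)} {a : L F Γ}
    (h : ∀ x, a * gen F (.vertex x) ∈ J) : a ∈ J := by
  obtain ⟨T, hT⟩ := exists_local_unit a
  rw [← (hT T subset_rfl).2, Finset.mul_sum]
  exact sum_mem fun x _ => h x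

theorem mem_of_forall_vertex_mul {J : TwoSidedIdeal (L F Γ)} {a : L F Γ}
    (h : ∀ x, gen F (.vertex x) * a ∈ J) : a ∈ J := by
  obtain ⟨T, hT⟩ := exists_local_unit a
  rw [← (hT T subset_rfl).1, Finset.sum_mul]
  exact sum_mem fun x _ => h x

theorem mem_vertexSet {J : TwoSidedIdeal (L F Γ)} {x : Γ.V} :
    x ∈ vertexSet J ↔ gen F (.vertex x) ∈ J := Iff.rfl

theorem arrow_mem_of_tgt {J : TwoSidedIdeal (L F Γ)} {e : Γ.E} (h : Γ.tgt e ∈ vertexSet J) :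
    gen F (.arrow e) ∈ J := by
  rw [← arrow_mul_tgt]; exact J.mul_mem_left _ _ h

theorem dual_mem_of_tgt {J : TwoSidedIdeal (L F Γ)} {e : Γ.E} (h : Γ.tgt e ∈ vertexSet J) :
    gen F (.dual e) ∈ J := by
  rw [← tgt_mul_dual]; exact J.mul_mem_right _ _ h

/-- The set of vertices of an ideal is hereditary. -/
theorem tgt_mem_vertexSet {J : TwoSidedIdeal (L F Γ)} {e : Γ.E} (h : Γ.src e ∈ vertexSet J) :
    Γ.tgt e ∈ vertexSet J := by
  have h1 : gen F (.dual e) * gen F (.vertex (Γ.src e)) * gen F (.arrow e) ∈ J :=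
    J.mul_mem_right _ _ (J.mul_mem_left _ _ h)
  rwa [dual_mul_src, dual_mul_arrow_self] at h1

theorem src_notMem_vertexSet {J : TwoSidedIdeal (L F Γ)} {e : Γ.E} (h : Γ.tgt e ∉ vertexSet J) :
    Γ.src e ∉ vertexSet J := fun h' => h (tgt_mem_vertexSet h')

/-- The set of vertices of an ideal is saturated. -/
theorem mem_vertexSet_of_forall {J : TwoSidedIdeal (L F Γ)} {x : Γ.V}
    (hfin : {e | Γ.src e = x}.Finite) (hne : {e | Γ.src e = x}.Nonempty)
    (h : ∀ e, Γ.src e = x → Γ.tgt e ∈ vertexSet J) : x ∈ vertexSet J := by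
  rw [mem_vertexSet, vertex_eq_sum x hfin.toFinset (by simp) (by simpa using hne)]
  refine sum_mem fun e he => J.mul_mem_right _ _ (arrow_mem_of_tgt (h e (by simpa using he)))

variable (F) in
/-- The element `x - ∑ e e*`, the sum over the arrows `e` from `x` to a vertex outside `H`. -/
def breakElem (H : Set Γ.V) (x : Γ.V) : L F Γ :=
  gen F (.vertex x) - ∑ᶠ e ∈ {e : Γ.E | Γ.src e = x ∧ Γ.tgt e ∉ H},
      gen F (.arrow e) * gen F (.dual e)

theorem mem_breakingSet {J : TwoSidedIdeal (L F Γ)} {x : Γ.V} :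
    x ∈ breakingSet J ↔ Γ.IsBreaking (vertexSet J) x ∧ breakElem F (vertexSet J) x ∈ J := Iff.rfl

theorem breakElem_eq {H : Set Γ.V} {x : Γ.V} (h : {e | Γ.src e = x ∧ Γ.tgt e ∉ H}.Finite) :
    breakElem F H x =
      gen F (.vertex x) - ∑ e ∈ h.toFinset, gen F (.arrow e) * gen F (.dual e) := by
  rw [breakElem, finsum_mem_eq_finite_toFinset_sum _ h]

theorem dual_mul_breakElem {H : Set Γ.V} {x : Γ.V} (h : {e | Γ.src e = x ∧ Γ.tgt e ∉ H}.Finite)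
    {e : Γ.E} (he : Γ.tgt e ∉ H) : gen F (.dual e) * breakElem F H x = 0 := by
  classical
  rw [breakElem_eq h, mul_sub, Finset.mul_sum]
  by_cases hs : Γ.src e = x
  · rw [Finset.sum_eq_single_of_mem e (by simp [hs, he])]
    · subst hs
      rw [← mul_assoc, dual_mul_arrow_self, tgt_mul_dual, dual_mul_src, sub_self]
    · intro f _ hf
      rw [← mul_assoc, dual_mul_arrow_of_ne hf.symm, zero_mul]
  · rw [dual_mul_vertex, if_neg hs, Finset.sum_eq_zero, sub_zero]
    intro f hf
    have hf' : Γ.src f = x := by simp at hf; exact hf.1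
    rw [← mul_assoc, dual_mul_arrow_of_ne (by rintro rfl; exact hs hf'), zero_mul]

theorem breakElem_mul_arrow {H : Set Γ.V} {x : Γ.V} (h : {e | Γ.src e = x ∧ Γ.tgt e ∉ H}.Finite)
    {e : Γ.E} (he : Γ.tgt e ∉ H) : breakElem F H x * gen F (.arrow e) = 0 := by
  classical
  rw [breakElem_eq h, sub_mul, Finset.sum_mul]
  by_cases hs : Γ.src e = x
  · rw [Finset.sum_eq_single_of_mem e (by simp [hs, he])]
    · subst hs
      rw [mul_assoc, dual_mul_arrow_self, arrow_mul_tgt, src_mul_arrow, sub_self]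
    · intro f _ hf
      rw [mul_assoc, dual_mul_arrow_of_ne hf, mul_zero]
  · rw [vertex_mul_arrow, if_neg (Ne.symm hs), Finset.sum_eq_zero, sub_zero]
    intro f hf
    have hf' : Γ.src f = x := by simp at hf; exact hf.1
    rw [mul_assoc, dual_mul_arrow_of_ne (by rintro rfl; exact hs hf'), mul_zero]

theorem breakElem_mul_vertex {H : Set Γ.V} {x : Γ.V}
    (h : {e | Γ.src e = x ∧ Γ.tgt e ∉ H}.Finite) :
    breakElem F H x * gen F (.vertex x) = breakElem F H x := by
  rw [breakElem_eq h, sub_mul, vertex_mul_self, Finset.sum_mul]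
  congr 1
  refine Finset.sum_congr rfl fun e he => ?_
  have he' : Γ.src e = x := by simp at he; exact he.1
  rw [mul_assoc, ← he', dual_mul_src]

theorem breakElem_mul_self {H : Set Γ.V} {x : Γ.V}
    (h : {e | Γ.src e = x ∧ Γ.tgt e ∉ H}.Finite) :
    breakElem F H x * breakElem F H x = breakElem F H x := by
  nth_rewrite 2 [breakElem_eq h]
  rw [mul_sub, breakElem_mul_vertex h, Finset.mul_sum, Finset.sum_eq_zero, sub_zero]
  intro e he
  have he' : Γ.tgt e ∉ H := by simp at he; exact he.2
  rw [← mul_assoc, breakElem_mul_arrow h he', zero_mul]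

end Ideals

/-! ### Paths -/

namespace DiGraph

variable {Γ : DiGraph.{u, v}}

/-- `l` is a path from `x` to `y`. -/
def IsPath (Γ : DiGraph.{u, v}) : Γ.V → List Γ.E → Γ.V → Prop
  | x, [], y => x = y
  | x, e :: l, y => Γ.src e = x ∧ IsPath Γ (Γ.tgt e) l y

@[simp] theorem isPath_nil {x y : Γ.V} : Γ.IsPath x [] y ↔ x = y := Iff.rfl

@[simp] theorem isPath_cons {x y : Γ.V} {e : Γ.E} {l : List Γ.E} :
    Γ.IsPath x (e :: l) y ↔ Γ.src e = x ∧ Γ.IsPath (Γ.tgt e) l y := Iff.rfl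

theorem isPath_append {x z : Γ.V} {l m : List Γ.E} :
    Γ.IsPath x (l ++ m) z ↔ ∃ y, Γ.IsPath x l y ∧ Γ.IsPath y m z := by
  induction l generalizing x with
  | nil => simp
  | cons e l ih => simp [ih, and_assoc]

theorem IsPath.append {x y z : Γ.V} {l m : List Γ.E} (hl : Γ.IsPath x l y) (hm : Γ.IsPath y m z) :
    Γ.IsPath x (l ++ m) z := isPath_append.2 ⟨y, hl, hm⟩

theorem IsPath.end_unique {x y z : Γ.V} {l : List Γ.E} (h : Γ.IsPath x l y) (h' : Γ.IsPath x l z) :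
    y = z := by
  induction l generalizing x with
  | nil => exact h.symm.trans h'
  | cons e l ih => exact ih h.2 h'.2

theorem IsPath.take_drop {x y : Γ.V} {l : List Γ.E} (h : Γ.IsPath x l y) (i : ℕ)
    (hi : i < l.length) :
    Γ.IsPath x (l.take i) (Γ.src l[i]) ∧ Γ.IsPath (Γ.src l[i]) (l.drop i) y := by
  rw [← List.take_append_drop i l, isPath_append] at h
  obtain ⟨z, h1, h2⟩ := h
  have h3 : Γ.src l[i] = z := by
    rw [List.drop_eq_getElem_cons hi] at h2
    exact h2.1
  rw [h3]
  exact ⟨h1, h2⟩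

theorem IsPath.flatten_replicate {x : Γ.V} {p : List Γ.E} (h : Γ.IsPath x p x) (n : ℕ) :
    Γ.IsPath x (List.replicate n p).flatten x := by
  induction n with
  | zero => simp
  | succ n ih => rw [List.replicate_succ, List.flatten_cons]; exact h.append ih

/-- All vertices on a path lie outside a hereditary set if the last one does. -/
theorem IsPath.tgt_notMem {H : Set Γ.V} (hH : ∀ e, Γ.src e ∈ H → Γ.tgt e ∈ H) {x y : Γ.V}
    {l : List Γ.E} (h : Γ.IsPath x l y) (hy : y ∉ H) : x ∉ H ∧ ∀ e ∈ l, Γ.tgt e ∉ H := by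
  induction l generalizing x with
  | nil => rw [isPath_nil] at h; subst h; simpa using hy
  | cons e l ih =>
    obtain ⟨h1, h2⟩ := ih h.2
    refine ⟨fun hx => h1 (hH e (h.1 ▸ hx)), ?_⟩
    simpa using ⟨h1, h2⟩

/-- `y` can be reached from `x` by a path whose vertices (except perhaps `x`) are outside `H`. -/
def Reach (Γ : DiGraph.{u, v}) (H : Set Γ.V) : Γ.V → Γ.V → Prop :=
  Relation.ReflTransGen fun x y => ∃ e, Γ.src e = x ∧ Γ.tgt e = y ∧ y ∉ H

theorem IsPath.reach {H : Set Γ.V} {x y : Γ.V} {l : List Γ.E} (h : Γ.IsPath x l y)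
    (hl : ∀ e ∈ l, Γ.tgt e ∉ H) : Γ.Reach H x y := by
  induction l generalizing x with
  | nil => rw [isPath_nil] at h; rw [h]; exact Relation.ReflTransGen.refl
  | cons e l ih =>
    exact Relation.ReflTransGen.head ⟨e, h.1, rfl, hl e (by simp)⟩
      (ih h.2 fun f hf => hl f (by simp [hf]))

/-- In the quotient digraph `Γ / (H, S)`, the vertex `y` emits exactly one arrow and no arrow to an
added sink leaves from a predecessor of `y`. -/
def Determined (Γ : DiGraph.{u, v}) (H S : Set Γ.V) (y : Γ.V) : Prop :=
  (∃! e, Γ.src e = y ∧ Γ.tgt e ∉ H) ∧ ¬ (Γ.IsBreaking H y ∧ y ∉ S)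

/-- Everything that can be reached from `x` outside `H` is determined. -/
def IsLinear (Γ : DiGraph.{u, v}) (H S : Set Γ.V) (x : Γ.V) : Prop :=
  ∀ y, Γ.Reach H x y → Γ.Determined H S y

/-- `p` is a closed path at `x` that gives a cycle with no exit in `Γ / (H, S)`, expressed in terms
of `Γ`. -/
structure NoExitIn (Γ : DiGraph.{u, v}) (H S : Set Γ.V) (x : Γ.V) (p : List Γ.E) : Prop where
  ne_nil : p ≠ []
  path : Γ.IsPath x p x
  tgt_notMem : ∀ e ∈ p, Γ.tgt e ∉ H
  unique : ∀ e ∈ p, ∀ f, Γ.src f = Γ.src e → Γ.tgt f ∉ H → f = e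
  notBreaking : ∀ e ∈ p, ¬ (Γ.IsBreaking H (Γ.src e) ∧ Γ.src e ∉ S)
  nodup : (p.map Γ.src).Nodup

theorem IsLinear.of_path {H S : Set Γ.V} {x y : Γ.V} {l : List Γ.E} (hx : Γ.IsLinear H S x)
    (h : Γ.IsPath x l y) (hl : ∀ e ∈ l, Γ.tgt e ∉ H) : Γ.IsLinear H S y :=
  fun _ hz => hx _ ((h.reach hl).trans hz)

/-- From a linear vertex there is only one way to go. -/
theorem IsLinear.prefix {H S : Set Γ.V} {x y z : Γ.V} {l m : List Γ.E} (hx : Γ.IsLinear H S x)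
    (hl : Γ.IsPath x l y) (hl' : ∀ e ∈ l, Γ.tgt e ∉ H) (hm : Γ.IsPath x m z)
    (hm' : ∀ e ∈ m, Γ.tgt e ∉ H) (hlm : l.length ≤ m.length) : l <+: m := by
  induction l generalizing x m with
  | nil => exact List.nil_prefix
  | cons e l ih =>
    cases m with
    | nil => simp at hlm
    | cons f m =>
      have hef : e = f := (hx x Relation.ReflTransGen.refl).1.unique
        ⟨hl.1, hl' e (by simp)⟩ ⟨hm.1, hm' f (by simp)⟩
      subst hef
      rw [List.cons_prefix_cons]
      refine ⟨rfl, ih ?_ hl.2 (fun f hf => hl' f (by simp [hf])) hm.2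
        (fun f hf => hm' f (by simp [hf])) (by simpa using hlm)⟩
      exact hx.of_path (l := [e]) ⟨hl.1, rfl⟩ (by simpa using hl' e (by simp))

/-- A closed path at a linear vertex is a power of a cycle with no exit. -/
theorem IsLinear.exists_noExitIn {H S : Set Γ.V} {x : Γ.V} {q : List Γ.E} (hx : Γ.IsLinear H S x)
    (hq0 : q ≠ []) (hq : Γ.IsPath x q x) (hqH : ∀ e ∈ q, Γ.tgt e ∉ H) :
    ∃ p, Γ.NoExitIn H S x p ∧ ∀ r, Γ.IsPath x r x → (∀ e ∈ r, Γ.tgt e ∉ H) →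
      ∃ n, r = (List.replicate n p).flatten := by
  classical
  have hex : ∃ n, ∃ p : List Γ.E, p.length = n ∧ p ≠ [] ∧ Γ.IsPath x p x ∧
      ∀ e ∈ p, Γ.tgt e ∉ H := ⟨_, q, rfl, hq0, hq, hqH⟩
  obtain ⟨p, hpn, hp0, hp, hpH⟩ := Nat.find_spec hex
  have hmin : ∀ r : List Γ.E, r ≠ [] → Γ.IsPath x r x → (∀ e ∈ r, Γ.tgt e ∉ H) →
      p.length ≤ r.length := fun r h1 h2 h3 => by
    rw [hpn]; exact Nat.find_min' hex ⟨r, rfl, h1, h2, h3⟩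
  have hlin : ∀ e ∈ p, Γ.Determined H S (Γ.src e) := by
    intro e he
    obtain ⟨i, hi, rfl⟩ := List.getElem_of_mem he
    exact hx _ ((hp.take_drop i hi).1.reach fun f hf => hpH f (List.mem_of_mem_take hf))
  refine ⟨p, ⟨hp0, hp, hpH, ?_, fun e he => (hlin e he).2, ?_⟩, ?_⟩
  · intro e he f hf hfH
    exact (hlin e he).1.unique ⟨hf, hfH⟩ ⟨rfl, hpH e he⟩
  · -- a repeated vertex would allow to cut out a piece of the shortest closed path
    rw [List.nodup_iff_pairwise_ne, List.pairwise_iff_getElem]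
    intro i j hi hj hij heq
    simp only [List.length_map] at hi hj
    simp only [List.getElem_map] at heq
    have h1 := (hp.take_drop i hi).1
    have h2 := (hp.take_drop j hj).2
    rw [heq] at h1
    have h3 := hmin (p.take i ++ p.drop j) (by simp; omega) (h1.append h2) (by
      intro e he
      rcases List.mem_append.1 he with he | he
      · exact hpH e (List.mem_of_mem_take he)
      · exact hpH e (List.mem_of_mem_drop he))
    simp at h3
    omega
  · intro r
    induction h : r.length using Nat.strong_induction_on generalizing r with
    | _ n ih =>
      intro hr hrH
      by_cases hr0 : r = []
      · exact ⟨0, by simp [hr0]⟩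
      · obtain ⟨s, rfl⟩ := hx.prefix hp hpH hr hrH (hmin r hr0 hr hrH)
        obtain ⟨y, h1, h2⟩ := isPath_append.1 hr
        obtain rfl := hp.end_unique h1
        obtain ⟨k, hk⟩ := ih s.length (by
          have := List.length_pos_iff.2 hp0
          simp at h; omega) s rfl h2 fun e he => hrH e (by simp [he])
        exact ⟨k + 1, by rw [List.replicate_succ, List.flatten_cons, ← hk]⟩

end DiGraph

/-! ### Paths as elements of the Leavitt path algebra -/

section PathElements

variable {F : Type w} [Field F] {Γ : DiGraph.{u, v}}

variable (F) in
/-- The product `e₁ ⋯ eₙ x` of a list of arrows and a vertex. It is nonzero only for a path that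
ends at `x`. -/
def pathTo (l : List Γ.E) (x : Γ.V) : L F Γ :=
  l.foldr (fun e a => gen F (.arrow e) * a) (gen F (.vertex x))

variable (F) in
/-- The product `x eₙ* ⋯ e₁*`. -/
def ghostFrom (l : List Γ.E) (x : Γ.V) : L F Γ :=
  l.foldr (fun e a => a * gen F (.dual e)) (gen F (.vertex x))

@[simp] theorem pathTo_nil (x : Γ.V) : pathTo F [] x = gen F (.vertex x) := rfl

@[simp] theorem pathTo_cons (e : Γ.E) (l : List Γ.E) (x : Γ.V) :
    pathTo F (e :: l) x = gen F (.arrow e) * pathTo F l x := rfl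

@[simp] theorem ghostFrom_nil (x : Γ.V) : ghostFrom F [] x = gen F (.vertex x) := rfl

@[simp] theorem ghostFrom_cons (e : Γ.E) (l : List Γ.E) (x : Γ.V) :
    ghostFrom F (e :: l) x = ghostFrom F l x * gen F (.dual e) := rfl

theorem vertex_mul_pathTo {x y : Γ.V} {l : List Γ.E} (h : Γ.IsPath x l y) :
    gen F (.vertex x) * pathTo F l y = pathTo F l y := by
  cases l with
  | nil => rw [DiGraph.isPath_nil] at h; rw [h]; exact vertex_mul_self y
  | cons e l => rw [pathTo_cons, ← mul_assoc, ← h.1, src_mul_arrow]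

theorem vertex_mul_pathTo_of_ne {x y z : Γ.V} {l : List Γ.E} (h : Γ.IsPath x l y) (hz : z ≠ x) :
    gen F (.vertex z) * pathTo F l y = 0 := by
  rw [← vertex_mul_pathTo h, ← mul_assoc, vertex_mul_of_ne hz, zero_mul]

theorem pathTo_mul_vertex (l : List Γ.E) (y : Γ.V) :
    pathTo F l y * gen F (.vertex y) = pathTo F l y := by
  induction l with
  | nil => exact vertex_mul_self y
  | cons e l ih => rw [pathTo_cons, mul_assoc, ih]

theorem pathTo_mul_vertex_of_ne (l : List Γ.E) {y z : Γ.V} (h : y ≠ z) :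
    pathTo F l y * gen F (.vertex z) = 0 := by
  rw [← pathTo_mul_vertex, mul_assoc, vertex_mul_of_ne h, mul_zero]

theorem vertex_mul_ghostFrom (l : List Γ.E) (y : Γ.V) :
    gen F (.vertex y) * ghostFrom F l y = ghostFrom F l y := by
  induction l with
  | nil => exact vertex_mul_self y
  | cons e l ih => rw [ghostFrom_cons, ← mul_assoc, ih]

/-- A list of arrows that is not a path to `y` gives zero. -/
theorem pathTo_eq_zero_or (l : List Γ.E) (y : Γ.V) :
    pathTo F l y = 0 ∨ ∃ x, Γ.IsPath x l y := by
  induction l with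
  | nil => exact Or.inr ⟨y, rfl⟩
  | cons e l ih =>
    rcases ih with h | ⟨x, h⟩
    · exact Or.inl (by rw [pathTo_cons, h, mul_zero])
    · by_cases hx : x = Γ.tgt e
      · subst hx
        exact Or.inr ⟨Γ.src e, rfl, h⟩
      · refine Or.inl ?_
        rw [pathTo_cons, ← arrow_mul_tgt, mul_assoc, vertex_mul_pathTo_of_ne h (Ne.symm hx),
          mul_zero]

theorem pathTo_append {y z : Γ.V} (l : List Γ.E) {m : List Γ.E} (hm : Γ.IsPath y m z) :
    pathTo F (l ++ m) z = pathTo F l y * pathTo F m z := by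
  induction l with
  | nil => rw [List.nil_append, pathTo_nil, vertex_mul_pathTo hm]
  | cons e l ih => rw [List.cons_append, pathTo_cons, pathTo_cons, ih, mul_assoc]

theorem pathTo_mul_arrow (l : List Γ.E) (e : Γ.E) :
    pathTo F l (Γ.src e) * gen F (.arrow e) = pathTo F (l ++ [e]) (Γ.tgt e) := by
  rw [pathTo_append l (y := Γ.src e) (by simp), pathTo_cons, pathTo_nil, arrow_mul_tgt]

theorem pathElem_eq_pathTo {x y : Γ.V} {l : List Γ.E} (hl : l ≠ []) (h : Γ.IsPath x l y) :
    pathElem F l = pathTo F l y := by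
  induction l generalizing x with
  | nil => exact absurd rfl hl
  | cons e l ih =>
    cases l with
    | nil =>
      have h2 : Γ.tgt e = y := h.2
      rw [pathElem, pathTo_cons, pathTo_nil, ← h2, arrow_mul_tgt]
    | cons f l => rw [pathElem, pathTo_cons, ih (by simp) h.2]

/-! ### Polynomials in a closed path -/

variable {x : Γ.V} {p : List Γ.E}

theorem pathPow_zero (hp0 : p ≠ []) (hp : Γ.IsPath x p x) :
    pathPow F p 0 = gen F (.vertex x) := by
  cases p with
  | nil => exact absurd rfl hp0
  | cons e l => rw [pathPow, hp.1]

theorem pathPow_eq_pathTo (hp0 : p ≠ []) (hp : Γ.IsPath x p x) (n : ℕ) :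
    pathPow F p n = pathTo F (List.replicate n p).flatten x := by
  induction n with
  | zero => rw [pathPow_zero hp0 hp]; rfl
  | succ n ih =>
    rw [pathPow, ih, pathElem_eq_pathTo hp0 hp, List.replicate_succ', List.flatten_append,
      List.flatten_singleton, pathTo_append _ hp]

theorem coe_pathPow (hp0 : p ≠ []) (hp : Γ.IsPath x p x) (n : ℕ) :
    (pathPow F p n : UnitalLPA F Γ) =
      (pathElem F p : UnitalLPA F Γ) ^ n * unitalGen F Γ (.vertex x) := by
  have hPx : (pathElem F p : UnitalLPA F Γ) * unitalGen F Γ (.vertex x) = pathElem F p := by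
    have := pathTo_mul_vertex (F := F) p x
    rw [← pathElem_eq_pathTo hp0 hp] at this
    simpa using congrArg Subtype.val this
  have hxP : unitalGen F Γ (.vertex x) * (pathElem F p : UnitalLPA F Γ) = pathElem F p := by
    have := vertex_mul_pathTo (F := F) hp
    rw [← pathElem_eq_pathTo hp0 hp] at this
    simpa using congrArg Subtype.val this
  induction n with
  | zero => rw [pathPow_zero hp0 hp]; simp
  | succ n ih =>
    rw [pathPow, NonUnitalSubalgebra.coe_mul, ih, pow_succ, mul_assoc, mul_assoc, hxP, hPx]

/-- In the unital algebra, `pathEval p g` is the value of `g` at `p`, cut down by the vertex. -/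
theorem coe_pathEval (hp0 : p ≠ []) (hp : Γ.IsPath x p x) (g : F[X]) :
    (pathEval p g : UnitalLPA F Γ) =
      aeval (pathElem F p : UnitalLPA F Γ) g * unitalGen F Γ (.vertex x) := by
  rw [pathEval, Polynomial.sum, aeval_eq_sum_range, Finset.sum_mul,
    ← Polynomial.sum_over_range' (p := g)
      (f := fun n a => (a • (pathElem F p : UnitalLPA F Γ) ^ n) * unitalGen F Γ (.vertex x))
      (by simp) _ (Nat.lt_succ_self _), Polynomial.sum,
    AddSubmonoidClass.coe_finsetSum]
  refine Finset.sum_congr rfl fun n _ => ?_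
  rw [NonUnitalSubalgebra.coe_smul, coe_pathPow hp0 hp, smul_mul_assoc]

theorem pathElem_commute (hp0 : p ≠ []) (hp : Γ.IsPath x p x) :
    Commute (pathElem F p : UnitalLPA F Γ) (unitalGen F Γ (.vertex x)) := by
  have h1 := pathTo_mul_vertex (F := F) p x
  have h2 := vertex_mul_pathTo (F := F) hp
  rw [← pathElem_eq_pathTo hp0 hp] at h1 h2
  have h1' := congrArg Subtype.val h1
  have h2' := congrArg Subtype.val h2
  simp only [NonUnitalSubalgebra.coe_mul, coe_gen] at h1' h2'
  exact h1'.trans h2'.symm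

theorem unitalGen_vertex_mul_self (x : Γ.V) :
    unitalGen F Γ (.vertex x) * unitalGen F Γ (.vertex x) = unitalGen F Γ (.vertex x) :=
  congrArg Subtype.val (vertex_mul_self (F := F) x)

theorem commute_aeval {A : Type*} [Ring A] [Algebra F A] {a b : A} (h : Commute a b) (g : F[X]) :
    Commute (aeval a g) b := by
  induction g using Polynomial.induction_on' with
  | add p q hp hq => rw [map_add]; exact hp.add_left hq
  | monomial n c =>
    rw [aeval_monomial]
    exact (Algebra.commute_algebraMap_left c b).mul_left (h.pow_left n)

theorem pathEval_mul (hp0 : p ≠ []) (hp : Γ.IsPath x p x) (g h : F[X]) :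
    pathEval p (g * h) = pathEval p g * pathEval p h := by
  apply Subtype.ext
  rw [NonUnitalSubalgebra.coe_mul, coe_pathEval hp0 hp, coe_pathEval hp0 hp, coe_pathEval hp0 hp,
    map_mul, mul_assoc, mul_assoc, ← mul_assoc (unitalGen F Γ (.vertex x)),
    ← (commute_aeval (pathElem_commute hp0 hp) h).eq, mul_assoc, unitalGen_vertex_mul_self]

theorem pathEval_add (p : List Γ.E) (g h : F[X]) :
    pathEval p (g + h) = pathEval p g + pathEval p h :=
  Polynomial.sum_add_index _ _ _ (by simp) (by simp [add_smul])

theorem pathEval_monomial (p : List Γ.E) (n : ℕ) (c : F) :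
    pathEval p (monomial n c) = c • pathPow F p n := by
  rw [pathEval, Polynomial.sum_monomial_index _ _ (by simp)]

@[simp] theorem pathEval_zero (p : List Γ.E) : pathEval p (0 : F[X]) = 0 := by
  rw [pathEval, Polynomial.sum_zero_index]

theorem pathEval_C (hp0 : p ≠ []) (hp : Γ.IsPath x p x) (c : F) :
    pathEval p (C c) = c • gen F (.vertex x) := by
  rw [← monomial_zero_left, pathEval_monomial, pathPow_zero hp0 hp]

theorem pathEval_one (hp0 : p ≠ []) (hp : Γ.IsPath x p x) :
    pathEval p (1 : F[X]) = gen F (.vertex x) := by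
  rw [← C_1, pathEval_C hp0 hp, one_smul]

theorem pathEval_X (hp0 : p ≠ []) (hp : Γ.IsPath x p x) :
    pathEval p (X : F[X]) = pathTo F p x := by
  rw [← monomial_one_one_eq_X, pathEval_monomial, pathPow_eq_pathTo hp0 hp]
  simp

theorem vertex_mul_pathEval (hp0 : p ≠ []) (hp : Γ.IsPath x p x) (g : F[X]) :
    gen F (.vertex x) * pathEval p g = pathEval p g := by
  rw [← pathEval_one hp0 hp, ← pathEval_mul hp0 hp, one_mul]

theorem pathEval_mul_vertex (hp0 : p ≠ []) (hp : Γ.IsPath x p x) (g : F[X]) :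
    pathEval p g * gen F (.vertex x) = pathEval p g := by
  rw [← pathEval_one hp0 hp, ← pathEval_mul hp0 hp, mul_one]

/-- Conjugation by the first arrow of a closed path rotates the path. -/
theorem dual_mul_pathEval_mul_arrow {e : Γ.E} {l : List Γ.E} (hp : Γ.IsPath x (e :: l) x)
    (g : F[X]) : gen F (.dual e) * pathEval (e :: l) g * gen F (.arrow e) =
      pathEval (l ++ [e]) g := by
  have hx : Γ.src e = x := hp.1
  have hrot : Γ.IsPath (Γ.tgt e) (l ++ [e]) (Γ.tgt e) := hp.2.append ⟨hp.1, rfl⟩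
  have h1 : pathTo F (e :: l) x * gen F (.arrow e) =
      gen F (.arrow e) * pathTo F (l ++ [e]) (Γ.tgt e) := by
    subst hx
    rw [pathTo_mul_arrow]; rfl
  induction g using Polynomial.induction_on' with
  | add g h hg hh => rw [pathEval_add, pathEval_add, mul_add, add_mul, hg, hh]
  | monomial n c =>
    rw [pathEval_monomial, pathEval_monomial, mul_smul_comm, smul_mul_assoc]
    congr 1
    have h2 : pathPow F (e :: l) n * gen F (.arrow e) =
        gen F (.arrow e) * pathPow F (l ++ [e]) n := by
      induction n with
      | zero =>
        rw [pathPow_zero (by simp) hp, pathPow_zero (by simp) hrot, arrow_mul_tgt, ← hx,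
          src_mul_arrow]
      | succ n ih =>
        rw [pathPow, pathPow, mul_assoc, pathElem_eq_pathTo (by simp) hp,
          pathElem_eq_pathTo (by simp) hrot, h1, ← mul_assoc, ih, mul_assoc]
    rw [mul_assoc, h2, ← mul_assoc, dual_mul_arrow_self, pathPow_eq_pathTo (by simp) hrot,
      vertex_mul_pathTo (hrot.flatten_replicate n)]

end PathElements

section Reduction

variable {F : Type w} [Field F] {Γ : DiGraph.{u, v}}

/-! ### Linear combinations of paths in an ideal -/

/-- The linear combination of paths ending at `x` with given coefficients. -/
def pathSum (x : Γ.V) (l : List (F × List Γ.E)) : L F Γ :=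
  (l.map fun q => q.1 • pathTo F q.2 x).sum

@[simp] theorem pathSum_nil (x : Γ.V) : pathSum x ([] : List (F × List Γ.E)) = 0 := rfl

@[simp] theorem pathSum_cons (x : Γ.V) (q : F × List Γ.E) (l : List (F × List Γ.E)) :
    pathSum x (q :: l) = q.1 • pathTo F q.2 x + pathSum x l := by
  simp [pathSum]

theorem pathSum_append (x : Γ.V) (l m : List (F × List Γ.E)) :
    pathSum x (l ++ m) = pathSum x l + pathSum x m := by
  simp [pathSum]

/-- All paths in `l` are nontrivial closed paths at `x`. -/
def AllClosed (x : Γ.V) (l : List (F × List Γ.E)) : Prop :=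
  ∀ q ∈ l, q.2 ≠ [] ∧ Γ.IsPath x q.2 x

/-- Conjugation by an arrow maps nontrivial closed paths to closed paths, and kills those that do
not start with the arrow. -/
theorem exists_conj_pathSum (e : Γ.E) (l : List (F × List Γ.E)) (hl : AllClosed (Γ.src e) l) :
    ∃ l' : List (F × List Γ.E), AllClosed (Γ.tgt e) l' ∧
      gen F (.dual e) * pathSum (Γ.src e) l * gen F (.arrow e) = pathSum (Γ.tgt e) l' ∧
      l'.length ≤ l.length ∧ (l' ≠ [] → ∃ ν, Γ.IsPath (Γ.tgt e) ν (Γ.src e)) ∧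
      ((∃ q ∈ l, q.2.head? ≠ some e) → l'.length < l.length) := by
  induction l with
  | nil => exact ⟨[], by simp [AllClosed], by simp, le_rfl, by simp, by simp⟩
  | cons q l ih =>
    obtain ⟨l', h1, h2, h3, h4, h5⟩ := ih fun q hq => hl q (by simp [hq])
    obtain ⟨c, γ⟩ := q
    obtain ⟨hγ, hγp⟩ := hl (c, γ) (by simp)
    cases γ with
    | nil => exact absurd rfl hγ
    | cons f ν =>
      by_cases hef : e = f
      · subst hef
        have hν : Γ.IsPath (Γ.tgt e) ν (Γ.src e) := hγp.2
        refine ⟨(c, ν ++ [e]) :: l', ?_, ?_, by simpa using h3, fun _ => ⟨ν, hν⟩, ?_⟩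
        · intro q hq
          rcases List.mem_cons.1 hq with rfl | hq
          · exact ⟨by simp, hν.append ⟨rfl, rfl⟩⟩
          · exact h1 q hq
        · rw [pathSum_cons, pathSum_cons, mul_add, add_mul, h2]
          congr 1
          rw [pathTo_cons, mul_smul_comm, smul_mul_assoc, ← mul_assoc, dual_mul_arrow_self,
            vertex_mul_pathTo hν, pathTo_mul_arrow]
        · rintro ⟨q, hq, hqe⟩
          rcases List.mem_cons.1 hq with rfl | hq
          · simp at hqe
          · simpa using h5 ⟨q, hq, hqe⟩
      · refine ⟨l', h1, ?_, by simp; omega, h4, fun _ => by simp; omega⟩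
        rw [pathSum_cons, mul_add, add_mul, h2, pathTo_cons, mul_smul_comm, ← mul_assoc,
          dual_mul_arrow_of_ne hef, zero_mul, smul_zero, zero_mul, zero_add]

theorem isBreaking_of_notMem {J : TwoSidedIdeal (L F Γ)} {x : Γ.V}
    (h : Γ.IsBreaking (vertexSet J) x) : x ∉ vertexSet J := by
  obtain ⟨e, rfl, he⟩ := h.2.2
  exact src_notMem_vertexSet he

theorem breakElem_mul_pathSum {J : TwoSidedIdeal (L F Γ)} {x : Γ.V}
    (hfin : {e | Γ.src e = x ∧ Γ.tgt e ∉ vertexSet J}.Finite) (hx : x ∉ vertexSet J)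
    {l : List (F × List Γ.E)} (hl : AllClosed x l) :
    breakElem F (vertexSet J) x * pathSum x l = 0 := by
  induction l with
  | nil => simp
  | cons q l ih =>
    obtain ⟨c, γ⟩ := q
    obtain ⟨hγ, hγp⟩ := hl (c, γ) (by simp)
    cases γ with
    | nil => exact absurd rfl hγ
    | cons f ν =>
      have hf := (hγp.tgt_notMem (fun _ => tgt_mem_vertexSet) hx).2 f (by simp)
      rw [pathSum_cons, mul_add, ih fun q hq => hl q (by simp [hq]), add_zero, mul_smul_comm,
        pathTo_cons, ← mul_assoc, breakElem_mul_arrow hfin hf, zero_mul, smul_zero]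

/-- If an ideal contains `k x` plus a combination of nontrivial closed paths at `x`, but not the
vertex `x` itself, then nothing branches off from `x` outside the ideal: at a branching, conjugation
by an arrow would reduce the number of closed paths while it keeps the term with a vertex. -/
theorem isLinear_of_mem {J : TwoSidedIdeal (L F Γ)} (n : ℕ) {x : Γ.V} (hx : x ∉ vertexSet J)
    {k : F} (hk : k ≠ 0) {l : List (F × List Γ.E)} (hn : l.length ≤ n) (hl : AllClosed x l)
    (h : k • gen F (.vertex x) + pathSum x l ∈ J) :
    Γ.IsLinear (vertexSet J) (breakingSet J) x ∧ l ≠ [] := by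
  induction n using Nat.strong_induction_on generalizing x l with
  | _ n ih =>
  have hne : ∀ {y : Γ.V}, y ∉ vertexSet J → ∀ l' : List (F × List Γ.E),
      k • gen F (.vertex y) + pathSum y l' ∈ J → l' ≠ [] := by
    rintro y hy l' h' rfl
    rw [pathSum_nil, add_zero] at h'
    exact hy (mem_of_smul_mem hk h')
  have hconj : ∀ e : Γ.E, ∀ l' : List (F × List Γ.E), AllClosed (Γ.src e) l' →
      k • gen F (.vertex (Γ.src e)) + pathSum (Γ.src e) l' ∈ J →
      ∃ l'' : List (F × List Γ.E), AllClosed (Γ.tgt e) l'' ∧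
        k • gen F (.vertex (Γ.tgt e)) + pathSum (Γ.tgt e) l'' ∈ J ∧ l''.length ≤ l'.length ∧
        (l'' ≠ [] → ∃ ν, Γ.IsPath (Γ.tgt e) ν (Γ.src e)) ∧
        ((∃ q ∈ l', q.2.head? ≠ some e) → l''.length < l'.length) := by
    intro e l' hl' h'
    obtain ⟨l'', h1, h2, h3, h4, h5⟩ := exists_conj_pathSum e l' hl'
    refine ⟨l'', h1, ?_, h3, h4, h5⟩
    have h6 := J.mul_mem_right _ (gen F (.arrow e)) (J.mul_mem_left (gen F (.dual e)) _ h')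
    rwa [mul_add, add_mul, h2, mul_smul_comm, smul_mul_assoc, dual_mul_src,
      dual_mul_arrow_self] at h6
  refine ⟨fun y hxy => ?_, hne hx l h⟩
  obtain ⟨hy, l', hl', hlen, h'⟩ : y ∉ vertexSet J ∧ ∃ l' : List (F × List Γ.E), AllClosed y l' ∧
      l'.length ≤ n ∧ k • gen F (.vertex y) + pathSum y l' ∈ J := by
    induction hxy with
    | refl => exact ⟨hx, l, hl, hn, h⟩
    | tail _ hyz ih2 =>
      obtain ⟨e, rfl, rfl, he⟩ := hyz
      obtain ⟨_, l', hl', hlen, h'⟩ := ih2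
      obtain ⟨l'', h1, h2, h3, _⟩ := hconj e l' hl' h'
      exact ⟨he, l'', h1, h3.trans hlen, h2⟩
  obtain ⟨q, hq⟩ := List.exists_mem_of_ne_nil l' (hne hy l' h')
  obtain ⟨hq0, hqp⟩ := hl' q hq
  obtain ⟨g, ν, hgν⟩ := List.exists_cons_of_ne_nil hq0
  rw [hgν] at hqp
  have hgH := (hqp.tgt_notMem (fun _ => tgt_mem_vertexSet) hy).2 g (by simp)
  by_cases hbr : ∃ e, e ≠ g ∧ Γ.src e = y ∧ Γ.tgt e ∉ vertexSet J
  · obtain ⟨e, heg, rfl, heH⟩ := hbr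
    obtain ⟨l'', h1, h2, h3, h4, h5⟩ := hconj e l' hl' h'
    obtain ⟨h6, h7⟩ := ih l''.length ((h5 ⟨q, hq, by simp [hgν, Ne.symm heg]⟩).trans_le hlen)
      heH le_rfl h1 h2
    obtain ⟨ν', hν'⟩ := h4 h7
    exact h6 _ (hν'.reach (hν'.tgt_notMem (fun _ => tgt_mem_vertexSet) hy).2)
  · refine ⟨⟨g, ⟨hqp.1, hgH⟩, fun e he => by_contra fun heg => hbr ⟨e, heg, he⟩⟩, ?_⟩
    rintro ⟨hb, hbS⟩
    refine hbS ⟨hb, ?_⟩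
    have h8 := J.mul_mem_right _ (breakElem F (vertexSet J) y)
      (J.mul_mem_left (breakElem F (vertexSet J) y) _ h')
    rw [mul_add, add_mul, breakElem_mul_pathSum hb.2.1 hy hl', zero_mul, add_zero, mul_smul_comm,
      smul_mul_assoc, breakElem_mul_vertex hb.2.1, breakElem_mul_self hb.2.1] at h8
    exact mem_of_smul_mem hk h8

/-- Multiplication by a vertex on the left keeps the paths that start there. -/
theorem exists_vertex_mul_pathSum (y x : Γ.V) (l : List (F × List Γ.E)) :
    ∃ m : List (F × List Γ.E), (∀ q ∈ m, q ∈ l ∧ Γ.IsPath y q.2 x) ∧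
      gen F (.vertex y) * pathSum x l = pathSum x m := by
  induction l with
  | nil => exact ⟨[], by simp, by simp⟩
  | cons q l ih =>
    obtain ⟨m, h1, h2⟩ := ih
    have h1' : ∀ r ∈ m, r ∈ q :: l ∧ Γ.IsPath y r.2 x := fun r hr =>
      ⟨List.mem_cons_of_mem _ (h1 r hr).1, (h1 r hr).2⟩
    rcases pathTo_eq_zero_or (F := F) q.2 x with h0 | ⟨z, hz⟩
    · exact ⟨m, h1', by rw [pathSum_cons, mul_add, h2, h0, smul_zero, mul_zero, zero_add]⟩
    · by_cases hyz : y = z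
      · subst hyz
        refine ⟨q :: m, ?_, ?_⟩
        · intro r hr
          rcases List.mem_cons.1 hr with rfl | hr
          exacts [⟨List.mem_cons_self .., hz⟩, h1' r hr]
        · rw [pathSum_cons, mul_add, h2, mul_smul_comm, vertex_mul_pathTo hz, pathSum_cons]
      · refine ⟨m, h1', ?_⟩
        rw [pathSum_cons, mul_add, h2, mul_smul_comm, vertex_mul_pathTo_of_ne hz hyz, smul_zero,
          zero_add]

/-- The trivial paths in a combination of paths can be collected in one term. -/
theorem exists_split_trivial (x : Γ.V) (l : List (F × List Γ.E)) :
    ∃ (k : F) (m : List (F × List Γ.E)), (∀ q ∈ m, q ∈ l ∧ q.2 ≠ []) ∧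
      pathSum x l = k • gen F (.vertex x) + pathSum x m := by
  induction l with
  | nil => exact ⟨0, [], by simp, by simp⟩
  | cons q l ih =>
    obtain ⟨k, m, h1, h2⟩ := ih
    have h1' : ∀ r ∈ m, r ∈ q :: l ∧ r.2 ≠ [] := fun r hr =>
      ⟨List.mem_cons_of_mem _ (h1 r hr).1, (h1 r hr).2⟩
    by_cases hq : q.2 = []
    · exact ⟨q.1 + k, m, h1', by rw [pathSum_cons, h2, hq, pathTo_nil, add_smul, add_assoc]⟩
    · refine ⟨k, q :: m, ?_, by rw [pathSum_cons, h2, pathSum_cons]; abel⟩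
      intro r hr
      rcases List.mem_cons.1 hr with rfl | hr
      exacts [⟨List.mem_cons_self .., hq⟩, h1' r hr]

/-- Multiplication by `e*` on the left shortens nontrivial paths. -/
theorem exists_dual_mul_pathSum (e : Γ.E) (x : Γ.V) (l : List (F × List Γ.E))
    (hl : ∀ q ∈ l, q.2 ≠ []) :
    ∃ m : List (F × List Γ.E), (∀ q ∈ m, ∃ r ∈ l, q.2.length < r.2.length) ∧
      gen F (.dual e) * pathSum x l = pathSum x m := by
  induction l with
  | nil => exact ⟨[], by simp, by simp⟩
  | cons q l ih =>
    obtain ⟨m, h1, h2⟩ := ih fun q hq => hl q (by simp [hq])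
    have h1' : ∀ r ∈ m, ∃ s ∈ q :: l, r.2.length < s.2.length := fun r hr => by
      obtain ⟨s, hs, h⟩ := h1 r hr
      exact ⟨s, List.mem_cons_of_mem _ hs, h⟩
    obtain ⟨c, γ⟩ := q
    cases γ with
    | nil => exact absurd rfl (hl _ (List.mem_cons_self ..))
    | cons f ν =>
      rw [pathSum_cons, mul_add, h2, mul_smul_comm, pathTo_cons, ← mul_assoc]
      by_cases hef : e = f
      · subst hef
        rw [dual_mul_arrow_self]
        rcases pathTo_eq_zero_or (F := F) ν x with h0 | ⟨z, hz⟩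
        · exact ⟨m, h1', by rw [h0, mul_zero, smul_zero, zero_add]⟩
        · by_cases hez : Γ.tgt e = z
          · subst hez
            refine ⟨(c, ν) :: m, ?_, by rw [vertex_mul_pathTo hz, pathSum_cons]⟩
            intro r hr
            rcases List.mem_cons.1 hr with rfl | hr
            exacts [⟨_, List.mem_cons_self .., by simp⟩, h1' r hr]
          · exact ⟨m, h1', by rw [vertex_mul_pathTo_of_ne hz hez, smul_zero, zero_add]⟩
      · exact ⟨m, h1', by rw [dual_mul_arrow_of_ne hef, zero_mul, smul_zero, zero_add]⟩

/-- A combination `b` of nontrivial paths is recovered from the products `e* b`. -/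
theorem exists_sum_arrow_dual_mul_pathSum (x : Γ.V) (l : List (F × List Γ.E))
    (hl : ∀ q ∈ l, q.2 ≠ []) : ∃ T : Finset Γ.E, ∀ T', T ⊆ T' →
      (∑ e ∈ T', gen F (.arrow e) * gen F (.dual e)) * pathSum x l = pathSum x l := by
  classical
  induction l with
  | nil => exact ⟨∅, by simp⟩
  | cons q l ih =>
    obtain ⟨T, hT⟩ := ih fun q hq => hl q (by simp [hq])
    obtain ⟨c, γ⟩ := q
    cases γ with
    | nil => exact absurd rfl (hl _ (List.mem_cons_self ..))
    | cons f ν =>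
      refine ⟨insert f T, fun T' hT' => ?_⟩
      rw [pathSum_cons, mul_add, hT T' ((Finset.subset_insert f T).trans hT'), mul_smul_comm,
        pathTo_cons, Finset.sum_mul,
        Finset.sum_eq_single_of_mem f (hT' (Finset.mem_insert_self f T)), mul_assoc,
        ← mul_assoc (gen F (.dual f)), dual_mul_arrow_self, ← mul_assoc, arrow_mul_tgt]
      intro e _ hef
      rw [mul_assoc, ← mul_assoc (gen F (.dual e)), dual_mul_arrow_of_ne hef, zero_mul, mul_zero]

/-- Peeling off first arrows reduces a statement about combinations of paths ending at `x` to
combinations of `x` and closed paths at `x`. -/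
theorem pathSum_mem_of_forall {J : TwoSidedIdeal (L F Γ)} {P : L F Γ → Prop}
    (hP : ∀ c b, P b → P (c * b)) {x : Γ.V}
    (hbase : ∀ (k : F) (l : List (F × List Γ.E)), k ≠ 0 → AllClosed x l →
      P (k • gen F (.vertex x) + pathSum x l) → k • gen F (.vertex x) + pathSum x l ∈ J)
    (l : List (F × List Γ.E)) (h : P (pathSum x l)) : pathSum x l ∈ J := by
  obtain ⟨N, hN⟩ : ∃ N, ∀ q ∈ l, q.2.length ≤ N := by
    refine ⟨(l.map fun q => q.2.length).sum, fun q hq => ?_⟩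
    exact List.single_le_sum (by simp) _ (List.mem_map_of_mem hq)
  induction N using Nat.strong_induction_on generalizing l with
  | _ N ih =>
  -- combinations of nontrivial paths
  have hne : ∀ m : List (F × List Γ.E), (∀ q ∈ m, q ∈ l ∧ q.2 ≠ []) → P (pathSum x m) →
      pathSum x m ∈ J := by
    intro m hm hPm
    obtain ⟨T, hT⟩ := exists_sum_arrow_dual_mul_pathSum x m fun q hq => (hm q hq).2
    rw [← hT T subset_rfl, Finset.sum_mul]
    refine sum_mem fun e _ => ?_
    rw [mul_assoc]
    refine J.mul_mem_left _ _ ?_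
    obtain ⟨m', h1, h2⟩ := exists_dual_mul_pathSum e x m fun q hq => (hm q hq).2
    rw [h2]
    cases N with
    | zero =>
      have : m' = [] := List.eq_nil_iff_forall_not_mem.2 fun q hq => by
        obtain ⟨r, hr, hqr⟩ := h1 q hq
        have := hN r (hm r hr).1
        omega
      rw [this, pathSum_nil]
      exact J.zero_mem
    | succ N =>
      refine ih N (Nat.lt_succ_self N) m' (h2 ▸ hP _ _ hPm) fun q hq => ?_
      obtain ⟨r, hr, hqr⟩ := h1 q hq
      have := hN r (hm r hr).1
      omega
  refine mem_of_forall_vertex_mul fun y => ?_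
  obtain ⟨m, h1, h2⟩ := exists_vertex_mul_pathSum y x l
  have hPm : P (pathSum x m) := h2 ▸ hP _ _ h
  rw [h2]
  by_cases hyx : y = x
  · subst hyx
    obtain ⟨k, m', h3, h4⟩ := exists_split_trivial y m
    by_cases hk : k = 0
    · rw [hk, zero_smul, zero_add] at h4
      rw [h4] at hPm ⊢
      exact hne m' (fun q hq => ⟨(h1 q (h3 q hq).1).1, (h3 q hq).2⟩) hPm
    · rw [h4] at hPm ⊢
      exact hbase k m' hk (fun q hq => ⟨(h3 q hq).2, (h1 q (h3 q hq).1).2⟩) hPm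
  · refine hne m (fun q hq => ⟨(h1 q hq).1, fun h0 => hyx ?_⟩) hPm
    have := (h1 q hq).2
    rwa [h0] at this

end Reduction

section Comparison

variable {F : Type w} [Field F] {Γ : DiGraph.{u, v}}

/-! ### Comparison of ideals -/

variable (F Γ) in
/-- The span of the elements `α β*` for paths `α`, `β` with a common end, where `β` has at most `n`
arrows. -/
def ghostDeg (n : ℕ) : Submodule F (L F Γ) :=
  Submodule.span F {a | ∃ α w β, β.length ≤ n ∧ a = pathTo F α w * ghostFrom F β w}

theorem ghostDeg_mono {m n : ℕ} (h : m ≤ n) : ghostDeg F Γ m ≤ ghostDeg F Γ n :=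
  Submodule.span_mono fun _ ⟨α, w, β, hβ, ha⟩ => ⟨α, w, β, hβ.trans h, ha⟩

theorem mul_mem_of_ghostDeg {n : ℕ} {W : Submodule F (L F Γ)} (b : L F Γ)
    (h : ∀ α w β, β.length ≤ n → pathTo F α w * ghostFrom F β w * b ∈ W) {a : L F Γ}
    (ha : a ∈ ghostDeg F Γ n) : a * b ∈ W := by
  induction ha using Submodule.span_induction with
  | mem a ha => obtain ⟨α, w, β, hβ, rfl⟩ := ha; exact h α w β hβ
  | zero => rw [zero_mul]; exact W.zero_mem
  | add a c _ _ h1 h2 => rw [add_mul]; exact W.add_mem h1 h2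
  | smul k a _ h1 => rw [smul_mul_assoc]; exact W.smul_mem k h1

theorem ghostFrom_mul_vertex (l : List Γ.E) (w y : Γ.V) :
    ghostFrom F l w * gen F (.vertex y) = ghostFrom F l w ∨
      ghostFrom F l w * gen F (.vertex y) = 0 := by
  cases l with
  | nil =>
    rw [ghostFrom_nil, vertex_mul_vertex]
    split_ifs
    exacts [Or.inl rfl, Or.inr rfl]
  | cons e l =>
    rw [ghostFrom_cons, mul_assoc, dual_mul_vertex]
    split_ifs
    exacts [Or.inl rfl, Or.inr (mul_zero _)]

theorem mul_vertex_mem_ghostDeg {n : ℕ} {a : L F Γ} (ha : a ∈ ghostDeg F Γ n) (y : Γ.V) :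
    a * gen F (.vertex y) ∈ ghostDeg F Γ n := by
  refine mul_mem_of_ghostDeg _ (fun α w β hβ => ?_) ha
  rw [mul_assoc]
  rcases ghostFrom_mul_vertex (F := F) β w y with h | h <;> rw [h]
  · exact Submodule.subset_span ⟨α, w, β, hβ, rfl⟩
  · rw [mul_zero]; exact Submodule.zero_mem _

theorem mul_dual_mem_ghostDeg {n : ℕ} {a : L F Γ} (ha : a ∈ ghostDeg F Γ n) (e : Γ.E) :
    a * gen F (.dual e) ∈ ghostDeg F Γ (n + 1) := by
  refine mul_mem_of_ghostDeg _ (fun α w β hβ => ?_) ha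
  rw [mul_assoc]
  exact Submodule.subset_span ⟨α, w, e :: β, by simpa using hβ, rfl⟩

/-- Multiplication by an arrow on the right lowers the number of ghost arrows. -/
theorem mul_arrow_mem_ghostDeg {n : ℕ} {a : L F Γ} (ha : a ∈ ghostDeg F Γ n) (e : Γ.E) :
    a * gen F (.arrow e) ∈ ghostDeg F Γ (n - 1) := by
  refine mul_mem_of_ghostDeg _ (fun α w β hβ => ?_) ha
  cases β with
  | nil =>
    rw [ghostFrom_nil, pathTo_mul_vertex]
    by_cases hw : w = Γ.src e
    · subst hw
      rw [pathTo_mul_arrow]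
      exact Submodule.subset_span ⟨α ++ [e], Γ.tgt e, [], by simp, by
        rw [ghostFrom_nil, pathTo_mul_vertex]⟩
    · rw [← src_mul_arrow, ← mul_assoc, pathTo_mul_vertex_of_ne _ hw, zero_mul]
      exact Submodule.zero_mem _
  | cons f β =>
    rw [ghostFrom_cons, mul_assoc, mul_assoc]
    by_cases hef : f = e
    · subst hef
      rw [dual_mul_arrow_self]
      rcases ghostFrom_mul_vertex (F := F) β w (Γ.tgt f) with h | h <;> rw [h]
      · refine Submodule.subset_span ⟨α, w, β, ?_, rfl⟩
        simp at hβ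
        omega
      · rw [mul_zero]; exact Submodule.zero_mem _
    · rw [dual_mul_arrow_of_ne hef, mul_zero, mul_zero]
      exact Submodule.zero_mem _

theorem exists_mem_ghostDeg (a : L F Γ) : ∃ n, a ∈ ghostDeg F Γ n := by
  have key : ∀ b : L F Γ, ∀ n, ∀ a ∈ ghostDeg F Γ n, ∃ m, a * b ∈ ghostDeg F Γ m := by
    intro b
    induction b using L_induction with
    | hgen g =>
      intro n a ha
      cases g with
      | vertex x => exact ⟨n, mul_vertex_mem_ghostDeg ha x⟩
      | arrow e => exact ⟨n - 1, mul_arrow_mem_ghostDeg ha e⟩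
      | dual e => exact ⟨n + 1, mul_dual_mem_ghostDeg ha e⟩
    | hadd b c hb hc =>
      intro n a ha
      obtain ⟨m, hm⟩ := hb n a ha
      obtain ⟨k, hk⟩ := hc n a ha
      refine ⟨max m k, ?_⟩
      rw [mul_add]
      exact Submodule.add_mem _ (ghostDeg_mono (le_max_left m k) hm)
        (ghostDeg_mono (le_max_right m k) hk)
    | h0 => exact fun n a _ => ⟨0, by rw [mul_zero]; exact Submodule.zero_mem _⟩
    | hmul b c hb hc =>
      intro n a ha
      obtain ⟨m, hm⟩ := hb n a ha
      obtain ⟨k, hk⟩ := hc m _ hm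
      exact ⟨k, by rwa [← mul_assoc]⟩
    | hsmul c b hb =>
      intro n a ha
      obtain ⟨m, hm⟩ := hb n a ha
      exact ⟨m, by rw [mul_smul_comm]; exact Submodule.smul_mem _ c hm⟩
  obtain ⟨T, hT⟩ := exists_local_unit a
  rw [← (hT T subset_rfl).1]
  refine key a 0 _ (Submodule.sum_mem _ fun x _ => Submodule.subset_span ⟨[], x, [], le_rfl, ?_⟩)
  rw [pathTo_nil, ghostFrom_nil, vertex_mul_self]

theorem pathSum_smul (c : F) (x : Γ.V) (l : List (F × List Γ.E)) :
    c • pathSum x l = pathSum x (l.map fun q => (c * q.1, q.2)) := by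
  induction l with
  | nil => simp
  | cons q l ih => rw [pathSum_cons, smul_add, ih, List.map_cons, pathSum_cons, smul_smul]

/-- An element `a = a x` is a combination of paths plus a sum of elements `a_e e*`. -/
theorem exists_mul_vertex_eq {n : ℕ} {a : L F Γ} (ha : a ∈ ghostDeg F Γ n) (x : Γ.V) :
    ∃ (l : List (F × List Γ.E)) (c : Γ.E →₀ L F Γ), (∀ e ∈ c.support, Γ.src e = x) ∧
      (n = 0 → c = 0) ∧
      a * gen F (.vertex x) = pathSum x l + c.sum fun e b => b * gen F (.dual e) := by
  classical
  induction ha using Submodule.span_induction with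
  | mem a ha =>
    obtain ⟨α, w, β, hβ, rfl⟩ := ha
    cases β with
    | nil =>
      rw [ghostFrom_nil, pathTo_mul_vertex]
      by_cases hw : w = x
      · subst hw
        exact ⟨[(1, α)], 0, by simp, by simp, by simp [pathTo_mul_vertex]⟩
      · exact ⟨[], 0, by simp, by simp, by simp [pathTo_mul_vertex_of_ne _ hw]⟩
    | cons e β =>
      rw [ghostFrom_cons, mul_assoc, mul_assoc, dual_mul_vertex]
      split_ifs with he
      · refine ⟨[], Finsupp.single e (pathTo F α w * ghostFrom F β w), ?_, ?_, ?_⟩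
        · intro f hf
          rw [Finset.mem_singleton.1 (Finsupp.support_single_subset hf), he]
        · rintro rfl
          simp at hβ
        · rw [Finsupp.sum_single_index (zero_mul _), pathSum_nil, zero_add, mul_assoc]
      · exact ⟨[], 0, by simp, by simp, by simp⟩
  | zero => exact ⟨[], 0, by simp, by simp, by simp⟩
  | add a b _ _ h1 h2 =>
    obtain ⟨l, c, h1, h1', h1''⟩ := h1
    obtain ⟨m, d, h2, h2', h2''⟩ := h2
    refine ⟨l ++ m, c + d, ?_, ?_, ?_⟩
    · intro e he
      rcases Finset.mem_union.1 (Finsupp.support_add he) with he | he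
      exacts [h1 e he, h2 e he]
    · intro hn
      rw [h1' hn, h2' hn, add_zero]
    · rw [add_mul, h1'', h2'', pathSum_append, Finsupp.sum_add_index'
        (h := fun e (b : L F Γ) => b * gen F (.dual e)) (fun e => zero_mul _)
        (fun e b c => add_mul b c _)]
      abel
  | smul k a _ h1 =>
    obtain ⟨l, c, h1, h1', h1''⟩ := h1
    refine ⟨l.map fun q => (k * q.1, q.2), k • c, ?_, ?_, ?_⟩
    · intro e he
      exact h1 e (Finsupp.support_smul he)
    · intro hn
      rw [h1' hn, smul_zero]
    · rw [smul_mul_assoc, h1'', smul_add, pathSum_smul, Finsupp.sum_smul_index'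
        (fun e => zero_mul _), Finsupp.smul_sum]
      simp only [smul_mul_assoc]

theorem pathEval_powers {x : Γ.V} {p : List Γ.E} (hp0 : p ≠ [])
    (hp : Γ.IsPath x p x) (k : F) (l : List (F × List Γ.E))
    (hl : ∀ q ∈ l, ∃ n, q.2 = (List.replicate n p).flatten) :
    ∃ g : F[X], k • gen F (.vertex x) + pathSum x l = pathEval p g := by
  induction l with
  | nil => exact ⟨C k, by rw [pathEval_C hp0 hp, pathSum_nil, add_zero]⟩
  | cons q l ih =>
    obtain ⟨g, hg⟩ := ih fun q hq => hl q (by simp [hq])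
    obtain ⟨n, hn⟩ := hl q (by simp)
    refine ⟨monomial n q.1 + g, ?_⟩
    rw [pathEval_add, pathEval_monomial, pathPow_eq_pathTo hp0 hp, ← hn, ← hg, pathSum_cons]
    abel

variable {J J' : TwoSidedIdeal (L F Γ)}

/-- A combination of paths in `J` lies in `J'` if the polynomials in cycles with no exit do. -/
theorem pathSum_mem_of_mem {x : Γ.V} (hx : x ∉ vertexSet J)
    (h3 : ∀ p, Γ.NoExitIn (vertexSet J) (breakingSet J) x p →
      ∀ g : F[X], pathEval p g ∈ J → pathEval p g ∈ J')
    (l : List (F × List Γ.E)) (h : pathSum x l ∈ J) : pathSum x l ∈ J' := by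
  refine pathSum_mem_of_forall (P := fun b => b ∈ J) (fun c b hb => J.mul_mem_left _ _ hb) ?_ l h
  intro k m hk hm hmem
  obtain ⟨hlin, hm0⟩ := isLinear_of_mem _ hx hk le_rfl hm hmem
  obtain ⟨q, hq⟩ := List.exists_mem_of_ne_nil m hm0
  have havoid : ∀ q ∈ m, ∀ e ∈ q.2, Γ.tgt e ∉ vertexSet J := fun q hq =>
    ((hm q hq).2.tgt_notMem (fun _ => tgt_mem_vertexSet) hx).2
  obtain ⟨p, hp, hpow⟩ := hlin.exists_noExitIn (hm q hq).1 (hm q hq).2 (havoid q hq)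
  obtain ⟨g, hg⟩ := pathEval_powers hp.ne_nil hp.path k m fun q hq =>
    hpow q.2 (hm q hq).2 (havoid q hq)
  rw [hg] at hmem ⊢
  exact h3 p hp g hmem

/-- If infinitely many arrows go from `x` to vertices outside `J`, a nonzero combination of paths
ending at `x` is not annihilated modulo `J` by almost all of them. -/
theorem pathSum_mem_of_infinite {x : Γ.V}
    (hinf : {e | Γ.src e = x ∧ Γ.tgt e ∉ vertexSet J}.Infinite) (l : List (F × List Γ.E))
    (h : {e | Γ.src e = x ∧ Γ.tgt e ∉ vertexSet J ∧ pathSum x l * gen F (.arrow e) ∉ J}.Finite) :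
    pathSum x l ∈ J' := by
  classical
  refine pathSum_mem_of_forall (P := fun b =>
    {e | Γ.src e = x ∧ Γ.tgt e ∉ vertexSet J ∧ b * gen F (.arrow e) ∉ J}.Finite) ?_ ?_ l h
  · intro c b hb
    refine hb.subset fun e he => ⟨he.1, he.2.1, fun h => he.2.2 ?_⟩
    rw [mul_assoc]
    exact J.mul_mem_left _ _ h
  · intro k m hk hm hfin
    exfalso
    obtain ⟨e, ⟨rfl, heH⟩, he'⟩ := (hinf.sdiff (hfin.union
      ((m.flatMap fun q => q.2).toFinset.finite_toSet))).nonempty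
    simp only [Set.mem_union, Set.mem_ofPred_eq, not_or, not_and, not_not, Finset.mem_coe,
      List.mem_toFinset] at he'
    have h0 : gen F (.dual e) * pathSum (Γ.src e) m = 0 := by
      have h1 : ∀ q ∈ m, e ∉ q.2 := fun q hq heq => he'.2 (List.mem_flatMap.2 ⟨q, hq, heq⟩)
      clear hfin he'
      induction m with
      | nil => simp
      | cons q m ih =>
        obtain ⟨f, ν, hfν⟩ := List.exists_cons_of_ne_nil (hm q (by simp)).1
        have hef : e ≠ f := fun hef => h1 q (by simp) (by simp [hfν, hef])
        rw [pathSum_cons, mul_add, ih (fun q hq => hm q (by simp [hq]))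
          (fun q hq => h1 q (by simp [hq])), hfν, pathTo_cons, mul_smul_comm, ← mul_assoc,
          dual_mul_arrow_of_ne hef, zero_mul, smul_zero, add_zero]
    have h1 : (k • gen F (.vertex (Γ.src e)) + pathSum (Γ.src e) m) * gen F (.arrow e) ∈ J := by
      simpa [heH] using he'.1
    have h2 := J.mul_mem_left (gen F (.dual e)) _ h1
    rw [← mul_assoc, mul_add, h0, add_zero, mul_smul_comm, smul_mul_assoc, dual_mul_src,
      dual_mul_arrow_self] at h2
    exact heH (mem_of_smul_mem hk h2)

theorem pathSum_mem_of_isBreaking {x : Γ.V} (hb : Γ.IsBreaking (vertexSet J) x)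
    (hx : x ∉ breakingSet J) (l : List (F × List Γ.E))
    (h : pathSum x l * breakElem F (vertexSet J) x ∈ J) : pathSum x l ∈ J' := by
  refine pathSum_mem_of_forall (P := fun b => b * breakElem F (vertexSet J) x ∈ J) ?_ ?_ l h
  · intro c b hb
    rw [mul_assoc]
    exact J.mul_mem_left _ _ hb
  · intro k m hk hm h1
    refine absurd ?_ hx
    have h2 := J.mul_mem_left (breakElem F (vertexSet J) x) _ h1
    rw [← mul_assoc, mul_add, breakElem_mul_pathSum hb.2.1 (isBreaking_of_notMem hb) hm, add_zero,
      mul_smul_comm, smul_mul_assoc, breakElem_mul_vertex hb.2.1, breakElem_mul_self hb.2.1] at h2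
    exact ⟨hb, mem_of_smul_mem hk h2⟩

theorem dual_mul_breakElem_mem {x : Γ.V}
    (h : {e | Γ.src e = x ∧ Γ.tgt e ∉ vertexSet J}.Finite) (e : Γ.E) :
    gen F (.dual e) * breakElem F (vertexSet J) x ∈ J := by
  by_cases he : Γ.tgt e ∈ vertexSet J
  · exact J.mul_mem_right _ _ (dual_mem_of_tgt he)
  · rw [dual_mul_breakElem h he]
    exact J.zero_mem

/-- For a vertex with finitely many arrows, at least one of them, `x^H` is a sum over the arrows
into `H`. -/
theorem breakElem_mem_of_finite {x : Γ.V} (hH : vertexSet J ⊆ vertexSet J')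
    (hfin : {e | Γ.src e = x}.Finite) (hne : {e | Γ.src e = x}.Nonempty) :
    breakElem F (vertexSet J) x ∈ J' := by
  classical
  have hfin' : {e | Γ.src e = x ∧ Γ.tgt e ∉ vertexSet J}.Finite := hfin.subset fun e he => he.1
  rw [breakElem_eq hfin', vertex_eq_sum x hfin.toFinset (by simp) (by simpa using hne),
    ← Finset.sum_sdiff (s₁ := hfin'.toFinset) (s₂ := hfin.toFinset) (by
      intro e he
      simp at he ⊢
      exact he.1), add_sub_cancel_right]
  refine sum_mem fun e he => J'.mul_mem_right _ _ (arrow_mem_of_tgt (hH ?_))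
  simp at he
  exact he.2 he.1

/-- The structure of ideals of a Leavitt path algebra: an ideal `J` is contained in `J'` if `J'`
contains the vertices of `J`, the elements `x^H` for the breaking vertices of `J`, and the
polynomials in cycles with no exit that `J` contains. -/
theorem le_of_generators (hH : vertexSet J ⊆ vertexSet J')
    (hS : ∀ x ∈ breakingSet J, breakElem F (vertexSet J) x ∈ J')
    (hC : ∀ x p, Γ.NoExitIn (vertexSet J) (breakingSet J) x p →
      ∀ g : F[X], pathEval p g ∈ J → pathEval p g ∈ J') : J ≤ J' := by
  classical
  have main : ∀ n, ∀ a ∈ ghostDeg F Γ n, a ∈ J → a ∈ J' := by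
    intro n
    induction n with
    | zero =>
      intro a han haJ
      refine mem_of_forall_mul_vertex fun x => ?_
      obtain ⟨l, c, -, hc, h⟩ := exists_mul_vertex_eq han x
      by_cases hx : x ∈ vertexSet J
      · exact J'.mul_mem_left _ _ (hH hx)
      rw [hc rfl, Finsupp.sum_zero_index, add_zero] at h
      rw [h]
      exact pathSum_mem_of_mem hx (hC x) l (h ▸ J.mul_mem_right _ _ haJ)
    | succ n ih =>
      intro a han haJ
      refine mem_of_forall_mul_vertex fun x => ?_
      by_cases hx : x ∈ vertexSet J
      · exact J'.mul_mem_left _ _ (hH hx)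
      have hae : ∀ e, a * gen F (.arrow e) ∈ J' := fun e =>
        ih _ (mul_arrow_mem_ghostDeg han e) (J.mul_mem_right _ _ haJ)
      obtain ⟨l, c, hcx, -, h⟩ := exists_mul_vertex_eq han x
      have haxJ : a * gen F (.vertex x) ∈ J := J.mul_mem_right _ _ haJ
      have hce : ∀ e, Γ.src e = x →
          a * gen F (.arrow e) =
            pathSum x l * gen F (.arrow e) + c e * gen F (.vertex (Γ.tgt e)) := by
        rintro e rfl
        have h1 : a * gen F (.arrow e) = a * gen F (.vertex (Γ.src e)) * gen F (.arrow e) := by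
          rw [mul_assoc, src_mul_arrow]
        rw [h1, h, add_mul]
        congr 1
        rw [Finsupp.sum, Finset.sum_mul, Finset.sum_eq_single e, mul_assoc, dual_mul_arrow_self]
        · intro f _ hf
          rw [mul_assoc, dual_mul_arrow_of_ne hf, mul_zero]
        · intro he
          rw [Finsupp.notMem_support_iff.1 he, zero_mul, zero_mul]
      -- it is enough to deal with the combination of paths
      have hsuff : pathSum x l ∈ J' → a * gen F (.vertex x) ∈ J' := by
        intro hl
        rw [h]
        refine add_mem hl (sum_mem fun e he => ?_)
        have h1 : c e * gen F (.vertex (Γ.tgt e)) ∈ J' := by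
          have h2 := J'.sub_mem (hae e) (J'.mul_mem_right _ (gen F (.arrow e)) hl)
          rwa [hce e (hcx e he), add_sub_cancel_left] at h2
        change c e * gen F (.dual e) ∈ J'
        rw [← tgt_mul_dual, ← mul_assoc]
        exact J'.mul_mem_right _ _ h1
      by_cases hfin : {e | Γ.src e = x ∧ Γ.tgt e ∉ vertexSet J}.Finite
      · by_cases hbJ' : breakElem F (vertexSet J) x ∈ J'
        · have h1 : a * gen F (.vertex x) = a * breakElem F (vertexSet J) x +
              ∑ e ∈ hfin.toFinset, a * gen F (.arrow e) * gen F (.dual e) := by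
            rw [breakElem_eq hfin, mul_sub, Finset.mul_sum]
            simp only [mul_assoc, sub_add_cancel]
          rw [h1]
          exact add_mem (J'.mul_mem_left _ _ hbJ')
            (sum_mem fun e _ => J'.mul_mem_right _ _ (hae e))
        by_cases hne : {e | Γ.src e = x ∧ Γ.tgt e ∉ vertexSet J}.Nonempty
        · have hb : Γ.IsBreaking (vertexSet J) x := by
            refine ⟨fun hfin' => hbJ' (breakElem_mem_of_finite hH hfin' ?_), hfin, hne⟩
            exact hne.mono fun e he => he.1
          refine hsuff (pathSum_mem_of_isBreaking hb (fun hxS => hbJ' (hS x hxS)) l ?_)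
          have h1 : pathSum x l * breakElem F (vertexSet J) x =
              a * gen F (.vertex x) * breakElem F (vertexSet J) x -
                c.sum fun e b => b * (gen F (.dual e) * breakElem F (vertexSet J) x) := by
            rw [h, add_mul, Finsupp.sum, Finsupp.sum, Finset.sum_mul]
            simp only [mul_assoc, add_sub_cancel_right]
          rw [h1]
          exact J.sub_mem (J.mul_mem_right _ _ haxJ) (sum_mem fun e _ =>
            J.mul_mem_left _ _ (dual_mul_breakElem_mem hfin e))
        · refine hsuff (pathSum_mem_of_mem hx (hC x) l ?_)
          have h1 : pathSum x l =
              a * gen F (.vertex x) - c.sum fun e b => b * gen F (.dual e) := by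
            rw [h, add_sub_cancel_right]
          rw [h1]
          refine J.sub_mem haxJ (sum_mem fun e he => J.mul_mem_left _ _ (dual_mem_of_tgt ?_))
          by_contra he'
          exact hne ⟨e, hcx e he, he'⟩
      · refine hsuff (pathSum_mem_of_infinite hfin l
          (c.support.finite_toSet.subset fun e he => ?_))
        obtain ⟨h1, -, h3⟩ := he
        by_contra hec
        have h4 := hce e h1
        rw [Finsupp.notMem_support_iff.1 hec, zero_mul, add_zero] at h4
        exact h3 (h4 ▸ J.mul_mem_right _ _ haJ)
  intro a ha
  obtain ⟨n, hn⟩ := exists_mem_ghostDeg a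
  exact main n a hn ha

end Comparison

/-! ### The grading -/

section Grading

variable {F : Type w} [Field F] {Γ : DiGraph.{u, v}}

theorem isFamily_grading : IsFamily Γ (A := AddMonoidAlgebra (UnitalLPA F Γ) ℤ)
    (fun x => AddMonoidAlgebra.single 0 (unitalGen F Γ (.vertex x)))
    (fun e => AddMonoidAlgebra.single 1 (unitalGen F Γ (.arrow e)))
    (fun e => AddMonoidAlgebra.single (-1) (unitalGen F Γ (.dual e))) where
  idem x := by
    rw [AddMonoidAlgebra.single_mul_single, unitalGen_vertex_mul_self]; rfl
  orth x y h := by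
    have := congrArg Subtype.val (vertex_mul_of_ne (F := F) h)
    simp only [NonUnitalSubalgebra.coe_mul, coe_gen, NonUnitalSubalgebra.coe_zero] at this
    rw [AddMonoidAlgebra.single_mul_single, this, AddMonoidAlgebra.single_zero]
  src_mul e := by
    have := congrArg Subtype.val (src_mul_arrow (F := F) e)
    simp only [NonUnitalSubalgebra.coe_mul, coe_gen] at this
    rw [AddMonoidAlgebra.single_mul_single, this]; rfl
  mul_tgt e := by
    have := congrArg Subtype.val (arrow_mul_tgt (F := F) e)
    simp only [NonUnitalSubalgebra.coe_mul, coe_gen] at this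
    rw [AddMonoidAlgebra.single_mul_single, this]; rfl
  tgt_mul e := by
    have := congrArg Subtype.val (tgt_mul_dual (F := F) e)
    simp only [NonUnitalSubalgebra.coe_mul, coe_gen] at this
    rw [AddMonoidAlgebra.single_mul_single, this]; rfl
  mul_src e := by
    have := congrArg Subtype.val (dual_mul_src (F := F) e)
    simp only [NonUnitalSubalgebra.coe_mul, coe_gen] at this
    rw [AddMonoidAlgebra.single_mul_single, this]; rfl
  same e := by
    have := congrArg Subtype.val (dual_mul_arrow_self (F := F) e)
    simp only [NonUnitalSubalgebra.coe_mul, coe_gen] at this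
    rw [AddMonoidAlgebra.single_mul_single, this]; rfl
  diff e f h _ := by
    have := congrArg Subtype.val (dual_mul_arrow_of_ne (F := F) h)
    simp only [NonUnitalSubalgebra.coe_mul, coe_gen, NonUnitalSubalgebra.coe_zero] at this
    rw [AddMonoidAlgebra.single_mul_single, this, AddMonoidAlgebra.single_zero]
  ck2 x T hT hne := by
    have := congrArg Subtype.val (vertex_eq_sum (F := F) x T hT hne)
    simp only [AddSubmonoidClass.coe_finsetSum, NonUnitalSubalgebra.coe_mul, coe_gen] at this
    rw [this, ← AddMonoidAlgebra.singleAddHom_apply, map_sum]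
    refine Finset.sum_congr rfl fun e _ => ?_
    rw [AddMonoidAlgebra.single_mul_single]
    rfl

variable (F Γ) in
/-- The map `a ↦ a tⁿ` for `a` of degree `n`, to Laurent polynomials; it shows that the
homogeneous components are independent. -/
def gradingHom : UnitalLPA F Γ →ₐ[F] AddMonoidAlgebra (UnitalLPA F Γ) ℤ :=
  isFamily_grading.lift F

theorem gradingHom_of_isMonomial {n : ℤ} {a : L F Γ} (h : IsMonomial n a) :
    gradingHom F Γ a = AddMonoidAlgebra.single n (a : UnitalLPA F Γ) := by
  induction h with
  | vertex x => exact isFamily_grading.lift_gen _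
  | arrow e => exact isFamily_grading.lift_gen _
  | dual e => exact isFamily_grading.lift_gen _
  | mul _ _ h1 h2 =>
    rw [NonUnitalSubalgebra.coe_mul, map_mul, h1, h2, AddMonoidAlgebra.single_mul_single]

theorem gradingHom_of_mem {n : ℤ} {a : L F Γ} (h : a ∈ homogeneous F Γ n) :
    gradingHom F Γ a = AddMonoidAlgebra.single n (a : UnitalLPA F Γ) := by
  induction h using Submodule.span_induction with
  | mem a ha => exact gradingHom_of_isMonomial ha
  | zero => simp
  | add a b _ _ h1 h2 =>
    rw [NonUnitalSubalgebra.coe_add, map_add, h1, h2, AddMonoidAlgebra.single_add]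
  | smul c a _ h1 =>
    rw [NonUnitalSubalgebra.coe_smul, map_smul, h1, AddMonoidAlgebra.smul_single]

theorem isMonomial_mem {n : ℤ} {a : L F Γ} (h : IsMonomial n a) : a ∈ homogeneous F Γ n :=
  Submodule.subset_span h

theorem mul_mem_homogeneous {m n : ℤ} {a b : L F Γ} (ha : a ∈ homogeneous F Γ m)
    (hb : b ∈ homogeneous F Γ n) : a * b ∈ homogeneous F Γ (m + n) := by
  induction ha using Submodule.span_induction with
  | mem a ha =>
    induction hb using Submodule.span_induction with
    | mem b hb => exact isMonomial_mem (ha.mul hb)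
    | zero => rw [mul_zero]; exact Submodule.zero_mem _
    | add b c _ _ h1 h2 => rw [mul_add]; exact Submodule.add_mem _ h1 h2
    | smul c b _ h1 => rw [mul_smul_comm]; exact Submodule.smul_mem _ c h1
  | zero => rw [zero_mul]; exact Submodule.zero_mem _
  | add b c _ _ h1 h2 => rw [add_mul]; exact Submodule.add_mem _ h1 h2
  | smul c b _ h1 => rw [smul_mul_assoc]; exact Submodule.smul_mem _ c h1

theorem mem_closure_homogeneous (a : L F Γ) :
    a ∈ AddSubmonoid.closure {b : L F Γ | ∃ n, b ∈ homogeneous F Γ n} := by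
  induction a using L_induction with
  | hgen g =>
    refine AddSubmonoid.subset_closure ?_
    cases g with
    | vertex x => exact ⟨0, isMonomial_mem (.vertex x)⟩
    | arrow e => exact ⟨1, isMonomial_mem (.arrow e)⟩
    | dual e => exact ⟨-1, isMonomial_mem (.dual e)⟩
  | hadd a b h1 h2 => exact add_mem h1 h2
  | h0 => exact zero_mem _
  | hmul a b h1 h2 =>
    induction h1 using AddSubmonoid.closure_induction with
    | mem a ha =>
      induction h2 using AddSubmonoid.closure_induction with
      | mem b hb =>
        obtain ⟨m, hm⟩ := ha
        obtain ⟨n, hn⟩ := hb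
        exact AddSubmonoid.subset_closure ⟨m + n, mul_mem_homogeneous hm hn⟩
      | zero => rw [mul_zero]; exact zero_mem _
      | add b c _ _ h1 h2 => rw [mul_add]; exact add_mem h1 h2
    | zero => rw [zero_mul]; exact zero_mem _
    | add b c _ _ h1 h2 => rw [add_mul]; exact add_mem h1 h2
  | hsmul c a h =>
    induction h using AddSubmonoid.closure_induction with
    | mem a ha =>
      obtain ⟨m, hm⟩ := ha
      exact AddSubmonoid.subset_closure ⟨m, Submodule.smul_mem _ c hm⟩
    | zero => rw [smul_zero]; exact zero_mem _
    | add b c _ _ h1 h2 => rw [smul_add]; exact add_mem h1 h2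

/-- The largest graded ideal contained in `J`. -/
def gradedPart (J : TwoSidedIdeal (L F Γ)) : TwoSidedIdeal (L F Γ) :=
  .mk' (AddSubmonoid.closure {b : L F Γ | b ∈ J ∧ ∃ n, b ∈ homogeneous F Γ n}) (zero_mem _)
    add_mem
    (by
      intro a ha
      induction ha using AddSubmonoid.closure_induction with
      | mem a ha =>
        obtain ⟨h, m, hm⟩ := ha
        exact AddSubmonoid.subset_closure ⟨J.neg_mem h, m, by
          rw [← neg_one_smul F]; exact Submodule.smul_mem _ _ hm⟩
      | zero => rw [neg_zero]; exact zero_mem _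
      | add b c _ _ h1 h2 => rw [neg_add]; exact add_mem h1 h2)
    (by
      intro c a ha
      induction ha using AddSubmonoid.closure_induction with
      | mem a ha =>
        have hc := mem_closure_homogeneous c
        induction hc using AddSubmonoid.closure_induction with
        | mem c hc =>
          obtain ⟨m, hm⟩ := hc
          obtain ⟨h, n, hn⟩ := ha
          exact AddSubmonoid.subset_closure ⟨J.mul_mem_left _ _ h, _, mul_mem_homogeneous hm hn⟩
        | zero => rw [zero_mul]; exact zero_mem _
        | add b c _ _ h1 h2 => rw [add_mul]; exact add_mem h1 h2
      | zero => rw [mul_zero]; exact zero_mem _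
      | add b c _ _ h1 h2 => rw [mul_add]; exact add_mem h1 h2)
    (by
      intro a c ha
      induction ha using AddSubmonoid.closure_induction with
      | mem a ha =>
        have hc := mem_closure_homogeneous c
        induction hc using AddSubmonoid.closure_induction with
        | mem c hc =>
          obtain ⟨m, hm⟩ := hc
          obtain ⟨h, n, hn⟩ := ha
          exact AddSubmonoid.subset_closure ⟨J.mul_mem_right _ _ h, _, mul_mem_homogeneous hn hm⟩
        | zero => rw [mul_zero]; exact zero_mem _
        | add b c _ _ h1 h2 => rw [mul_add]; exact add_mem h1 h2
      | zero => rw [zero_mul]; exact zero_mem _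
      | add b c _ _ h1 h2 => rw [add_mul]; exact add_mem h1 h2)

theorem mem_gradedPart {J : TwoSidedIdeal (L F Γ)} {a : L F Γ} : a ∈ gradedPart J ↔
    a ∈ AddSubmonoid.closure {b : L F Γ | b ∈ J ∧ ∃ n, b ∈ homogeneous F Γ n} :=
  TwoSidedIdeal.mem_mk' ..

theorem mem_gradedPart_of_mem {J : TwoSidedIdeal (L F Γ)} {a : L F Γ} {n : ℤ} (ha : a ∈ J)
    (hn : a ∈ homogeneous F Γ n) : a ∈ gradedPart J :=
  mem_gradedPart.2 (AddSubmonoid.subset_closure ⟨ha, n, hn⟩)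

theorem gradedPart_le (J : TwoSidedIdeal (L F Γ)) : gradedPart J ≤ J := by
  intro a ha
  rw [mem_gradedPart] at ha
  induction ha using AddSubmonoid.closure_induction with
  | mem a ha => exact ha.1
  | zero => exact J.zero_mem
  | add b c _ _ h1 h2 => exact J.add_mem h1 h2

theorem isGraded_gradedPart (J : TwoSidedIdeal (L F Γ)) : IsGraded (gradedPart J) := by
  intro a ha
  rw [mem_gradedPart] at ha
  refine AddSubmonoid.closure_mono (fun b hb => ?_) ha
  obtain ⟨hb, n, hn⟩ := hb
  exact ⟨mem_gradedPart_of_mem hb hn, n, hn⟩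

theorem le_gradedPart {K J : TwoSidedIdeal (L F Γ)} (hK : IsGraded K) (hKJ : K ≤ J) :
    K ≤ gradedPart J := by
  intro a ha
  rw [mem_gradedPart]
  have h := hK a ha
  refine AddSubmonoid.closure_mono (fun b hb => ?_) h
  exact ⟨hKJ hb.1, hb.2⟩

theorem isGraded_bot : IsGraded (⊥ : TwoSidedIdeal (L F Γ)) := by
  intro a ha
  rw [TwoSidedIdeal.mem_bot] at ha
  rw [ha]
  exact zero_mem _

theorem pathTo_mem_homogeneous (l : List Γ.E) (x : Γ.V) :
    pathTo F l x ∈ homogeneous F Γ l.length := by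
  induction l with
  | nil => exact isMonomial_mem (.vertex x)
  | cons e l ih =>
    rw [pathTo_cons, List.length_cons, Nat.cast_succ, add_comm]
    exact mul_mem_homogeneous (isMonomial_mem (.arrow e)) ih

theorem breakElem_mem_homogeneous {H : Set Γ.V} {x : Γ.V}
    (h : {e | Γ.src e = x ∧ Γ.tgt e ∉ H}.Finite) : breakElem F H x ∈ homogeneous F Γ 0 := by
  rw [breakElem_eq h, sub_eq_add_neg, ← neg_one_smul F]
  refine Submodule.add_mem _ (isMonomial_mem (.vertex x)) (Submodule.smul_mem _ _
    (Submodule.sum_mem _ fun e _ => isMonomial_mem ?_))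
  exact (IsMonomial.arrow e).mul (.dual e)

theorem ghostFrom_mul_pathTo {x y : Γ.V} {l : List Γ.E} (h : Γ.IsPath x l y) :
    ghostFrom F l y * pathTo F l y = gen F (.vertex y) := by
  induction l generalizing x with
  | nil => exact vertex_mul_self y
  | cons e l ih =>
    rw [ghostFrom_cons, pathTo_cons, mul_assoc, ← mul_assoc (gen F (.dual e)), dual_mul_arrow_self,
      vertex_mul_pathTo h.2, ih h.2]

/-- A graded ideal contains a nonzero polynomial in a closed path only if it contains the vertex,
since it contains the monomials of the polynomial. -/
theorem eq_zero_of_pathEval_mem {I : TwoSidedIdeal (L F Γ)} (hI : IsGraded I) {x : Γ.V}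
    {p : List Γ.E} (hp0 : p ≠ []) (hp : Γ.IsPath x p x) (hx : x ∉ vertexSet I) {g : F[X]}
    (hg : pathEval p g ∈ I) : g = 0 := by
  have hcomp : ∀ a ∈ I, ∀ n : ℤ, ∃ c ∈ I, (c : UnitalLPA F Γ) = (gradingHom F Γ a).coeff n := by
    intro a ha n
    have ha' := hI a ha
    clear ha
    induction ha' using AddSubmonoid.closure_induction with
    | mem b hb =>
      obtain ⟨hbI, m, hm⟩ := hb
      rw [gradingHom_of_mem hm]
      by_cases hmn : m = n
      · exact ⟨b, hbI, by rw [AddMonoidAlgebra.coeff_single, hmn, Finsupp.single_eq_same]⟩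
      · exact ⟨0, I.zero_mem, by
          rw [AddMonoidAlgebra.coeff_single, Finsupp.single_eq_of_ne' hmn]; rfl⟩
    | zero => exact ⟨0, I.zero_mem, by simp⟩
    | add b c _ _ h1 h2 =>
      obtain ⟨d, hd, hd'⟩ := h1
      obtain ⟨f, hf, hf'⟩ := h2
      exact ⟨d + f, I.add_mem hd hf, by
        simp [hd', hf']⟩
  by_contra hg0
  have hlen : (p.length : ℤ) ≠ 0 := by
    have := List.length_pos_iff.2 hp0
    omega
  obtain ⟨c, hcI, hc⟩ := hcomp _ hg (g.natDegree * p.length)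
  have hdeg : ∀ n : ℕ, gradingHom F Γ (pathPow F p n) =
      AddMonoidAlgebra.single ((n : ℤ) * p.length) (pathPow F p n : UnitalLPA F Γ) := by
    intro n
    refine gradingHom_of_mem ?_
    rw [pathPow_eq_pathTo hp0 hp]
    have := pathTo_mem_homogeneous (F := F) (List.replicate n p).flatten x
    simpa using this
  have h1 : (gradingHom F Γ (pathEval p g)).coeff (g.natDegree * p.length) =
      g.leadingCoeff • (pathPow F p g.natDegree : UnitalLPA F Γ) := by
    rw [pathEval, Polynomial.sum, AddSubmonoidClass.coe_finsetSum, map_sum]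
    simp only [NonUnitalSubalgebra.coe_smul, map_smul, hdeg]
    rw [AddMonoidAlgebra.coeff_sum, Finset.sum_apply', Finset.sum_eq_single g.natDegree]
    · rw [AddMonoidAlgebra.coeff_smul, AddMonoidAlgebra.coeff_single, Finsupp.smul_apply,
        Finsupp.single_eq_same]
      rfl
    · intro n _ hn
      have h2 : (n : ℤ) * p.length ≠ g.natDegree * p.length := fun h2 =>
        hn (by exact_mod_cast mul_right_cancel₀ hlen h2)
      rw [AddMonoidAlgebra.coeff_smul, AddMonoidAlgebra.coeff_single, Finsupp.smul_apply,
        Finsupp.single_eq_of_ne' h2, smul_zero]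
    · intro h
      rw [notMem_support_iff.1 h, zero_smul]
      rfl
  have h2 : c = g.leadingCoeff • pathPow F p g.natDegree :=
    Subtype.ext (hc.trans h1)
  rw [h2] at hcI
  have h3 := mem_of_smul_mem (leadingCoeff_ne_zero.2 hg0) hcI
  rw [pathPow_eq_pathTo hp0 hp] at h3
  have h4 := I.mul_mem_left (ghostFrom F (List.replicate g.natDegree p).flatten x) _ h3
  rw [ghostFrom_mul_pathTo (hp.flatten_replicate _)] at h4
  exact hx h4

/-- A graded ideal is determined by its vertices and breaking vertices, and it is the largest
graded ideal in every ideal with the same vertices and breaking vertices. -/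
theorem isGreatest_of_eq {I J : TwoSidedIdeal (L F Γ)} (hI : IsGraded I)
    (hV : vertexSet J = vertexSet I) (hS : breakingSet J = breakingSet I) :
    IsGreatest {K | IsGraded K ∧ K ≤ J} I := by
  have hle : ∀ K : TwoSidedIdeal (L F Γ), IsGraded K → ∀ K', vertexSet K' = vertexSet K →
      breakingSet K' = breakingSet K → K ≤ K' := by
    intro K hK K' h1 h2
    refine le_of_generators h1.ge ?_ ?_
    · intro x hx
      rw [← h2] at hx
      rw [← h1]
      exact hx.2
    · intro x p hp g hg
      obtain ⟨e, l, rfl⟩ := List.exists_cons_of_ne_nil hp.ne_nil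
      have hx : x ∉ vertexSet K := hp.path.1 ▸ src_notMem_vertexSet (hp.tgt_notMem e (by simp))
      rw [eq_zero_of_pathEval_mem hK hp.ne_nil hp.path hx hg, pathEval_zero]
      exact K'.zero_mem
  have hIJ := hle I hI J hV hS
  refine ⟨⟨hI, hIJ⟩, fun K hK => (le_gradedPart hK.1 hK.2).trans ?_⟩
  have h1 : I ≤ gradedPart J := le_gradedPart hI hIJ
  have h2 : vertexSet (gradedPart J) = vertexSet I := by
    refine Set.Subset.antisymm ?_ fun x hx => h1 hx
    rw [← hV]
    exact fun x hx => gradedPart_le J hx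
  refine hle _ (isGraded_gradedPart J) _ h2.symm (Set.Subset.antisymm ?_ ?_)
  · intro x hx
    rw [mem_breakingSet] at hx ⊢
    rw [h2]
    exact ⟨hx.1, h1 hx.2⟩
  · rw [← hS]
    intro x hx
    rw [mem_breakingSet] at hx ⊢
    rw [hV, ← h2]
    exact ⟨hx.1, gradedPart_le J hx.2⟩

theorem eq_of_isGreatest {I J : TwoSidedIdeal (L F Γ)}
    (h : IsGreatest {K | IsGraded K ∧ K ≤ J} I) :
    vertexSet J = vertexSet I ∧ breakingSet J = breakingSet I := by
  have h1 : gradedPart J ≤ I := h.2 ⟨isGraded_gradedPart J, gradedPart_le J⟩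
  have h2 : I ≤ J := h.1.2
  have h3 : vertexSet J = vertexSet I :=
    Set.Subset.antisymm (fun x hx => h1 (mem_gradedPart_of_mem hx (isMonomial_mem (.vertex x))))
      fun x hx => h2 hx
  refine ⟨h3, Set.Subset.antisymm ?_ ?_⟩
  · intro x hx
    rw [mem_breakingSet] at hx ⊢
    rw [← h3]
    exact ⟨hx.1, h1 (mem_gradedPart_of_mem hx.2 (breakElem_mem_homogeneous hx.1.2.1))⟩
  · intro x hx
    rw [mem_breakingSet] at hx ⊢
    rw [h3]
    exact ⟨hx.1, h2 hx.2⟩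

end Grading

/-! ### Cycles as closed paths -/

namespace DiGraph

variable {Γ : DiGraph.{u, v}}

theorem isPath_iff_isChain (e : Γ.E) (l : List Γ.E) (a : Γ.E) :
    List.IsChain (fun e f => Γ.tgt e = Γ.src f) (e :: (l ++ [a])) ↔
      Γ.IsPath (Γ.src e) (e :: l) (Γ.src a) := by
  induction l generalizing e with
  | nil => simp
  | cons f l ih =>
    rw [List.cons_append, List.isChain_cons_cons, ih, isPath_cons, isPath_cons, isPath_cons,
      eq_comm]
    simp

theorem isGeomCycle_coe {p : List Γ.E} : Γ.IsGeomCycle (p : Cycle Γ.E) ↔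
    p ≠ [] ∧ (∃ x, Γ.IsPath x p x) ∧ (p.map Γ.src).Nodup := by
  cases p with
  | nil => simp [IsGeomCycle]
  | cons e l =>
    rw [IsGeomCycle, Cycle.chain_coe_cons, isPath_iff_isChain, Cycle.map_coe,
      Cycle.nodup_coe_iff, Ne, Cycle.coe_eq_nil]
    refine and_congr Iff.rfl (and_congr ⟨fun h => ⟨_, h⟩, ?_⟩ Iff.rfl)
    rintro ⟨x, hx⟩
    rw [hx.1]
    exact hx

theorem IsPath.rotate_cons {x : Γ.V} {e : Γ.E} {l : List Γ.E} (h : Γ.IsPath x (e :: l) x) :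
    Γ.IsPath (Γ.tgt e) (l ++ [e]) (Γ.tgt e) := h.2.append ⟨h.1, rfl⟩

theorem IsPath.of_isRotated {x : Γ.V} {p q : List Γ.E} (h : Γ.IsPath x p x) (hpq : p ~r q) :
    ∃ y, Γ.IsPath y q y := by
  obtain ⟨n, rfl⟩ := hpq
  induction n generalizing x p with
  | zero => exact ⟨x, by simpa using h⟩
  | succ n ih =>
    cases p with
    | nil => exact ⟨x, by simp [h]⟩
    | cons e l =>
      rw [List.rotate_cons_succ]
      exact ih h.rotate_cons

theorem exists_isRotated_cons {α : Type*} {a : α} {p : List α} (h : a ∈ p) :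
    ∃ l, p ~r (a :: l) := by
  obtain ⟨s, t, rfl⟩ := List.append_of_mem h
  exact ⟨t ++ s, by simpa using List.isRotated_append (l := s) (l' := a :: t)⟩

theorem IsPath.exists_rotated {x : Γ.V} {p : List Γ.E} (h : Γ.IsPath x p x) {e : Γ.E}
    (he : e ∈ p) : ∃ l, p ~r (e :: l) ∧ Γ.IsPath (Γ.src e) (e :: l) (Γ.src e) := by
  obtain ⟨l, hl⟩ := exists_isRotated_cons he
  obtain ⟨y, hy⟩ := h.of_isRotated hl
  refine ⟨l, hl, ?_⟩
  rw [hy.1]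
  exact hy

theorem IsPath.exists_src_eq {x : Γ.V} {p : List Γ.E} (h : Γ.IsPath x p x) {e : Γ.E}
    (he : e ∈ p) : ∃ g ∈ p, Γ.src g = Γ.tgt e := by
  obtain ⟨l, hl, h2⟩ := h.exists_rotated he
  cases l with
  | nil => exact ⟨e, he, h2.2.symm⟩
  | cons g l => exact ⟨g, hl.mem_iff.2 (by simp), h2.2.1⟩

theorem IsPath.exists_tgt_eq {x : Γ.V} {p : List Γ.E} (h : Γ.IsPath x p x) {e : Γ.E}
    (he : e ∈ p) : ∃ g ∈ p, Γ.tgt g = Γ.src e := by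
  have key : ∀ (l : List Γ.E) (x y : Γ.V), l ≠ [] → Γ.IsPath x l y → ∃ g ∈ l, Γ.tgt g = y := by
    intro l
    induction l with
    | nil => exact fun _ _ h => absurd rfl h
    | cons f l ih =>
      intro x y _ hxy
      cases l with
      | nil => exact ⟨f, by simp, hxy.2⟩
      | cons g l =>
        obtain ⟨k, hk, h⟩ := ih _ y (by simp) hxy.2
        exact ⟨k, List.mem_cons_of_mem _ hk, h⟩
  obtain ⟨l, hl, h2⟩ := h.exists_rotated he
  obtain ⟨g, hg, hge⟩ := key _ _ _ (by simp) h2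
  exact ⟨g, hl.mem_iff.2 hg, hge⟩

/-! ### Cycles with no exit in a quotient digraph -/

variable {H S : Set Γ.V}

/-- A vertex outside `H`, as a vertex of `Γ / (H, S)`. -/
def keepV (H S : Set Γ.V) (x : Γ.V) (hx : x ∉ H) : (Γ.quotient H S).V := Sum.inl ⟨x, hx⟩

/-- The added sink `x'` of a breaking vertex `x ∉ S`. -/
def sinkV (H S : Set Γ.V) (x : Γ.V) (hx : Γ.IsBreaking H x ∧ x ∉ S) : (Γ.quotient H S).V :=
  Sum.inr ⟨x, hx⟩

/-- An arrow between vertices outside `H`, as an arrow of `Γ / (H, S)`. -/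
def keepE (H S : Set Γ.V) (e : Γ.E) (he : Γ.src e ∉ H ∧ Γ.tgt e ∉ H) : (Γ.quotient H S).E :=
  Sum.inl ⟨e, he⟩

/-- The added arrow `e'`. -/
def sinkE (H S : Set Γ.V) (e : Γ.E)
    (he : Γ.src e ∉ H ∧ Γ.IsBreaking H (Γ.tgt e) ∧ Γ.tgt e ∉ S) : (Γ.quotient H S).E :=
  Sum.inr ⟨e, he⟩

section Quotient

variable {x y : Γ.V} {e f : Γ.E}

theorem keepV_inj {hx : x ∉ H} {hy : y ∉ H} : keepV H S x hx = keepV H S y hy ↔ x = y :=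
  Sum.inl_injective.eq_iff.trans Subtype.ext_iff

theorem sinkV_inj {hx : Γ.IsBreaking H x ∧ x ∉ S} {hy : Γ.IsBreaking H y ∧ y ∉ S} :
    sinkV H S x hx = sinkV H S y hy ↔ x = y :=
  Sum.inr_injective.eq_iff.trans Subtype.ext_iff

theorem keepV_ne_sinkV {hx : x ∉ H} {hy : Γ.IsBreaking H y ∧ y ∉ S} :
    keepV H S x hx ≠ sinkV H S y hy := Sum.inl_ne_inr

theorem keepE_inj {he : Γ.src e ∉ H ∧ Γ.tgt e ∉ H} {hf : Γ.src f ∉ H ∧ Γ.tgt f ∉ H} :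
    keepE H S e he = keepE H S f hf ↔ e = f :=
  Sum.inl_injective.eq_iff.trans Subtype.ext_iff

theorem sinkE_inj {he : Γ.src e ∉ H ∧ Γ.IsBreaking H (Γ.tgt e) ∧ Γ.tgt e ∉ S}
    {hf : Γ.src f ∉ H ∧ Γ.IsBreaking H (Γ.tgt f) ∧ Γ.tgt f ∉ S} :
    sinkE H S e he = sinkE H S f hf ↔ e = f :=
  Sum.inr_injective.eq_iff.trans Subtype.ext_iff

theorem keepE_ne_sinkE {he : Γ.src e ∉ H ∧ Γ.tgt e ∉ H}
    {hf : Γ.src f ∉ H ∧ Γ.IsBreaking H (Γ.tgt f) ∧ Γ.tgt f ∉ S} :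
    keepE H S e he ≠ sinkE H S f hf := Sum.inl_ne_inr

theorem quotient_cases (e : (Γ.quotient H S).E) :
    (∃ e₀ he, e = keepE H S e₀ he) ∨ ∃ e₀ he, e = sinkE H S e₀ he := by
  rcases e with e | e
  exacts [Or.inl ⟨e.1, e.2, rfl⟩, Or.inr ⟨e.1, e.2, rfl⟩]

theorem quotient_cases_vertex (v : (Γ.quotient H S).V) :
    (∃ x hx, v = keepV H S x hx) ∨ ∃ x hx, v = sinkV H S x hx := by
  rcases v with v | v
  exacts [Or.inl ⟨v.1, v.2, rfl⟩, Or.inr ⟨v.1, v.2, rfl⟩]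

theorem src_keepE (he) : (Γ.quotient H S).src (keepE H S e he) = keepV H S (Γ.src e) he.1 := rfl
theorem tgt_keepE (he) : (Γ.quotient H S).tgt (keepE H S e he) = keepV H S (Γ.tgt e) he.2 := rfl
theorem baseArrow_keepE (he) : Γ.baseArrow H S (keepE H S e he) = e := rfl

end Quotient

theorem isPath_quotient {q : List (Γ.quotient H S).E} (hq : ∀ e ∈ q, ∃ e₀ he, e = keepE H S e₀ he)
    {x y : Γ.V} (hx : x ∉ H) (hy : y ∉ H) :
    (Γ.quotient H S).IsPath (keepV H S x hx) q (keepV H S y hy) ↔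
      Γ.IsPath x (q.map (Γ.baseArrow H S)) y := by
  induction q generalizing x with
  | nil => simp [IsPath, keepV_inj]
  | cons e q ih =>
    obtain ⟨e₀, he₀, rfl⟩ := hq e (by simp)
    rw [List.map_cons, isPath_cons, isPath_cons, src_keepE, tgt_keepE, keepV_inj, baseArrow_keepE,
      ih (fun e he => hq e (by simp [he])) he₀.2]

theorem src_quotient_eq {e f : (Γ.quotient H S).E} :
    (Γ.quotient H S).src e = (Γ.quotient H S).src f ↔
      Γ.src (Γ.baseArrow H S e) = Γ.src (Γ.baseArrow H S f) := by
  rcases quotient_cases e with ⟨e, he, rfl⟩ | ⟨e, he, rfl⟩ <;>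
  rcases quotient_cases f with ⟨f, hf, rfl⟩ | ⟨f, hf, rfl⟩ <;>
  exact keepV_inj

/-- A cycle in a quotient digraph avoids the added sinks. -/
theorem eq_keepE_of_isPath {x : (Γ.quotient H S).V} {q : List (Γ.quotient H S).E}
    (h : (Γ.quotient H S).IsPath x q x) : ∀ e ∈ q, ∃ e₀ he, e = keepE H S e₀ he := by
  intro e he
  obtain ⟨g, -, hg⟩ := h.exists_src_eq he
  rcases quotient_cases e with h | ⟨e, he, rfl⟩
  · exact h
  · rcases quotient_cases g with ⟨g, hg', rfl⟩ | ⟨g, hg', rfl⟩ <;>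
    exact absurd hg keepV_ne_sinkV

/-- A cycle with no exit in `Γ / (H, S)` is a closed path of `Γ` with the corresponding
property. -/
theorem exists_noExitIn_of_mem {C : Cycle (Γ.quotient H S).E}
    (hC : C ∈ (Γ.quotient H S).noExitCycles) :
    ∃ x p, Γ.NoExitIn H S x p ∧ C.map (Γ.baseArrow H S) = (p : Cycle Γ.E) := by
  obtain ⟨q, rfl⟩ := Quotient.exists_rep C
  obtain ⟨hgeom, hexit⟩ := hC
  obtain ⟨hq0, ⟨x', hx'⟩, hnd⟩ := isGeomCycle_coe.1 hgeom
  have hinl := eq_keepE_of_isPath hx'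
  have hmem : ∀ e f, e ∈ q → (Γ.quotient H S).src f = (Γ.quotient H S).src e → f = e := by
    intro e f he hfe
    by_contra hne
    refine hexit f ⟨fun hf => hne (List.inj_on_of_nodup_map hnd hf he hfe), ?_⟩
    rw [hfe]
    exact Cycle.mem_map.2 ⟨e, he, rfl⟩
  obtain ⟨x, hx, hxq⟩ : ∃ (x : Γ.V) (hx : x ∉ H), x' = keepV H S x hx := by
    cases q with
    | nil => exact absurd rfl hq0
    | cons e q =>
      obtain ⟨e₀, he₀, rfl⟩ := hinl e (by simp)
      exact ⟨_, he₀.1, hx'.1.symm⟩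
  rw [hxq] at hx'
  have hpath := (isPath_quotient hinl hx hx).1 hx'
  refine ⟨x, q.map (Γ.baseArrow H S), ⟨by simpa using hq0, hpath, ?_, ?_, ?_, ?_⟩, rfl⟩
  · intro e he
    obtain ⟨e', he', rfl⟩ := List.mem_map.1 he
    obtain ⟨e₀, he₀, rfl⟩ := hinl e' he'
    exact he₀.2
  · intro e he f hfe hfH
    obtain ⟨e', he', rfl⟩ := List.mem_map.1 he
    obtain ⟨e₀, he₀, rfl⟩ := hinl e' he'
    have hsf : Γ.src f ∉ H := by rw [hfe]; exact he₀.1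
    have := hmem _ (keepE H S f ⟨hsf, hfH⟩) he' (src_quotient_eq.2 hfe)
    rw [← this, baseArrow_keepE]
  · rintro e he ⟨hb, hbS⟩
    obtain ⟨g, hg, hge⟩ := hpath.exists_tgt_eq he
    obtain ⟨g', hg', rfl⟩ := List.mem_map.1 hg
    obtain ⟨g₀, hg₀, rfl⟩ := hinl g' hg'
    rw [← hge] at hb hbS
    exact absurd (hmem _ (sinkE H S g₀ ⟨hg₀.1, hb, hbS⟩) hg' (src_quotient_eq.2 rfl)).symm
      keepE_ne_sinkE
  · rw [List.nodup_iff_pairwise_ne, List.pairwise_map, List.pairwise_map]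
    rw [List.nodup_iff_pairwise_ne, List.pairwise_map] at hnd
    exact hnd.imp fun h h' => h (src_quotient_eq.2 h')

/-- A closed path of `Γ` that has no exit outside `H` comes from a cycle with no exit in
`Γ / (H, S)`. -/
theorem NoExitIn.exists_mem (hH : ∀ e, Γ.src e ∈ H → Γ.tgt e ∈ H) {x : Γ.V} {p : List Γ.E}
    (hp : Γ.NoExitIn H S x p) :
    ∃ C ∈ (Γ.quotient H S).noExitCycles, C.map (Γ.baseArrow H S) = (p : Cycle Γ.E) := by
  have hall : ∀ e ∈ p, Γ.src e ∉ H ∧ Γ.tgt e ∉ H := fun e he =>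
    ⟨fun h => hp.tgt_notMem e he (hH e h), hp.tgt_notMem e he⟩
  obtain ⟨q, hqinl, hqp⟩ : ∃ q : List (Γ.quotient H S).E,
      (∀ e ∈ q, ∃ e₀ he, e = keepE H S e₀ he) ∧ q.map (Γ.baseArrow H S) = p := by
    clear hp
    induction p with
    | nil => exact ⟨[], by simp, rfl⟩
    | cons e p ih =>
      obtain ⟨q, h1, h2⟩ := ih fun e he => hall e (by simp [he])
      refine ⟨keepE H S e (hall e (by simp)) :: q, ?_, by rw [List.map_cons, h2]; rfl⟩
      intro f hf
      rcases List.mem_cons.1 hf with rfl | hf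
      exacts [⟨_, _, rfl⟩, h1 f hf]
  have hx : x ∉ H := by
    obtain ⟨e, l, rfl⟩ := List.exists_cons_of_ne_nil hp.ne_nil
    rw [← hp.path.1]
    exact (hall e (by simp)).1
  refine ⟨(q : Cycle _), ⟨isGeomCycle_coe.2 ⟨?_, ⟨keepV H S x hx, ?_⟩, ?_⟩, ?_⟩, ?_⟩
  · rintro rfl
    exact hp.ne_nil hqp.symm
  · rw [isPath_quotient hqinl, hqp]
    exact hp.path
  · have h1 := hp.nodup
    rw [← hqp, List.nodup_iff_pairwise_ne, List.pairwise_map, List.pairwise_map] at h1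
    rw [List.nodup_iff_pairwise_ne, List.pairwise_map]
    exact h1.imp fun h h' => h (src_quotient_eq.1 h')
  · rintro f ⟨hfq, hfm⟩
    obtain ⟨e', he', hfe⟩ := Cycle.mem_map.1 hfm
    have he : Γ.baseArrow H S e' ∈ p := by rw [← hqp]; exact List.mem_map_of_mem he'
    obtain ⟨e₀, he₀, rfl⟩ := hqinl e' he'
    have hsrc := (src_quotient_eq.1 hfe).symm
    rw [baseArrow_keepE] at he hsrc
    rcases quotient_cases f with ⟨f, hf, rfl⟩ | ⟨f, hf, rfl⟩
    · obtain rfl := hp.unique _ he f hsrc hf.2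
      exact hfq he'
    · obtain ⟨g, hg1, hg2⟩ := hf.2.1.2.2
      have hfH : Γ.tgt f ∉ H := fun h => hg2 (hH g (hg1 ▸ h))
      obtain rfl := hp.unique _ he f hsrc hfH
      obtain ⟨k, hk, hke⟩ := hp.path.exists_src_eq he
      refine hp.notBreaking k hk ?_
      rw [hke]
      exact hf.2
  · rw [Cycle.map_coe, hqp]

/-- Two cycles with no exit that share an arrow coincide. -/
theorem noExitCycles_disjoint {C D : Cycle Γ.E} (hC : C ∈ Γ.noExitCycles)
    (hD : D ∈ Γ.noExitCycles) {e : Γ.E} (heC : e ∈ C) (heD : e ∈ D) : C = D := by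
  obtain ⟨p, rfl⟩ := Quotient.exists_rep C
  obtain ⟨q, rfl⟩ := Quotient.exists_rep D
  obtain ⟨-, ⟨x, hx⟩, hpn⟩ := isGeomCycle_coe.1 hC.1
  obtain ⟨-, ⟨y, hy⟩, hqn⟩ := isGeomCycle_coe.1 hD.1
  obtain ⟨p', hp', hpath⟩ := hx.exists_rotated heC
  obtain ⟨q', hq', hqath⟩ := hy.exists_rotated heD
  have hpe : (Quotient.mk _ p : Cycle Γ.E) = ((e :: p' : List Γ.E) : Cycle Γ.E) :=
    Cycle.coe_eq_coe.2 hp'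
  have hqe : (Quotient.mk _ q : Cycle Γ.E) = ((e :: q' : List Γ.E) : Cycle Γ.E) :=
    Cycle.coe_eq_coe.2 hq'
  rw [hpe] at hC
  rw [hqe] at hD
  rw [hpe, hqe]
  have hp'n := (isGeomCycle_coe.1 hC.1).2.2
  have hq'n := (isGeomCycle_coe.1 hD.1).2.2
  -- a cycle with no exit continues in only one way
  have hdet : ∀ (l : List Γ.E), (l : Cycle Γ.E) ∈ Γ.noExitCycles → ∀ f ∈ l, ∀ g,
      Γ.src g = Γ.src f → g = f := by
    intro l hl f hf g hgf
    by_contra hne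
    refine hl.2 g ⟨fun hg => hne (List.inj_on_of_nodup_map (isGeomCycle_coe.1 hl.1).2.2 hg hf hgf),
      ?_⟩
    rw [hgf]
    exact Cycle.mem_map.2 ⟨f, hf, rfl⟩
  have key : ∀ (l m : List Γ.E) (z : Γ.V), Γ.IsPath z l (Γ.src e) → Γ.IsPath z m (Γ.src e) →
      (∀ f ∈ l, ∀ g, Γ.src g = Γ.src f → g = f) →
      (∀ f ∈ l, Γ.src f ≠ Γ.src e) → (∀ f ∈ m, Γ.src f ≠ Γ.src e) → l = m := by
    intro l
    induction l with
    | nil =>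
      intro m z hl hm _ _ hme
      cases m with
      | nil => rfl
      | cons g m => exact absurd (hm.1.trans hl) (hme g (by simp))
    | cons f l ih =>
      intro m z hl hm hdet hle hme
      cases m with
      | nil => exact absurd (hl.1.trans hm) (hle f (by simp))
      | cons g m =>
        obtain rfl := hdet f (by simp) g (hm.1.trans hl.1.symm)
        rw [ih m _ hl.2 hm.2 (fun f hf => hdet f (by simp [hf])) (fun f hf => hle f (by simp [hf]))
          fun f hf => hme f (by simp [hf])]
  rw [List.map_cons, List.nodup_cons] at hp'n hq'n
  rw [key p' q' _ hpath.2 hqath.2 (fun f hf => hdet _ hC f (by simp [hf]))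
    (fun f hf h => hp'n.1 (List.mem_map.2 ⟨f, hf, h⟩))
    (fun f hf h => hq'n.1 (List.mem_map.2 ⟨f, hf, h⟩))]

end DiGraph

/-! ### Canonical polynomials -/

section Canonical

variable {F : Type w} [Field F] {Γ : DiGraph.{u, v}} {J : TwoSidedIdeal (L F Γ)}

theorem pathEval_mem_of_isRotated {x : Γ.V} {p q : List Γ.E} (hp : Γ.IsPath x p x) (hpq : p ~r q)
    {g : F[X]} (h : pathEval p g ∈ J) : pathEval q g ∈ J := by
  obtain ⟨n, rfl⟩ := hpq
  induction n generalizing x p with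
  | zero => simpa using h
  | succ n ih =>
    cases p with
    | nil => simpa using h
    | cons e l =>
      rw [List.rotate_cons_succ]
      refine ih hp.rotate_cons ?_
      rw [← dual_mul_pathEval_mul_arrow hp]
      exact J.mul_mem_right _ _ (J.mul_mem_left _ _ h)

/-- It is enough to test a canonical polynomial on one closed path of a cycle. -/
theorem isCanonicalPoly_coe_iff {x : Γ.V} {p : List Γ.E} (hp : Γ.IsPath x p x) {f : F[X]} :
    IsCanonicalPoly J (p : Cycle Γ.E) f ↔ f.coeff 0 = 1 ∧ 0 < f.natDegree ∧
      ∀ g : F[X], pathEval p g ∈ J ↔ f ∣ g := by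
  refine and_congr Iff.rfl (and_congr Iff.rfl ⟨fun h => h p rfl, fun h q hq g => ?_⟩)
  rw [← h g]
  have hqp := Cycle.coe_eq_coe.1 hq
  obtain ⟨y, hy⟩ := hp.of_isRotated hqp.symm
  exact ⟨pathEval_mem_of_isRotated hy hqp, pathEval_mem_of_isRotated hp hqp.symm⟩

/-- The polynomials `g` with `g(p) ∈ J`. -/
def polyIdeal (J : TwoSidedIdeal (L F Γ)) {x : Γ.V} {p : List Γ.E} (hp0 : p ≠ [])
    (hp : Γ.IsPath x p x) : Ideal F[X] where
  carrier := {g | pathEval p g ∈ J}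
  add_mem' {g h} hg hh := by
    change pathEval p (g + h) ∈ J
    rw [pathEval_add]
    exact J.add_mem hg hh
  zero_mem' := by
    change pathEval p 0 ∈ J
    rw [pathEval_zero]
    exact J.zero_mem
  smul_mem' c g hg := by
    change pathEval p (c * g) ∈ J
    rw [pathEval_mul hp0 hp]
    exact J.mul_mem_left _ _ hg

theorem exists_isCanonicalPoly {x : Γ.V} {p : List Γ.E} (hp0 : p ≠ []) (hp : Γ.IsPath x p x)
    (hx : x ∉ vertexSet J) {g : F[X]} (hg0 : g ≠ 0) (hg : pathEval p g ∈ J) :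
    ∃ f, IsCanonicalPoly J (p : Cycle Γ.E) f := by
  set A := polyIdeal J hp0 hp
  have hA : ∀ h : F[X], pathEval p h ∈ J ↔ Submodule.IsPrincipal.generator A ∣ h := fun h =>
    Submodule.IsPrincipal.mem_iff_generator_dvd A (x := h)
  set f := Submodule.IsPrincipal.generator A
  have hf0 : f ≠ 0 := by
    intro h
    have := (hA g).1 hg
    rw [h, zero_dvd_iff] at this
    exact hg0 this
  have hc : f.coeff 0 ≠ 0 := by
    -- otherwise `f` could be divided by `x`, since `p* p` is a vertex
    intro h
    obtain ⟨h', hh'⟩ := X_dvd_iff.2 h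
    have h1 : pathEval p h' ∈ J := by
      have h2 := J.mul_mem_left (ghostFrom F p x) _ ((hA f).2 dvd_rfl)
      rwa [hh', pathEval_mul hp0 hp, pathEval_X hp0 hp, ← mul_assoc, ghostFrom_mul_pathTo hp,
        vertex_mul_pathEval hp0 hp] at h2
    have h2 := (hA h').1 h1
    have h3 : h' ≠ 0 := by
      rintro rfl
      exact hf0 (by rw [hh', mul_zero])
    have h4 := natDegree_le_of_dvd h2 h3
    rw [hh', natDegree_X_mul h3] at h4
    omega
  refine ⟨C (f.coeff 0)⁻¹ * f, (isCanonicalPoly_coe_iff hp).2 ⟨?_, ?_, fun h => ?_⟩⟩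
  · rw [coeff_C_mul, inv_mul_cancel₀ hc]
  · rw [natDegree_C_mul (inv_ne_zero hc), Nat.pos_iff_ne_zero]
    intro h
    rw [eq_C_of_natDegree_eq_zero h] at hA
    refine hx ?_
    rw [mem_vertexSet, ← pathEval_one hp0 hp, hA]
    exact (isUnit_C.2 (isUnit_iff_ne_zero.2 hc)).dvd
  · rw [hA]
    exact ((isUnit_C.2 (isUnit_iff_ne_zero.2 (inv_ne_zero hc))).mul_left_dvd).symm

theorem pathEval_eq_add {x : Γ.V} {e : Γ.E} {l : List Γ.E} (hp : Γ.IsPath x (e :: l) x)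
    (f : F[X]) : ∃ a, pathEval (e :: l) f =
      gen F (.arrow e) * a + f.coeff 0 • gen F (.vertex x) := by
  refine ⟨pathTo F l x * pathEval (e :: l) f.divX, ?_⟩
  conv_lhs => rw [← X_mul_divX_add f]
  rw [pathEval_add, pathEval_C (by simp) hp, pathEval_mul (by simp) hp, pathEval_X (by simp) hp,
    pathTo_cons, mul_assoc]

/-- Only cycles with no exit in `Γ / J` contribute canonical polynomials. -/
theorem IsCanonicalPoly.noExitIn {p : List Γ.E} (hp : Γ.IsGeomCycle (p : Cycle Γ.E)) {f : F[X]}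
    (hf : IsCanonicalPoly J (p : Cycle Γ.E) f) :
    ∃ x, Γ.NoExitIn (vertexSet J) (breakingSet J) x p := by
  obtain ⟨hp0, ⟨x, hx⟩, hnd⟩ := DiGraph.isGeomCycle_coe.1 hp
  have hsrc : ∀ e ∈ p, Γ.src e ∉ vertexSet J := by
    intro e he hmem
    obtain ⟨l, hl, hpath⟩ := hx.exists_rotated he
    rw [mem_vertexSet, ← pathEval_one (by simp) hpath,
      hf.2.2 _ (Cycle.coe_eq_coe.2 hl.symm) 1] at hmem
    have h := natDegree_le_of_dvd hmem one_ne_zero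
    have := hf.2.1
    rw [natDegree_one] at h
    omega
  have htgt : ∀ e ∈ p, Γ.tgt e ∉ vertexSet J := by
    intro e he
    obtain ⟨g, hg, hge⟩ := hx.exists_src_eq he
    rw [← hge]
    exact hsrc g hg
  refine ⟨x, hp0, hx, htgt, ?_, ?_, hnd⟩
  · intro e he g hge hgJ
    by_contra hne
    obtain ⟨l, hl, hpath⟩ := hx.exists_rotated he
    have h1 := (hf.2.2 _ (Cycle.coe_eq_coe.2 hl.symm) f).2 dvd_rfl
    obtain ⟨a, ha⟩ := pathEval_eq_add hpath f
    have h2 := J.mul_mem_right _ (gen F (.arrow g)) (J.mul_mem_left (gen F (.dual g)) _ h1)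
    rw [ha, hf.1, one_smul, mul_add, ← mul_assoc, dual_mul_arrow_of_ne hne, zero_mul, zero_add,
      ← hge, dual_mul_src, dual_mul_arrow_self] at h2
    exact hgJ h2
  · rintro e he ⟨hb, hbS⟩
    obtain ⟨l, hl, hpath⟩ := hx.exists_rotated he
    have h1 := (hf.2.2 _ (Cycle.coe_eq_coe.2 hl.symm) f).2 dvd_rfl
    obtain ⟨a, ha⟩ := pathEval_eq_add hpath f
    have h2 := J.mul_mem_right _ (breakElem F (vertexSet J) (Γ.src e))
      (J.mul_mem_left (breakElem F (vertexSet J) (Γ.src e)) _ h1)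
    rw [ha, hf.1, one_smul, mul_add, ← mul_assoc, breakElem_mul_arrow hb.2.1 (htgt e he), zero_mul,
      zero_add, breakElem_mul_vertex hb.2.1, breakElem_mul_self hb.2.1] at h2
    exact hbS ⟨hb, h2⟩

/-! ### The strata -/

variable {I : TwoSidedIdeal (L F Γ)} {β : Set (Cycle (quotientGraph I).E)}

theorem exists_noExitIn_baseCycle {C : Cycle (quotientGraph I).E}
    (hC : C ∈ (quotientGraph I).noExitCycles) :
    ∃ x p, Γ.NoExitIn (vertexSet I) (breakingSet I) x p ∧ baseCycle I C = (p : Cycle Γ.E) :=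
  DiGraph.exists_noExitIn_of_mem hC

theorem exists_baseCycle_eq {x : Γ.V} {p : List Γ.E}
    (hp : Γ.NoExitIn (vertexSet I) (breakingSet I) x p) :
    ∃ C ∈ (quotientGraph I).noExitCycles, baseCycle I C = (p : Cycle Γ.E) :=
  hp.exists_mem fun _ => tgt_mem_vertexSet

theorem NoExitIn.start_notMem {x : Γ.V} {p : List Γ.E} {S : Set Γ.V}
    (hp : Γ.NoExitIn (vertexSet J) S x p) : x ∉ vertexSet J := by
  obtain ⟨e, l, rfl⟩ := List.exists_cons_of_ne_nil hp.ne_nil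
  rw [← hp.path.1]
  exact src_notMem_vertexSet (hp.tgt_notMem e (by simp))

/-- That `I` is the largest graded ideal contained in `J` is a condition on vertices and breaking
vertices only. -/
theorem mem_stratum_iff (hI : IsGraded I) {J : TwoSidedIdeal (L F Γ)} : J ∈ stratum I β ↔
    (vertexSet J = vertexSet I ∧ breakingSet J = breakingSet I) ∧
      {C | C ∈ (quotientGraph I).noExitCycles ∧ ∃ f, IsCanonicalPoly J (baseCycle I C) f} = β :=
  and_congr ⟨eq_of_isGreatest, fun h => isGreatest_of_eq hI h.1 h.2⟩ Iff.rfl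

theorem isCanonicalPoly_canonicalPoly (hβ : J ∈ stratum I β) (C : β) :
    IsCanonicalPoly J (baseCycle I C) (canonicalPoly J (baseCycle I C)) := by
  have h : C.1 ∈ {C | C ∈ (quotientGraph I).noExitCycles ∧
      ∃ f, IsCanonicalPoly J (baseCycle I C) f} := by
    rw [hβ.2]; exact C.2
  obtain ⟨-, f, hf⟩ := h
  rwa [canonicalPoly_eq hf]

/-- Ideals of the same stratum with the same canonical polynomials are equal. -/
theorem le_of_canonicalPoly_eq {K : TwoSidedIdeal (L F Γ)} (hJ : J ∈ stratum I β)
    (hK : K ∈ stratum I β)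
    (h : ∀ C : β, canonicalPoly J (baseCycle I C) = canonicalPoly K (baseCycle I C)) : J ≤ K := by
  obtain ⟨hJ1, hJ2⟩ := eq_of_isGreatest hJ.1
  obtain ⟨hK1, hK2⟩ := eq_of_isGreatest hK.1
  refine le_of_generators (hJ1.trans hK1.symm).le ?_ ?_
  · intro x hx
    rw [hJ2, ← hK2] at hx
    rw [hJ1, ← hK1]
    exact hx.2
  · intro x p hp g hg
    by_cases hg0 : g = 0
    · rw [hg0, pathEval_zero]
      exact K.zero_mem
    obtain ⟨f, hf⟩ := exists_isCanonicalPoly hp.ne_nil hp.path (NoExitIn.start_notMem hp) hg0 hg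
    rw [hJ1, hJ2] at hp
    obtain ⟨C, hC, hCp⟩ := exists_baseCycle_eq hp
    have hCβ : C ∈ β := by
      rw [← hJ.2]
      exact ⟨hC, f, hCp ▸ hf⟩
    have h1 := isCanonicalPoly_canonicalPoly hJ ⟨C, hCβ⟩
    have h2 := isCanonicalPoly_canonicalPoly hK ⟨C, hCβ⟩
    rw [← h ⟨C, hCβ⟩] at h2
    exact (h2.2.2 p hCp.symm g).2 ((h1.2.2 p hCp.symm g).1 hg)

theorem eq_of_canonicalPoly_eq {K : TwoSidedIdeal (L F Γ)} (hJ : J ∈ stratum I β)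
    (hK : K ∈ stratum I β)
    (h : ∀ C : β, canonicalPoly J (baseCycle I C) = canonicalPoly K (baseCycle I C)) : J = K :=
  le_antisymm (le_of_canonicalPoly_eq hJ hK h) (le_of_canonicalPoly_eq hK hJ fun C => (h C).symm)

/-- For the ideals of a stratum, the canonical polynomials are those at the cycles in `β`. -/
theorem isDlf_iff (hJ : J ∈ stratum I β) (hβ : β ⊆ (quotientGraph I).noExitCycles) :
    IsDlf J ↔ ∀ C : β, HasDistinctLinearFactors (canonicalPoly J (baseCycle I C)) := by
  constructor
  · intro h C
    obtain ⟨x, p, hp, hCp⟩ := exists_noExitIn_baseCycle (hβ C.2)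
    refine h _ ?_ _ (isCanonicalPoly_canonicalPoly hJ C)
    rw [hCp]
    exact DiGraph.isGeomCycle_coe.2 ⟨hp.ne_nil, ⟨x, hp.path⟩, hp.nodup⟩
  · intro h D hD f hf
    obtain ⟨p, rfl⟩ := Quotient.exists_rep D
    obtain ⟨x, hx⟩ := IsCanonicalPoly.noExitIn hD hf
    obtain ⟨hJ1, hJ2⟩ := eq_of_isGreatest hJ.1
    rw [hJ1, hJ2] at hx
    obtain ⟨C, hC, hCp⟩ := exists_baseCycle_eq hx
    have hf' : IsCanonicalPoly J (baseCycle I C) f := by rw [hCp]; exact hf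
    have hCβ : C ∈ β := by
      rw [← hJ.2]
      exact ⟨hC, f, hf'⟩
    have := h ⟨C, hCβ⟩
    rwa [canonicalPoly_eq hf'] at this

end Canonical

/-! ### Homomorphisms given by coverings of digraphs -/

/-- A covering of `Γ` by `Δ`, from the point of view of Leavitt path algebras: the vertices have
finite fibres, the fibre of an arrow is mapped bijectively to that of its target, and a vertex over
a regular vertex is not a sink. -/
structure IsCover {Γ Δ : DiGraph.{u, v}} (bV : Δ.V → Γ.V) (bE : Δ.E → Γ.E) : Prop where
  src : ∀ f, bV (Δ.src f) = Γ.src (bE f)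
  tgt : ∀ f, bV (Δ.tgt f) = Γ.tgt (bE f)
  finite : ∀ x, {w | bV w = x}.Finite
  exists_lift : ∀ e w, bV w = Γ.tgt e → ∃ f, bE f = e ∧ Δ.tgt f = w
  lift_unique : ∀ f g, bE f = bE g → Δ.tgt f = Δ.tgt g → f = g
  regular : ∀ x, {e | Γ.src e = x}.Finite → {e | Γ.src e = x}.Nonempty → ∀ w, bV w = x →
    ∃ f, Δ.src f = w

namespace IsCover

variable {F : Type w} [Field F] {Γ Δ : DiGraph.{u, v}} {bV : Δ.V → Γ.V} {bE : Δ.E → Γ.E}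
  (h : IsCover bV bE)

theorem finite_arrow (h : IsCover bV bE) (e : Γ.E) : {f | bE f = e}.Finite := by
  refine Set.Finite.of_finite_image ((h.finite (Γ.tgt e)).subset ?_) (f := Δ.tgt) ?_
  · rintro _ ⟨f, rfl, rfl⟩
    exact h.tgt f
  · intro f hf g hg hfg
    exact h.lift_unique f g (hf.trans hg.symm) hfg

variable (F) in
/-- The sum of the vertices over `x`. -/
def vertexSum (x : Γ.V) : L F Δ := ∑ w ∈ (h.finite x).toFinset, gen F (.vertex w)

variable (F) in
/-- The sum of the arrows over `e`. -/
def arrowSum (e : Γ.E) : L F Δ := ∑ f ∈ (h.finite_arrow e).toFinset, gen F (.arrow f)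

variable (F) in
/-- The sum of the dual arrows over `e`. -/
def dualSum (e : Γ.E) : L F Δ := ∑ f ∈ (h.finite_arrow e).toFinset, gen F (.dual f)

open Classical in
theorem vertex_mul_vertexSum (w : Δ.V) (x : Γ.V) :
    gen F (.vertex w) * h.vertexSum F x = if bV w = x then gen F (.vertex w) else 0 := by
  rw [vertexSum, Finset.mul_sum]
  simp only [vertex_mul_vertex, Finset.sum_ite_eq, Set.Finite.mem_toFinset, Set.mem_ofPred_eq]

open Classical in
theorem vertexSum_mul_vertex (w : Δ.V) (x : Γ.V) :
    h.vertexSum F x * gen F (.vertex w) = if bV w = x then gen F (.vertex w) else 0 := by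
  rw [vertexSum, Finset.sum_mul]
  have : ∀ w' ∈ (h.finite x).toFinset, gen F (Gen.vertex w') * gen F (Gen.vertex w) =
      if w = w' then gen F (.vertex w) else 0 := by
    intro w' _
    rw [vertex_mul_vertex]
    by_cases hw : w = w' <;> simp [hw, eq_comm]
  rw [Finset.sum_congr rfl this, Finset.sum_ite_eq]
  simp only [Set.Finite.mem_toFinset, Set.mem_ofPred_eq]

theorem arrowSum_mul_vertex {f : Δ.E} {e : Γ.E} (hf : bE f = e) :
    h.arrowSum F e * gen F (.vertex (Δ.tgt f)) = gen F (.arrow f) := by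
  classical
  rw [arrowSum, Finset.sum_mul, Finset.sum_eq_single f, arrow_mul_tgt]
  · intro g hg hgf
    rw [arrow_mul_vertex, if_neg]
    exact fun h' => hgf (h.lift_unique _ _ (by simpa [hf] using hg) h')
  · intro hn
    exact absurd (by simpa using hf) hn

theorem vertex_mul_dualSum {f : Δ.E} {e : Γ.E} (hf : bE f = e) :
    gen F (.vertex (Δ.tgt f)) * h.dualSum F e = gen F (.dual f) := by
  classical
  rw [dualSum, Finset.mul_sum, Finset.sum_eq_single f, tgt_mul_dual]
  · intro g hg hgf
    rw [vertex_mul_dual, if_neg]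
    exact fun h' => hgf (h.lift_unique _ _ (by simpa [hf] using hg) h'.symm)
  · intro hn
    exact absurd (by simpa using hf) hn

theorem sum_tgt (e : Γ.E) :
    ∑ f ∈ (h.finite_arrow e).toFinset, gen F (.vertex (Δ.tgt f)) = h.vertexSum F (Γ.tgt e) := by
  refine Finset.sum_bij (fun f _ => Δ.tgt f) ?_ ?_ ?_ fun _ _ => rfl
  · intro f hf
    simp only [Set.Finite.mem_toFinset, Set.mem_ofPred_eq] at hf ⊢
    rw [← hf, h.tgt]
  · intro f hf g hg hfg
    simp only [Set.Finite.mem_toFinset, Set.mem_ofPred_eq] at hf hg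
    exact h.lift_unique _ _ (hf.trans hg.symm) hfg
  · intro w hw
    simp only [Set.Finite.mem_toFinset, Set.mem_ofPred_eq] at hw
    obtain ⟨f, hf, rfl⟩ := h.exists_lift e w hw
    exact ⟨f, by simpa using hf, rfl⟩

open Classical in
theorem sum_arrowSum_mul_dualSum (T : Finset Γ.E) :
    ∑ e ∈ T, h.arrowSum F e * h.dualSum F e =
      ∑ f ∈ T.biUnion fun e => (h.finite_arrow e).toFinset, gen F (.arrow f) * gen F (.dual f) := by
  have hmem : ∀ {e f}, f ∈ (h.finite_arrow e).toFinset ↔ bE f = e := by simp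
  rw [Finset.sum_biUnion fun e _ f _ hef =>
    Finset.disjoint_left.2 fun g hg hg' => hef ((hmem.1 hg).symm.trans (hmem.1 hg'))]
  refine Finset.sum_congr rfl fun e _ => ?_
  conv_lhs => rw [arrowSum, Finset.sum_mul]
  refine Finset.sum_congr rfl fun f hf => ?_
  rw [← arrow_mul_tgt, mul_assoc, h.vertex_mul_dualSum (hmem.1 hf), mul_assoc, tgt_mul_dual]

theorem isFamily : IsFamily Γ (fun x => (h.vertexSum F x : UnitalLPA F Δ))
    (fun e => (h.arrowSum F e : UnitalLPA F Δ)) (fun e => (h.dualSum F e : UnitalLPA F Δ)) := by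
  classical
  have hmem : ∀ {e f}, f ∈ (h.finite_arrow e).toFinset ↔ bE f = e := by simp
  refine ⟨fun x => congrArg Subtype.val (?_ : h.vertexSum F x * h.vertexSum F x = h.vertexSum F x),
    fun x y hxy => congrArg Subtype.val (?_ : h.vertexSum F x * h.vertexSum F y = 0),
    fun e => congrArg Subtype.val (?_ : h.vertexSum F (Γ.src e) * h.arrowSum F e = h.arrowSum F e),
    fun e => congrArg Subtype.val (?_ : h.arrowSum F e * h.vertexSum F (Γ.tgt e) = h.arrowSum F e),
    fun e => congrArg Subtype.val (?_ : h.vertexSum F (Γ.tgt e) * h.dualSum F e = h.dualSum F e),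
    fun e => congrArg Subtype.val (?_ : h.dualSum F e * h.vertexSum F (Γ.src e) = h.dualSum F e),
    fun e => congrArg Subtype.val (?_ : h.dualSum F e * h.arrowSum F e = h.vertexSum F (Γ.tgt e)),
    fun e f hef _ => congrArg Subtype.val (?_ : h.dualSum F e * h.arrowSum F f = 0),
    fun x T hT hne => ?_⟩
  · conv_lhs => rw [vertexSum, Finset.sum_mul]
    refine Finset.sum_congr rfl fun w hw => ?_
    change gen F (.vertex w) * h.vertexSum F x = _
    rw [vertex_mul_vertexSum, if_pos (by simpa using hw)]
  · rw [vertexSum, Finset.sum_mul]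
    refine Finset.sum_eq_zero fun w hw => ?_
    rw [vertex_mul_vertexSum, if_neg]
    rintro rfl
    exact hxy (by simpa using hw : _ = _).symm
  · rw [arrowSum, Finset.mul_sum]
    refine Finset.sum_congr rfl fun f hf => ?_
    rw [← src_mul_arrow, ← mul_assoc, vertexSum_mul_vertex, if_pos]
    rw [h.src, hmem.1 hf]
  · rw [arrowSum, Finset.sum_mul]
    refine Finset.sum_congr rfl fun f hf => ?_
    rw [← arrow_mul_tgt, mul_assoc, vertex_mul_vertexSum, if_pos]
    rw [h.tgt, hmem.1 hf]
  · rw [dualSum, Finset.mul_sum]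
    refine Finset.sum_congr rfl fun f hf => ?_
    rw [← tgt_mul_dual, ← mul_assoc, vertexSum_mul_vertex, if_pos]
    rw [h.tgt, hmem.1 hf]
  · rw [dualSum, Finset.sum_mul]
    refine Finset.sum_congr rfl fun f hf => ?_
    rw [← dual_mul_src, mul_assoc, vertex_mul_vertexSum, if_pos]
    rw [h.src, hmem.1 hf]
  · rw [← h.sum_tgt, dualSum, arrowSum, Finset.sum_mul]
    refine Finset.sum_congr rfl fun f hf => ?_
    rw [Finset.mul_sum]
    simp only [dual_mul_arrow, Finset.sum_ite_eq, if_pos hf]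
  · rw [dualSum, arrowSum, Finset.sum_mul]
    refine Finset.sum_eq_zero fun f hf => ?_
    rw [Finset.mul_sum]
    refine Finset.sum_eq_zero fun g hg => ?_
    refine dual_mul_arrow_of_ne ?_
    rintro rfl
    exact hef ((hmem.1 hf).symm.trans (hmem.1 hg))
  · have key : h.vertexSum F x = ∑ e ∈ T, h.arrowSum F e * h.dualSum F e := by
      rw [h.sum_arrowSum_mul_dualSum, vertexSum]
      -- the arrows over the arrows from `x` are those from the vertices over `x`
      have hfin : {e | Γ.src e = x}.Finite := T.finite_toSet.subset fun e he => (hT e).2 he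
      have h2 : ∀ w ∈ (h.finite x).toFinset, gen F (.vertex w) =
          ∑ f ∈ T.biUnion (fun e => (h.finite_arrow e).toFinset) with Δ.src f = w,
            gen F (.arrow f) * gen F (.dual f) := by
        intro w hw
        have hw' : bV w = x := by simpa using hw
        obtain ⟨f₀, hf₀⟩ := h.regular x hfin (hne.imp fun e he => (hT e).1 he) w hw'
        have hmm : ∀ f, f ∈ (T.biUnion (fun e => (h.finite_arrow e).toFinset)).filter
            (fun f => Δ.src f = w) ↔ Δ.src f = w := by
          intro f
          simp only [Finset.mem_filter, Finset.mem_biUnion, hmem]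
          refine ⟨And.right, fun hf => ⟨⟨bE f, (hT _).2 ?_, rfl⟩, hf⟩⟩
          rw [← h.src, hf, hw']
        exact vertex_eq_sum w _ hmm ⟨f₀, (hmm f₀).2 hf₀⟩
      rw [Finset.sum_congr rfl h2]
      refine (Finset.sum_fiberwise_of_maps_to (g := Δ.src) ?_ _)
      intro f hf
      simp only [Finset.mem_biUnion, hmem] at hf
      obtain ⟨e, he, rfl⟩ := hf
      simpa [h.src] using (hT _).1 he
    rw [key]
    simp

variable (F) in
/-- The homomorphism that maps every generator to the sum of the generators over it. -/
def hom : UnitalLPA F Γ →ₐ[F] UnitalLPA F Δ := (h.isFamily (F := F)).lift F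

theorem hom_vertex (x : Γ.V) :
    h.hom F (gen F (.vertex x) : L F Γ) = (h.vertexSum F x : UnitalLPA F Δ) :=
  h.isFamily.lift_gen _

theorem hom_arrow (e : Γ.E) :
    h.hom F (gen F (.arrow e) : L F Γ) = (h.arrowSum F e : UnitalLPA F Δ) :=
  h.isFamily.lift_gen _

theorem hom_dual (e : Γ.E) :
    h.hom F (gen F (.dual e) : L F Γ) = (h.dualSum F e : UnitalLPA F Δ) :=
  h.isFamily.lift_gen _

theorem vertexSum_eq {x : Γ.V} {w : Δ.V} (hw : ∀ w', bV w' = x ↔ w' = w) :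
    h.vertexSum F x = gen F (.vertex w) := by
  rw [vertexSum, show (h.finite x).toFinset = {w} by ext w'; simp [hw], Finset.sum_singleton]

theorem arrowSum_eq {e : Γ.E} {f : Δ.E} (hf : ∀ f', bE f' = e ↔ f' = f) :
    h.arrowSum F e = gen F (.arrow f) := by
  rw [arrowSum, show (h.finite_arrow e).toFinset = {f} by ext w'; simp [hf],
    Finset.sum_singleton]

/-- A path over which the covering is injective is mapped to its lift. -/
theorem hom_pathElem {q : List Δ.E} (hq : ∀ f ∈ q, ∀ f', bE f' = bE f → f' = f) :
    h.hom F (pathElem F (q.map bE) : L F Γ) = (pathElem F q : UnitalLPA F Δ) := by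
  induction q with
  | nil => exact map_zero _
  | cons f q ih =>
    have h1 : h.hom F (gen F (.arrow (bE f)) : L F Γ) = (gen F (.arrow f) : UnitalLPA F Δ) := by
      rw [h.hom_arrow, h.arrowSum_eq fun f' => ⟨hq f (by simp) f', fun h => h ▸ rfl⟩]
    cases q with
    | nil => exact h1
    | cons g q =>
      have h2 := ih fun f' hf' => hq f' (by simp [hf'])
      change h.hom F ((gen F (.arrow (bE f)) : L F Γ) * (pathElem F ((g :: q).map bE) : L F Γ)) =
        (gen F (.arrow f) : UnitalLPA F Δ) * (pathElem F (g :: q) : UnitalLPA F Δ)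
      rw [map_mul, h1, h2]

theorem hom_pathEval {x : Δ.V} {q : List Δ.E} (hq0 : q ≠ []) (hx : Δ.IsPath x q x)
    (hq : ∀ f ∈ q, ∀ f', bE f' = bE f → f' = f)
    (hv : ∀ w, bV w = bV x → w = x)
    (hp : Γ.IsPath (bV x) (q.map bE) (bV x)) (g : F[X]) :
    h.hom F (pathEval (q.map bE) g : L F Γ) = (pathEval q g : UnitalLPA F Δ) := by
  rw [coe_pathEval (by simpa using hq0) hp, coe_pathEval hq0 hx, map_mul,
    ← Polynomial.aeval_algHom_apply,
    h.hom_pathElem hq, ← coe_gen, h.hom_vertex, h.vertexSum_eq fun w => ⟨hv w, fun h => h ▸ rfl⟩,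
    coe_gen]

end IsCover

/-! ### The quotient digraph as a covering -/

namespace DiGraph

variable {Γ : DiGraph.{u, v}} {H S : Set Γ.V}

/-- The vertex of `Γ` from which a vertex of `Γ / (H, S)` comes. -/
def baseVertex (Γ : DiGraph.{u, v}) (H S : Set Γ.V) : (Γ.quotient H S).V → Γ.V :=
  Sum.elim Subtype.val Subtype.val

theorem baseVertex_keepV {x : Γ.V} (hx) : Γ.baseVertex H S (keepV H S x hx) = x := rfl

theorem isCover_quotient (hH : ∀ e, Γ.src e ∈ H → Γ.tgt e ∈ H)
    (hsat : ∀ x, {e | Γ.src e = x}.Finite → {e | Γ.src e = x}.Nonempty →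
      (∀ e, Γ.src e = x → Γ.tgt e ∈ H) → x ∈ H) :
    IsCover (Γ.baseVertex H S) (Γ.baseArrow H S) := by
  refine ⟨?_, ?_, ?_, ?_, ?_, ?_⟩
  · intro f
    rcases quotient_cases f with ⟨f, hf, rfl⟩ | ⟨f, hf, rfl⟩ <;> rfl
  · intro f
    rcases quotient_cases f with ⟨f, hf, rfl⟩ | ⟨f, hf, rfl⟩ <;> rfl
  · intro x
    refine Set.Finite.subset (s := {w | ∃ hx, w = keepV H S x hx} ∪ {w | ∃ hx, w = sinkV H S x hx})
      (Set.Finite.union ?_ ?_) ?_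
    · refine Set.Subsingleton.finite ?_
      rintro _ ⟨hx, rfl⟩ _ ⟨hx', rfl⟩
      rfl
    · refine Set.Subsingleton.finite ?_
      rintro _ ⟨hx, rfl⟩ _ ⟨hx', rfl⟩
      rfl
    · intro w hw
      rcases quotient_cases_vertex w with ⟨y, hy, rfl⟩ | ⟨y, hy, rfl⟩
      · obtain rfl : y = x := hw
        exact Or.inl ⟨hy, rfl⟩
      · obtain rfl : y = x := hw
        exact Or.inr ⟨hy, rfl⟩
  · intro e w hw
    rcases quotient_cases_vertex w with ⟨y, hy, rfl⟩ | ⟨y, hy, rfl⟩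
    · obtain rfl : y = Γ.tgt e := hw
      exact ⟨keepE H S e ⟨fun h => hy (hH e h), hy⟩, rfl, rfl⟩
    · obtain rfl : y = Γ.tgt e := hw
      refine ⟨sinkE H S e ⟨fun h => ?_, hy⟩, rfl, rfl⟩
      obtain ⟨g, hg1, hg2⟩ := hy.1.2.2
      exact hg2 (hH g (hg1 ▸ hH e h))
  · intro f g hfg htgt
    rcases quotient_cases f with ⟨f, hf, rfl⟩ | ⟨f, hf, rfl⟩ <;>
    rcases quotient_cases g with ⟨g, hg, rfl⟩ | ⟨g, hg, rfl⟩
    · exact keepE_inj.2 hfg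
    · exact absurd htgt keepV_ne_sinkV
    · exact absurd htgt.symm keepV_ne_sinkV
    · exact sinkE_inj.2 hfg
  · intro x hfin hne w hw
    rcases quotient_cases_vertex w with ⟨y, hy, rfl⟩ | ⟨y, hy, rfl⟩
    · obtain rfl : y = x := hw
      by_contra hcon
      refine hy (hsat y hfin hne fun e he => ?_)
      by_contra heH
      subst he
      exact hcon ⟨keepE H S e ⟨hy, heH⟩, rfl⟩
    · obtain rfl : y = x := hw
      exact absurd hfin hy.1.1

/-! ### Disjoint copies of cycles -/

/-- The digraph that has `n x` copies of the vertex `x` and, for each arrow `e`, one arrow to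
each copy of its target. It starts at the copy of the source with the same number if there is one,
and at the copy with number `0` otherwise. -/
def copies (Γ : DiGraph.{u, v}) (n : Γ.V → ℕ) (hn : ∀ x, 0 < n x) : DiGraph.{u, v} where
  V := {a : Γ.V × ℕ // a.2 < n a.1}
  E := {a : Γ.E × ℕ // a.2 < n (Γ.tgt a.1)}
  src a := if h : a.1.2 < n (Γ.src a.1.1) then ⟨(Γ.src a.1.1, a.1.2), h⟩
    else ⟨(Γ.src a.1.1, 0), hn _⟩
  tgt a := ⟨(Γ.tgt a.1.1, a.1.2), a.2⟩

variable {n : Γ.V → ℕ} {hn : ∀ x, 0 < n x}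

/-- The copy of `x` with number `i`. -/
def copyV (hn : ∀ x, 0 < n x) (x : Γ.V) (i : ℕ) (hi : i < n x) : (Γ.copies n hn).V := ⟨(x, i), hi⟩

/-- The copy of `e` with number `i`. -/
def copyE (hn : ∀ x, 0 < n x) (e : Γ.E) (i : ℕ) (hi : i < n (Γ.tgt e)) : (Γ.copies n hn).E :=
  ⟨(e, i), hi⟩

/-- The projection on vertices. -/
def copiesV (hn : ∀ x, 0 < n x) (w : (Γ.copies n hn).V) : Γ.V := w.1.1

/-- The projection on arrows. -/
def copiesE (hn : ∀ x, 0 < n x) (f : (Γ.copies n hn).E) : Γ.E := f.1.1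

theorem exists_copyV (w : (Γ.copies n hn).V) : ∃ x i hi, w = copyV hn x i hi :=
  ⟨_, _, w.2, rfl⟩

theorem exists_copyE (f : (Γ.copies n hn).E) : ∃ e i hi, f = copyE hn e i hi :=
  ⟨_, _, f.2, rfl⟩

theorem copyV_inj {x y : Γ.V} {i j : ℕ} {hi : i < n x} {hj : j < n y} :
    copyV hn x i hi = copyV hn y j hj ↔ x = y ∧ i = j :=
  Subtype.ext_iff.trans Prod.mk_inj

theorem copyE_inj {e f : Γ.E} {i j : ℕ} {hi : i < n (Γ.tgt e)} {hj : j < n (Γ.tgt f)} :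
    copyE hn e i hi = copyE hn f j hj ↔ e = f ∧ i = j :=
  Subtype.ext_iff.trans Prod.mk_inj

theorem copiesV_copyV {x : Γ.V} {i : ℕ} (hi : i < n x) : copiesV hn (copyV hn x i hi) = x := rfl

theorem copiesE_copyE {e : Γ.E} {i : ℕ} (hi : i < n (Γ.tgt e)) :
    copiesE hn (copyE hn e i hi) = e := rfl

theorem src_copyE {e : Γ.E} {i : ℕ} (hi : i < n (Γ.tgt e)) (h : i < n (Γ.src e)) :
    (Γ.copies n hn).src (copyE hn e i hi) = copyV hn (Γ.src e) i h := dif_pos h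

theorem copiesV_src (f : (Γ.copies n hn).E) :
    copiesV hn ((Γ.copies n hn).src f) = Γ.src (copiesE hn f) := by
  by_cases h : f.1.2 < n (Γ.src f.1.1)
  · exact congrArg (copiesV hn) (dif_pos h)
  · exact congrArg (copiesV hn) (dif_neg h)

theorem isCover_copies (hsrc : ∀ e, n (Γ.src e) = 1 ∨ n (Γ.src e) = n (Γ.tgt e)) :
    IsCover (copiesV hn) (copiesE hn) := by
  refine ⟨copiesV_src, fun _ => rfl, ?_, ?_, ?_, ?_⟩
  · intro x
    refine (Set.finite_range fun i : Fin (n x) => copyV hn x i i.2).subset ?_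
    rintro w rfl
    exact ⟨⟨_, w.2⟩, rfl⟩
  · intro e w hw
    obtain ⟨x, i, hi, rfl⟩ := exists_copyV w
    obtain rfl : x = Γ.tgt e := hw
    exact ⟨copyE hn e i hi, rfl, rfl⟩
  · intro f g hfg htgt
    obtain ⟨e, i, hi, rfl⟩ := exists_copyE f
    obtain ⟨e', j, hj, rfl⟩ := exists_copyE g
    exact copyE_inj.2 ⟨hfg, (copyV_inj.1 htgt).2⟩
  · rintro x - ⟨e, rfl⟩ w hw
    obtain ⟨x, i, hi, rfl⟩ := exists_copyV w
    obtain rfl : x = Γ.src e := hw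
    rcases hsrc e with h1 | h1
    · obtain rfl : i = 0 := by omega
      exact ⟨copyE hn e 0 (hn _), src_copyE _ _⟩
    · exact ⟨copyE hn e i (h1 ▸ hi), src_copyE _ _⟩

end DiGraph

/-! ### A faithful enough representation -/

namespace DiGraph

/-- `φ e : X → X` are injective maps such that those of the arrows from a common source have
disjoint images, which cover `X` if that source is regular; the map of an arrow that is the only
one from its source is the identity. -/
structure IsBranching (Γ : DiGraph.{u, v}) {X : Type*} (φ : Γ.E → X → X) : Prop where
  inj : ∀ {e f x y}, Γ.src e = Γ.src f → φ e x = φ f y → e = f ∧ x = y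
  surj : ∀ {v}, {e | Γ.src e = v}.Finite → {e | Γ.src e = v}.Nonempty → ∀ y, ∃ e x,
    Γ.src e = v ∧ φ e x = y
  eq_self : ∀ {e}, (∀ f, Γ.src f = Γ.src e → f = e) → ∀ x, φ e x = x

/-- In an infinite set `X` with at least as many elements as there are arrows, `X × {arrows from v}`
and `X` have the same cardinality. -/
theorem exists_isBranching (Γ : DiGraph.{u, v}) :
    ∃ (X : Type v) (_ : Nonempty X) (φ : Γ.E → X → X), Γ.IsBranching φ := by
  classical
  let X := Γ.E ⊕ ULift.{v} ℕ
  have hX : Cardinal.aleph0 ≤ Cardinal.mk X := Cardinal.aleph0_le_mk X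
  have key : ∀ v, ∃ c : {e // Γ.src e = v} → X → X,
      (∀ e f x y, c e x = c f y → e = f ∧ x = y) ∧
      (Nonempty {e // Γ.src e = v} → ∀ y, ∃ e x, c e x = y) ∧
      ∀ e, (∀ f, f = e) → ∀ x, c e x = x := by
    intro v
    by_cases hs : Subsingleton {e // Γ.src e = v}
    · exact ⟨fun _ x => x, fun e f x y h => ⟨Subsingleton.elim _ _, h⟩,
        fun ⟨e⟩ y => ⟨e, y, rfl⟩, fun _ _ _ => rfl⟩
    · rw [not_subsingleton_iff_nontrivial] at hs
      have h1 : Cardinal.mk {e // Γ.src e = v} ≤ Cardinal.mk X :=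
        Cardinal.mk_le_of_injective (f := fun e => Sum.inl e.1)
          fun e f h => Subtype.ext (Sum.inl_injective h)
      have h2 : Cardinal.mk ({e // Γ.src e = v} × X) = Cardinal.mk X := by
        rw [← Cardinal.mul_def, Cardinal.mul_eq_right hX h1 (Cardinal.mk_ne_zero _)]
      obtain ⟨t⟩ := Cardinal.eq.1 h2
      refine ⟨fun e x => t (e, x), fun e f x y h => Prod.mk_inj.1 (t.injective h),
        fun _ y => ⟨(t.symm y).1, (t.symm y).2, t.apply_symm_apply y⟩, fun e he => ?_⟩
      obtain ⟨f, hf⟩ := exists_ne e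
      exact absurd (he f) hf
  choose c hc using key
  refine ⟨X, inferInstance, fun e => c (Γ.src e) ⟨e, rfl⟩, ?_, ?_, ?_⟩
  · intro e f x y h hxy
    have h1 : c (Γ.src f) ⟨e, h⟩ x = c (Γ.src f) ⟨f, rfl⟩ y := by
      rw [← hxy]
      generalize Γ.src f = v at h
      subst h
      rfl
    obtain ⟨h2, h3⟩ := (hc _).1 _ _ _ _ h1
    exact ⟨congrArg Subtype.val h2, h3⟩
  · intro v _ hne y
    obtain ⟨⟨e, rfl⟩, x, hx⟩ := (hc v).2.1 (hne.elim fun e he => ⟨⟨e, he⟩⟩) y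
    exact ⟨e, x, rfl, hx⟩
  · intro e he x
    exact (hc _).2.2 _ (fun f => Subtype.ext (he f.1 f.2)) x

end DiGraph

section Rep

variable {F : Type w} [Field F] {Γ : DiGraph.{u, v}} {B : Type*} [CommRing B] [Algebra F B]
  {X : Type*} {φ : Γ.E → X → X} (hφ : Γ.IsBranching φ) (c : Γ.E → Bˣ)

open Classical in
variable (B X) in
/-- The projection that represents a vertex. -/
def repVertex (v : Γ.V) : Module.End B ((Γ.V × X) →₀ B) :=
  Finsupp.linearCombination B fun a => if a.1 = v then Finsupp.single a 1 else 0

open Classical in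
variable (φ) in
/-- The operator that represents an arrow `e`; it has the weight `c e`. -/
def repArrow (e : Γ.E) : Module.End B ((Γ.V × X) →₀ B) :=
  Finsupp.linearCombination B fun a =>
    if a.1 = Γ.tgt e then Finsupp.single (Γ.src e, φ e a.2) (c e : B) else 0

open Classical in
variable (φ) in
/-- The operator that represents a dual arrow `e*`. -/
def repDual (e : Γ.E) : Module.End B ((Γ.V × X) →₀ B) :=
  Finsupp.linearCombination B fun a =>
    if h : ∃ x, a = (Γ.src e, φ e x) then Finsupp.single (Γ.tgt e, h.choose) (↑(c e)⁻¹ : B) else 0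

open Classical in
theorem repVertex_single (v : Γ.V) (a : Γ.V × X) (b : B) :
    repVertex B X v (Finsupp.single a b) = if a.1 = v then Finsupp.single a b else 0 := by
  rw [repVertex, Finsupp.linearCombination_single]
  split_ifs <;> simp

open Classical in
theorem repArrow_single (e : Γ.E) (a : Γ.V × X) (b : B) :
    repArrow φ c e (Finsupp.single a b) =
      if a.1 = Γ.tgt e then Finsupp.single (Γ.src e, φ e a.2) (b * c e) else 0 := by
  rw [repArrow, Finsupp.linearCombination_single]
  split_ifs <;> simp

include hφ in
theorem repDual_single (e : Γ.E) (x : X) (b : B) :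
    repDual φ c e (Finsupp.single (Γ.src e, φ e x) b) =
      Finsupp.single (Γ.tgt e, x) (b * ↑(c e)⁻¹) := by
  have h : ∃ x', (Γ.src e, φ e x) = (Γ.src e, φ e x') := ⟨x, rfl⟩
  have h2 : h.choose = x := ((hφ.inj rfl (congrArg Prod.snd h.choose_spec)).2).symm
  rw [repDual, Finsupp.linearCombination_single, dif_pos h, h2]
  simp

theorem repDual_single_of_forall (e : Γ.E) {a : Γ.V × X} (ha : ∀ x, a ≠ (Γ.src e, φ e x)) (b : B) :
    repDual φ c e (Finsupp.single a b) = 0 := by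
  rw [repDual, Finsupp.linearCombination_single, dif_neg (by simpa using ha), smul_zero]

include hφ in
theorem isFamily_rep : IsFamily Γ (repVertex B X) (repArrow φ c) (repDual φ c) := by
  classical
  have hdual : ∀ e (a : Γ.V × X) (b : B), (∃ x, a = (Γ.src e, φ e x) ∧
      repDual φ c e (Finsupp.single a b) = Finsupp.single (Γ.tgt e, x) (b * ↑(c e)⁻¹)) ∨
      ((∀ x, a ≠ (Γ.src e, φ e x)) ∧ repDual φ c e (Finsupp.single a b) = 0) := by
    intro e a b
    by_cases h : ∃ x, a = (Γ.src e, φ e x)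
    · obtain ⟨x, rfl⟩ := h
      exact Or.inl ⟨x, rfl, repDual_single hφ c e x b⟩
    · exact Or.inr ⟨by simpa using h, repDual_single_of_forall c e (by simpa using h) b⟩
  refine ⟨fun v => ?_, fun v v' h => ?_, fun e => ?_, fun e => ?_, fun e => ?_, fun e => ?_,
    fun e => ?_, fun e f hef hs => ?_, fun v T hT hne => ?_⟩ <;>
    refine Finsupp.lhom_ext fun a b => ?_
  · rw [Module.End.mul_apply, repVertex_single]
    split_ifs with h
    · rw [repVertex_single, if_pos h]
    · exact map_zero _
  · rw [Module.End.mul_apply, repVertex_single]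
    split_ifs with h'
    · rw [repVertex_single, if_neg fun h'' => h (h''.symm.trans h')]
      rfl
    · exact map_zero _
  · rw [Module.End.mul_apply, repArrow_single]
    split_ifs with h
    · rw [repVertex_single, if_pos rfl]
    · exact map_zero _
  · rw [Module.End.mul_apply, repVertex_single]
    split_ifs with h
    · rfl
    · rw [map_zero, repArrow_single, if_neg h]
  · rw [Module.End.mul_apply]
    rcases hdual e a b with ⟨x, rfl, h⟩ | ⟨-, h⟩
    · rw [h, repVertex_single, if_pos rfl]
    · rw [h, map_zero]
  · rw [Module.End.mul_apply, repVertex_single]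
    split_ifs with h
    · rfl
    · rw [map_zero, repDual_single_of_forall]
      rintro x rfl
      exact h rfl
  · rw [Module.End.mul_apply, repArrow_single, repVertex_single]
    split_ifs with h
    · rw [repDual_single hφ, mul_assoc, Units.mul_inv, mul_one, ← h]
    · exact map_zero _
  · rw [Module.End.mul_apply, repArrow_single]
    split_ifs with h
    · rw [repDual_single_of_forall]
      · rfl
      · intro x hx
        exact hef (hφ.inj hs.symm (congrArg Prod.snd hx)).1.symm
    · exact map_zero _
  · rw [repVertex_single, LinearMap.sum_apply]
    have hfin : {e | Γ.src e = v}.Finite := T.finite_toSet.subset fun e he => (hT e).2 he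
    split_ifs with h
    · obtain ⟨e, x, he, hx⟩ := hφ.surj hfin (hne.imp fun e he => (hT e).1 he) a.2
      have ha : a = (Γ.src e, φ e x) := Prod.ext (h.trans he.symm) hx.symm
      rw [ha, Finset.sum_eq_single e]
      · rw [Module.End.mul_apply, repDual_single hφ, repArrow_single, if_pos rfl, mul_assoc,
          Units.inv_mul, mul_one]
      · intro f hf hfe
        rw [Module.End.mul_apply, repDual_single_of_forall, map_zero]
        intro x' hx'
        exact hfe (hφ.inj (congrArg Prod.fst hx').symm (congrArg Prod.snd hx').symm).1
      · exact fun hn => absurd ((hT e).2 he) hn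
    · refine (Finset.sum_eq_zero fun e he => ?_).symm
      rw [Module.End.mul_apply, repDual_single_of_forall, map_zero]
      rintro x rfl
      exact h ((hT e).1 he)

variable (F) in
/-- The representation on the free `B`-module with basis `V × X`. -/
def rep : UnitalLPA F Γ →ₐ[F] Module.End B ((Γ.V × X) →₀ B) := (isFamily_rep hφ c).lift F

theorem rep_vertex (v : Γ.V) : rep F hφ c (unitalGen F Γ (.vertex v)) = repVertex B X v :=
  (isFamily_rep hφ c).lift_gen _

theorem rep_arrow (e : Γ.E) : rep F hφ c (unitalGen F Γ (.arrow e)) = repArrow φ c e :=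
  (isFamily_rep hφ c).lift_gen _

theorem rep_vertex_ne_zero [Nontrivial B] [Nonempty X] (v : Γ.V) :
    rep F hφ c (unitalGen F Γ (.vertex v)) ≠ 0 := by
  classical
  intro h
  rw [rep_vertex] at h
  obtain ⟨x⟩ := ‹Nonempty X›
  have := congrArg (fun T => T (Finsupp.single (v, x) 1) (v, x)) h
  simp [repVertex_single] at this

/-- A path from `x` to `y` along which no vertex emits other arrows multiplies the basis vectors at
its end by the product of the weights. -/
theorem rep_pathElem {x y : Γ.V} {p : List Γ.E} (hp0 : p ≠ []) (hp : Γ.IsPath x p y)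
    (hu : ∀ e ∈ p, ∀ f, Γ.src f = Γ.src e → f = e) (z : X) (b : B) :
    rep F hφ c (pathElem F p : UnitalLPA F Γ) (Finsupp.single (y, z) b) =
      Finsupp.single (x, z) (b * ((p.map c).prod : Bˣ)) := by
  classical
  have harrow : ∀ e ∈ p, ∀ b : B, rep F hφ c (unitalGen F Γ (.arrow e))
      (Finsupp.single (Γ.tgt e, z) b) = Finsupp.single (Γ.src e, z) (b * c e) := by
    intro e he b
    rw [rep_arrow, repArrow_single, if_pos rfl, hφ.eq_self (hu e he)]
  induction p generalizing x with
  | nil => exact absurd rfl hp0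
  | cons e p ih =>
    have h1 := harrow e (by simp)
    cases p with
    | nil =>
      obtain ⟨rfl, rfl⟩ := hp
      refine (h1 b).trans ?_
      rw [List.map_singleton, List.prod_singleton]
    | cons f p =>
      have h2 := ih (by simp) hp.2 (fun e he => hu e (by simp [he]))
        fun e he => harrow e (by simp [he])
      change rep F hφ c (unitalGen F Γ (.arrow e) * (pathElem F (f :: p) : UnitalLPA F Γ)) _ = _
      rw [map_mul, Module.End.mul_apply, h2, h1, ← hp.1, List.map_cons (a := e), List.prod_cons,
        Units.val_mul, mul_assoc, mul_comm (c e : B)]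

theorem aeval_apply_of_eigenvector {σ : Type*} {T : Module.End B (σ →₀ B)} {ω : B} {m : σ →₀ B}
    (h : T m = ω • m) (g : F[X]) :
    aeval T g m = aeval ω g • m := by
  have hpow : ∀ n : ℕ, (T ^ n) m = ω ^ n • m := by
    intro n
    induction n with
    | zero => simp
    | succ n ih => rw [pow_succ', Module.End.mul_apply, ih, map_smul, h, smul_smul, pow_succ]
  rw [aeval_eq_sum_range, aeval_eq_sum_range, LinearMap.sum_apply, Finset.sum_smul]
  refine Finset.sum_congr rfl fun n _ => ?_
  rw [LinearMap.smul_apply, hpow, smul_assoc]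

/-- On a cycle with no exit, the representation evaluates polynomials at the product of the
weights. -/
theorem rep_pathEval_eq_zero_iff [Nonempty X] {x : Γ.V} {p : List Γ.E} (hp0 : p ≠ [])
    (hp : Γ.IsPath x p x) (hu : ∀ e ∈ p, ∀ f, Γ.src f = Γ.src e → f = e) (g : F[X]) :
    rep F hφ c (pathEval p g : UnitalLPA F Γ) = 0 ↔ aeval ((p.map c).prod : B) g = 0 := by
  classical
  have heig : ∀ (z : X) (b : B), rep F hφ c (pathEval p g : UnitalLPA F Γ)
      (Finsupp.single (x, z) b) =
      aeval (((p.map c).prod : Bˣ) : B) g • (Finsupp.single (x, z) b : (Γ.V × X) →₀ B) := by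
    intro z b
    rw [coe_pathEval hp0 hp, map_mul, Module.End.mul_apply, rep_vertex, repVertex_single,
      if_pos rfl, ← Polynomial.aeval_algHom_apply]
    refine aeval_apply_of_eigenvector ?_ g
    rw [rep_pathElem hφ c hp0 hp hu, Finsupp.smul_single, smul_eq_mul, mul_comm]
  constructor
  · intro h
    obtain ⟨z⟩ := ‹Nonempty X›
    have h1 := heig z 1
    rw [h, LinearMap.zero_apply, Finsupp.smul_single, smul_eq_mul, mul_one, eq_comm,
      Finsupp.single_eq_zero] at h1
    exact h1
  · intro h
    refine Finsupp.lhom_ext fun a b => ?_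
    by_cases ha : a.1 = x
    · obtain ⟨a1, a2⟩ := a
      obtain rfl : a1 = x := ha
      rw [heig, h, zero_smul]
      rfl
    · rw [coe_pathEval hp0 hp, map_mul, Module.End.mul_apply, rep_vertex, repVertex_single,
        if_neg ha, map_zero]
      rfl

end Rep

/-- The vertices of a Leavitt path algebra are not zero. -/
theorem gen_vertex_ne_zero {F : Type w} [Field F] {Γ : DiGraph.{u, v}} (v : Γ.V) :
    gen F (.vertex v) ≠ 0 := by
  obtain ⟨X, _, φ, hφ⟩ := Γ.exists_isBranching
  intro h
  have h1 : unitalGen F Γ (.vertex v) = 0 := congrArg Subtype.val h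
  refine rep_vertex_ne_zero (F := F) hφ (fun _ => (1 : Fˣ)) v ?_
  rw [h1, map_zero]

/-! ### Ideals of a stratum from homomorphisms -/

namespace DiGraph

variable {Γ : DiGraph.{u, v}}

theorem noExitCycles_unique {q : List Γ.E} (hq : (q : Cycle Γ.E) ∈ Γ.noExitCycles) {f : Γ.E}
    (hf : f ∈ q) (g : Γ.E) (hgf : Γ.src g = Γ.src f) : g = f := by
  by_contra hne
  refine hq.2 g
    ⟨fun hg => hne (List.inj_on_of_nodup_map (isGeomCycle_coe.1 hq.1).2.2 hg hf hgf), ?_⟩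
  rw [hgf]
  exact Cycle.mem_map.2 ⟨f, hf, rfl⟩

theorem exists_cons_of_mem_noExitCycles {C : Cycle Γ.E} (hC : C ∈ Γ.noExitCycles) :
    ∃ e l, C = ((e :: l : List Γ.E) : Cycle Γ.E) ∧ Γ.IsPath (Γ.src e) (e :: l) (Γ.src e) := by
  obtain ⟨q, rfl⟩ := Quotient.exists_rep C
  obtain ⟨hq0, ⟨x, hx⟩, -⟩ := isGeomCycle_coe.1 hC.1
  obtain ⟨e, l, rfl⟩ := List.exists_cons_of_ne_nil hq0
  refine ⟨e, l, rfl, ?_⟩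
  rw [hx.1]
  exact hx

/-- The first arrow of a chosen closed path in the class of `C`. -/
def headArrow {C : Cycle Γ.E} (hC : C ∈ Γ.noExitCycles) : Γ.E :=
  (exists_cons_of_mem_noExitCycles hC).choose

/-- The rest of the chosen closed path. -/
def tailPath {C : Cycle Γ.E} (hC : C ∈ Γ.noExitCycles) : List Γ.E :=
  (exists_cons_of_mem_noExitCycles hC).choose_spec.choose

section

variable {C : Cycle Γ.E} (hC : C ∈ Γ.noExitCycles)

theorem eq_head_cons_tail :
    C = ((headArrow hC :: tailPath hC : List Γ.E) : Cycle Γ.E) :=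
  (exists_cons_of_mem_noExitCycles hC).choose_spec.choose_spec.1

theorem isPath_head_cons_tail :
    Γ.IsPath (Γ.src (headArrow hC)) (headArrow hC :: tailPath hC) (Γ.src (headArrow hC)) :=
  (exists_cons_of_mem_noExitCycles hC).choose_spec.choose_spec.2

theorem mem_cycle_iff (f : Γ.E) : f ∈ C ↔ f ∈ headArrow hC :: tailPath hC := by
  conv_lhs => rw [eq_head_cons_tail hC]
  exact Cycle.mem_coe_iff

theorem headArrow_mem : headArrow hC ∈ C := (mem_cycle_iff hC _).2 (by simp)

theorem unique_of_mem (hC : C ∈ Γ.noExitCycles) {f : Γ.E} (hf : f ∈ C) (g : Γ.E)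
    (hgf : Γ.src g = Γ.src f) : g = f :=
  noExitCycles_unique (eq_head_cons_tail hC ▸ hC) ((mem_cycle_iff hC f).1 hf) g hgf

theorem headArrow_notMem_tailPath : headArrow hC ∉ tailPath hC := by
  have h := (eq_head_cons_tail hC ▸ hC : ((headArrow hC :: tailPath hC : List Γ.E) : Cycle Γ.E) ∈
    Γ.noExitCycles)
  have h2 := (isGeomCycle_coe.1 h.1).2.2
  rw [List.map_cons, List.nodup_cons] at h2
  exact fun h3 => h2.1 (List.mem_map_of_mem h3)

/-- The chosen first arrow of a cycle lies on no other cycle with no exit. -/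
theorem eq_of_headArrow_mem {D : Cycle Γ.E} (hD : D ∈ Γ.noExitCycles) (h : headArrow hC ∈ D) :
    C = D := noExitCycles_disjoint hC hD (headArrow_mem hC) h

end

end DiGraph

section Criterion

open DiGraph

variable {F : Type w} [Field F] {Γ : DiGraph.{u, v}} (I : TwoSidedIdeal (L F Γ))

theorem isCover_quotientGraph :
    IsCover (Γ.baseVertex (vertexSet I) (breakingSet I))
      (Γ.baseArrow (vertexSet I) (breakingSet I)) :=
  isCover_quotient (fun _ => tgt_mem_vertexSet) fun _ hfin hne => mem_vertexSet_of_forall hfin hne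

/-- The homomorphism from the Leavitt path algebra of `Γ` to that of `Γ / I`. -/
def quotientHom : UnitalLPA F Γ →ₐ[F] UnitalLPA F (quotientGraph I) :=
  (isCover_quotientGraph I).hom F

variable {I}

theorem not_isBreaking_of_mem {x : Γ.V} (hx : x ∈ vertexSet I) :
    ¬ Γ.IsBreaking (vertexSet I) x := by
  rintro ⟨-, -, e, he, heI⟩
  exact heI (tgt_mem_vertexSet (he ▸ hx))

theorem quotientHom_vertex_of_mem {x : Γ.V} (hx : x ∈ vertexSet I) :
    quotientHom I (gen F (.vertex x) : L F Γ) = 0 := by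
  rw [quotientHom, IsCover.hom_vertex, IsCover.vertexSum, Finset.sum_eq_zero]
  · rfl
  intro w hw
  rw [Set.Finite.mem_toFinset] at hw
  rcases quotient_cases_vertex w with ⟨y, hy, rfl⟩ | ⟨y, hy, rfl⟩
  · obtain rfl : y = x := hw
    exact absurd hx hy
  · obtain rfl : y = x := hw
    exact absurd hy.1 (not_isBreaking_of_mem hx)

theorem quotientHom_vertex_mul (w : (quotientGraph I).V) :
    quotientHom I (gen F (.vertex (Γ.baseVertex (vertexSet I) (breakingSet I) w)) : L F Γ) *
      unitalGen F (quotientGraph I) (.vertex w) = unitalGen F (quotientGraph I) (.vertex w) := by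
  classical
  rw [quotientHom, IsCover.hom_vertex, ← coe_gen, ← NonUnitalSubalgebra.coe_mul,
    IsCover.vertexSum_mul_vertex, if_pos rfl]

open Classical in
/-- The image of a breaking vertex is the sum of the vertex and, if there is one, the added sink. -/
theorem quotientHom_breakElem {x : Γ.V} (hx : Γ.IsBreaking (vertexSet I) x) :
    quotientHom I (breakElem F (vertexSet I) x : L F Γ) =
      if h : x ∉ breakingSet I then
        unitalGen F (quotientGraph I) (.vertex (sinkV (vertexSet I) (breakingSet I) x ⟨hx, h⟩))
      else 0 := by
  have hxI : x ∉ vertexSet I := fun h => not_isBreaking_of_mem h hx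
  have hc := isCover_quotientGraph I
  have hfin := hx.2.1
  have hsum : ∑ e ∈ hfin.toFinset, hc.arrowSum F e * hc.dualSum F e =
      gen F (.vertex (keepV (vertexSet I) (breakingSet I) x hxI)) := by
    rw [hc.sum_arrowSum_mul_dualSum]
    obtain ⟨e, he, heI⟩ := hx.2.2
    have hmem : ∀ f, f ∈ hfin.toFinset.biUnion (fun e => (hc.finite_arrow e).toFinset) ↔
        (quotientGraph I).src f = keepV (vertexSet I) (breakingSet I) x hxI := by
      intro f
      simp only [Finset.mem_biUnion, Set.Finite.mem_toFinset]
      constructor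
      · rintro ⟨e, ⟨he, heI⟩, hfe⟩
        rcases quotient_cases f with ⟨f, hf, rfl⟩ | ⟨f, hf, rfl⟩
        · obtain rfl : f = e := hfe
          exact keepV_inj.2 he
        · obtain rfl : f = e := hfe
          exact keepV_inj.2 he
      · intro hf
        rcases quotient_cases f with ⟨f, hf', rfl⟩ | ⟨f, hf', rfl⟩
        · exact ⟨f, ⟨keepV_inj.1 hf, hf'.2⟩, rfl⟩
        · exact ⟨f, ⟨keepV_inj.1 hf, fun h => not_isBreaking_of_mem h hf'.2.1⟩, rfl⟩
    exact (vertex_eq_sum _ _ hmem ⟨keepE _ _ e ⟨src_notMem_vertexSet heI, heI⟩,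
      (hmem _).2 (keepV_inj.2 he)⟩).symm
  have h1 : quotientHom I (breakElem F (vertexSet I) x : L F Γ) =
      (hc.vertexSum F x - gen F (.vertex (keepV (vertexSet I) (breakingSet I) x hxI)) :
        L F (quotientGraph I)) := by
    rw [breakElem_eq hfin, ← hsum]
    rw [show ((gen F (.vertex x) -
        ∑ e ∈ hfin.toFinset, gen F (.arrow e) * gen F (.dual e) : L F Γ) :
      UnitalLPA F Γ) = (gen F (.vertex x) : L F Γ) - ((∑ e ∈ hfin.toFinset, gen F (.arrow e) *
        gen F (.dual e) : L F Γ) : UnitalLPA F Γ) from rfl, map_sub]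
    refine congrArg₂ (· - ·) (hc.hom_vertex x) ?_
    rw [AddSubmonoidClass.coe_finsetSum, AddSubmonoidClass.coe_finsetSum, map_sum]
    refine Finset.sum_congr rfl fun e _ => ?_
    rw [NonUnitalSubalgebra.coe_mul, NonUnitalSubalgebra.coe_mul, map_mul]
    exact congrArg₂ (· * ·) (hc.hom_arrow e) (hc.hom_dual e)
  rw [h1]
  split_ifs with h
  swap
  · rw [← coe_gen]
    congr 1
    rw [IsCover.vertexSum, show (hc.finite x).toFinset =
      {keepV _ _ x hxI, sinkV _ _ x ⟨hx, h⟩} from ?_, Finset.sum_pair keepV_ne_sinkV,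
      add_sub_cancel_left]
    ext w
    rw [Set.Finite.mem_toFinset, Finset.mem_insert, Finset.mem_singleton]
    constructor
    · intro hw
      rcases quotient_cases_vertex w with ⟨y, hy, rfl⟩ | ⟨y, hy, rfl⟩
      · exact Or.inl (keepV_inj.2 hw)
      · exact Or.inr (sinkV_inj.2 hw)
    · rintro (rfl | rfl) <;> rfl
  · rw [hc.vertexSum_eq (w := keepV _ _ x hxI), sub_self]
    · rfl
    intro w
    constructor
    · intro hw
      rcases quotient_cases_vertex w with ⟨y, hy, rfl⟩ | ⟨y, hy, rfl⟩
      · exact keepV_inj.2 hw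
      · obtain rfl : y = x := hw
        exact absurd h hy.2
    · rintro rfl
      rfl

/-- The homomorphism to the Leavitt path algebra of `Γ / I` is the obvious map on cycles with no
exit. -/
theorem quotientHom_pathEval {q : List (quotientGraph I).E}
    (hq : (q : Cycle (quotientGraph I).E) ∈ (quotientGraph I).noExitCycles) :
    (∃ x, Γ.IsPath x (q.map (Γ.baseArrow (vertexSet I) (breakingSet I))) x) ∧ ∀ g : F[X],
      quotientHom I (pathEval (q.map (Γ.baseArrow (vertexSet I) (breakingSet I))) g : L F Γ) =
      (pathEval q g : L F (quotientGraph I)) := by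
  obtain ⟨hq0, ⟨x, hx⟩, -⟩ := isGeomCycle_coe.1 hq.1
  have hkeep := eq_keepE_of_isPath hx
  obtain ⟨g, hg, hgx⟩ : ∃ g ∈ q, (quotientGraph I).tgt g = x := by
    obtain ⟨e, l, rfl⟩ := List.exists_cons_of_ne_nil hq0
    rw [← hx.1]
    exact hx.exists_tgt_eq (by simp)
  obtain ⟨g, hg', rfl⟩ := hkeep g hg
  subst hgx
  have hp := (isPath_quotient hkeep hg'.2 hg'.2).1 hx
  refine ⟨⟨_, hp⟩, fun k => (isCover_quotientGraph I).hom_pathEval hq0 hx ?_ ?_ hp k⟩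
  · intro f hf f' hff'
    exact noExitCycles_unique hq hf f' (src_quotient_eq.2 (congrArg _ hff'))
  · intro w hw
    rcases quotient_cases_vertex w with ⟨y, hy, rfl⟩ | ⟨y, hy, rfl⟩
    · exact keepV_inj.2 hw
    · obtain rfl : y = Γ.tgt g := hw
      -- an arrow to the added sink would leave the cycle
      have := noExitCycles_unique hq hg (sinkE _ _ g ⟨hg'.1, hy⟩) rfl
      exact absurd this.symm keepE_ne_sinkE

/-- A criterion for the kernel of a homomorphism that factors through the Leavitt path algebra of
`Γ / I` to lie in the stratum `𝒥(I, β)`, with prescribed canonical polynomials. The polynomials at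
the cycles outside `β` are set to `0`. -/
theorem kerIdeal_mem_stratum (hI : IsGraded I) {β : Set (Cycle (quotientGraph I).E)}
    (hβ : β ⊆ (quotientGraph I).noExitCycles) {A : Type*} [Ring A] [Algebra F A]
    (φ : UnitalLPA F (quotientGraph I) →ₐ[F] A)
    (hφ : ∀ w, φ (unitalGen F (quotientGraph I) (.vertex w)) ≠ 0)
    (f : Cycle (quotientGraph I).E → F[X]) (hf : ∀ C ∈ β, (f C).coeff 0 = 1 ∧ 0 < (f C).natDegree)
    (hf0 : ∀ C, C ∉ β → f C = 0)
    (hC : ∀ C (hC : C ∈ (quotientGraph I).noExitCycles), ∀ g : F[X],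
      φ (pathEval (headArrow hC :: tailPath hC) g : L F (quotientGraph I)) = 0 ↔ f C ∣ g) :
    kerIdeal (φ.comp (quotientHom I)) ∈ stratum I β ∧
      ∀ C ∈ β, IsCanonicalPoly (kerIdeal (φ.comp (quotientHom I))) (baseCycle I C) (f C) := by
  set K := kerIdeal (φ.comp (quotientHom I))
  have hK : ∀ a : L F Γ, a ∈ K ↔ φ (quotientHom I a) = 0 := fun a => mem_kerIdeal
  have hV : vertexSet K = vertexSet I := by
    ext x
    rw [mem_vertexSet, hK]
    constructor
    · intro h
      by_contra hx
      refine hφ (keepV _ _ x hx) ?_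
      rw [← quotientHom_vertex_mul, map_mul, baseVertex_keepV, h, zero_mul]
    · intro h
      rw [quotientHom_vertex_of_mem h, map_zero]
  have hS : breakingSet K = breakingSet I := by
    ext x
    rw [mem_breakingSet, hV, hK]
    constructor
    · rintro ⟨hx, h⟩
      by_contra hxS
      rw [quotientHom_breakElem hx, dif_pos hxS] at h
      exact hφ _ h
    · intro h
      refine ⟨h.1, ?_⟩
      rw [quotientHom_breakElem h.1, dif_neg (not_not.2 h), map_zero]
  have key : ∀ C ∈ (quotientGraph I).noExitCycles, ∃ x p, Γ.IsPath x p x ∧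
      baseCycle I C = (p : Cycle Γ.E) ∧ ∀ g, pathEval p g ∈ K ↔ f C ∣ g := by
    intro C hC'
    obtain ⟨⟨x, hx⟩, h⟩ := quotientHom_pathEval (F := F) (eq_head_cons_tail hC' ▸ hC')
    refine ⟨x, _, hx, ?_, fun g => ?_⟩
    · conv_lhs => rw [eq_head_cons_tail hC']
      rfl
    · rw [hK, h, hC]
  have hcan : ∀ C ∈ β, IsCanonicalPoly K (baseCycle I C) (f C) := by
    intro C hCβ
    obtain ⟨x, p, hp, hCp, h⟩ := key C (hβ hCβ)
    rw [hCp, isCanonicalPoly_coe_iff hp]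
    exact ⟨(hf C hCβ).1, (hf C hCβ).2, h⟩
  refine ⟨(mem_stratum_iff hI).2 ⟨⟨hV, hS⟩, ?_⟩, hcan⟩
  ext C
  constructor
  · rintro ⟨hC', k, hk⟩
    by_contra hCβ
    obtain ⟨x, p, hp, hCp, h⟩ := key C hC'
    rw [hCp, isCanonicalPoly_coe_iff hp] at hk
    have h1 := (h k).1 ((hk.2.2 k).2 dvd_rfl)
    rw [hf0 C hCβ, zero_dvd_iff] at h1
    simp [h1] at hk
  · intro hCβ
    exact ⟨hβ hCβ, _, hcan C hCβ⟩

end Criterion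

/-! ### Existence of ideals with given canonical polynomials -/

section Existence

open DiGraph

variable {F : Type w} [Field F]

/-- The algebra `F[x, x⁻¹] / (f)`. -/
abbrev LaurentQuotient (f : F[X]) : Type w := Localization.Away (AdjoinRoot.root f)

/-- The polynomial `f` is coprime to `x`, so inverting the class of `x` in `F[x] / (f)` loses
nothing. -/
theorem exists_unit_aeval_eq_zero_iff {f : F[X]} (hf : f = 0 ∨ f.coeff 0 = 1) :
    ∃ ω : (LaurentQuotient f)ˣ, ∀ g : F[X], aeval (ω : LaurentQuotient f) g = 0 ↔ f ∣ g := by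
  obtain ⟨ω, hω⟩ := IsLocalization.Away.algebraMap_isUnit (S := LaurentQuotient f)
    (AdjoinRoot.root f)
  refine ⟨ω, fun g => ?_⟩
  rw [hω, aeval_algebraMap_apply, AdjoinRoot.aeval_eq,
    IsLocalization.map_eq_zero_iff (Submonoid.powers (AdjoinRoot.root f))]
  constructor
  · rintro ⟨⟨_, n, rfl⟩, h⟩
    have h1 : f ∣ X ^ n * g := by
      rw [← AdjoinRoot.mk_eq_zero, map_mul, map_pow, AdjoinRoot.mk_X]
      exact h
    rcases hf with rfl | hf
    · rw [zero_dvd_iff] at h1 ⊢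
      simpa using h1
    · refine IsCoprime.dvd_of_dvd_mul_left (IsCoprime.pow_right ?_) h1
      refine ⟨1, -f.divX, ?_⟩
      have h2 := X_mul_divX_add f
      rw [hf, map_one] at h2
      linear_combination -h2
  · intro h
    exact ⟨1, by rw [AdjoinRoot.mk_eq_zero.2 h, mul_zero]⟩

theorem exists_unit_root [IsAlgClosed F] {f : F[X]}
    (hf : f = 0 ∨ f.coeff 0 = 1 ∧ 0 < f.natDegree) : ∃ r : Fˣ, f.eval (r : F) = 0 := by
  rcases hf with rfl | ⟨h0, hd⟩
  · exact ⟨1, eval_zero⟩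
  · obtain ⟨r, hr⟩ := IsAlgClosed.exists_root f (natDegree_pos_iff_degree_pos.1 hd).ne'
    refine ⟨Units.mk0 r ?_, hr⟩
    rintro rfl
    rw [IsRoot.def, ← coeff_zero_eq_eval_zero, h0] at hr
    exact one_ne_zero hr

/-- Over a digraph, there are weights in a commutative algebra for which every cycle `C` with no
exit gets a weight that is annihilated by the multiples of `f C` only. -/
theorem exists_weights [IsAlgClosed F] (Δ : DiGraph.{u, v}) (f : Cycle Δ.E → F[X])
    (hf : ∀ C, f C = 0 ∨ (f C).coeff 0 = 1 ∧ 0 < (f C).natDegree) :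
    ∃ (B : Type max v w) (_ : CommRing B) (_ : Nontrivial B) (_ : Algebra F B) (c : Δ.E → Bˣ),
      ∀ C (hC : C ∈ Δ.noExitCycles) (g : F[X]),
        aeval (((headArrow hC :: tailPath hC).map c).prod : B) g = 0 ↔ f C ∣ g := by
  classical
  choose ω hω using fun C => exists_unit_aeval_eq_zero_iff ((hf C).imp id And.left)
  choose r hr using fun C => exists_unit_root (hf C)
  let B := ∀ D : Cycle Δ.E, LaurentQuotient (f D)
  -- the component at `D` of the weight of the chosen arrow of `C ≠ D` is a root of `f C`
  let c : Δ.E → Bˣ := fun e => MulEquiv.piUnits.symm fun D =>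
    if h : ∃ C, ∃ hC : C ∈ Δ.noExitCycles, e = headArrow hC then
      if h.choose = D then ω D
      else Units.map (algebraMap F (LaurentQuotient (f D))).toMonoidHom (r h.choose)
    else 1
  have hhead : ∀ C (hC : C ∈ Δ.noExitCycles) D, (c (headArrow hC) : B) D =
      if C = D then (ω D : LaurentQuotient (f D))
      else algebraMap F (LaurentQuotient (f D)) (r C) := by
    intro C hC D
    have h : ∃ C', ∃ hC' : C' ∈ Δ.noExitCycles, headArrow hC = headArrow hC' := ⟨C, hC, rfl⟩
    have hch : h.choose = C := by
      obtain ⟨h1, h2⟩ := h.choose_spec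
      refine (eq_of_headArrow_mem hC h1 ?_).symm
      exact Eq.mpr (congrArg (· ∈ h.choose) h2) (headArrow_mem h1)
    change ((if h : _ then _ else _ : (LaurentQuotient (f D))ˣ) : LaurentQuotient (f D)) = _
    rw [dif_pos h, hch]
    split_ifs <;> rfl
  have htail : ∀ C (hC : C ∈ Δ.noExitCycles), ∀ e ∈ tailPath hC, c e = 1 := by
    intro C hC e he
    have h : ¬ ∃ C', ∃ hC' : C' ∈ Δ.noExitCycles, e = headArrow hC' := by
      rintro ⟨C', hC', rfl⟩
      obtain rfl := eq_of_headArrow_mem hC' hC ((mem_cycle_iff hC _).2 (by simp [he]))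
      exact headArrow_notMem_tailPath hC he
    refine Units.ext (funext fun D => ?_)
    change ((if h : _ then _ else _ : (LaurentQuotient (f D))ˣ) : LaurentQuotient (f D)) = _
    rw [dif_neg h]
    rfl
  have hnt : ∀ D, Nontrivial (LaurentQuotient (f D)) := by
    intro D
    refine ⟨1, 0, fun h => ?_⟩
    have h1 := (hω D 1).1 (by rw [map_one, h])
    rcases hf D with h0 | ⟨-, h0⟩
    · rw [h0, zero_dvd_iff] at h1
      exact one_ne_zero h1
    · have := natDegree_le_of_dvd h1 one_ne_zero
      rw [natDegree_one] at this
      omega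
  have := hnt Cycle.nil
  refine ⟨B, inferInstance, Pi.nontrivial_at Cycle.nil, inferInstance, c, fun C hC g => ?_⟩
  have hprod : ((headArrow hC :: tailPath hC).map c).prod = c (headArrow hC) := by
    rw [List.map_cons, List.prod_cons, List.prod_eq_one, mul_one]
    intro a ha
    obtain ⟨e, he, rfl⟩ := List.mem_map.1 ha
    exact htail C hC e he
  have heval : aeval (c (headArrow hC) : B) g = 0 ↔
      ∀ D, aeval ((c (headArrow hC) : B) D) g = 0 := by
    rw [aeval_pi, funext_iff]
    rfl
  rw [hprod, heval]
  constructor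
  · intro h
    have h1 := h C
    rw [hhead, if_pos rfl] at h1
    exact (hω C g).1 h1
  · intro h D
    rw [hhead]
    split_ifs with hCD
    · subst hCD
      exact (hω C g).2 h
    · obtain ⟨k, rfl⟩ := h
      rw [aeval_algebraMap_apply, coe_aeval_eq_eval, eval_mul, hr, zero_mul, map_zero]

/-- Every choice of polynomials occurs in a stratum. -/
theorem exists_mem_stratum [IsAlgClosed F] {Γ : DiGraph.{u, v}} {I : TwoSidedIdeal (L F Γ)}
    (hI : IsGraded I) {β : Set (Cycle (quotientGraph I).E)}
    (hβ : β ⊆ (quotientGraph I).noExitCycles) (f : β → F[X])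
    (hf : ∀ C, (f C).coeff 0 = 1 ∧ 0 < (f C).natDegree) :
    ∃ J ∈ stratum I β, ∀ C : β, IsCanonicalPoly J (baseCycle I C) (f C) := by
  classical
  let f' : Cycle (quotientGraph I).E → F[X] := fun C => if h : C ∈ β then f ⟨C, h⟩ else 0
  have hf' : ∀ C : β, f' C = f C := fun C => dif_pos C.2
  obtain ⟨B, _, _, _, c, hc⟩ := exists_weights (quotientGraph I) f' fun C => by
    by_cases h : C ∈ β
    · exact Or.inr ((hf' ⟨C, h⟩).symm ▸ hf ⟨C, h⟩)
    · exact Or.inl (dif_neg h)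
  obtain ⟨X, _, φ, hφ⟩ := (quotientGraph I).exists_isBranching
  obtain ⟨h1, h2⟩ := kerIdeal_mem_stratum hI hβ
    (A := Module.End B (((quotientGraph I).V × X) →₀ B)) (rep F hφ c) (rep_vertex_ne_zero hφ c) f'
    (fun C hC => (hf' ⟨C, hC⟩).symm ▸ hf ⟨C, hC⟩) (fun C hC => dif_neg hC) fun C hC g => by
      rw [rep_pathEval_eq_zero_iff hφ c (by simp) (isPath_head_cons_tail hC)
        (fun e he => unique_of_mem hC ((mem_cycle_iff hC e).2 he)), hc C hC]
  exact ⟨_, h1, fun C => hf' C ▸ h2 C C.2⟩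

/-! ### The parametrization of the strata -/

theorem Factor.coeff_zero {n : ℕ} (a : Factor F n) : a.poly.coeff 0 = 1 := by
  simp [Factor.poly, coeff_X_pow]

theorem Factor.coeff_succ {n : ℕ} (a : Factor F n) (i : Fin n) : a.poly.coeff (i + 1) = a.1 i := by
  classical
  rw [Factor.poly, coeff_add, coeff_one, if_neg (by omega), zero_add, finsetSum_coeff,
    Finset.sum_eq_single i]
  · simp
  · intro j _ hj
    rw [coeff_C_mul_X_pow, if_neg]
    exact fun h => hj (Fin.ext (by omega))
  · simp

theorem Factor.natDegree_poly_le {n : ℕ} (a : Factor F n) : a.poly.natDegree ≤ n := by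
  refine (natDegree_add_le _ _).trans (max_le (by simp) (natDegree_sum_le_of_forall_le _ _ ?_))
  intro i _
  exact (natDegree_C_mul_X_pow_le _ _).trans i.2

theorem Factor.natDegree_poly {n : ℕ} (a : Factor F n) : a.poly.natDegree = n := by
  refine le_antisymm a.natDegree_poly_le ?_
  cases n with
  | zero => exact Nat.zero_le _
  | succ n =>
    refine le_natDegree_of_ne_zero ?_
    have h := a.coeff_succ (Fin.last n)
    rw [Fin.val_last] at h
    rw [h]
    exact a.2 _ rfl

/-- A polynomial of degree at most `n` with constant term `1` is determined by its coefficients. -/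
theorem Factor.poly_eq {n : ℕ} (a : Factor F n) {f : F[X]} (h0 : f.coeff 0 = 1)
    (hd : f.natDegree ≤ n) (h : ∀ i : Fin n, f.coeff (i + 1) = a.1 i) : a.poly = f := by
  ext k
  rcases k with _ | k
  · rw [a.coeff_zero, h0]
  · by_cases hk : k < n
    · rw [h ⟨k, hk⟩, ← a.coeff_succ ⟨k, hk⟩]
    · rw [coeff_eq_zero_of_natDegree_lt (by have := a.natDegree_poly_le; omega),
        coeff_eq_zero_of_natDegree_lt (by omega)]

variable {Γ : DiGraph.{u, v}} {I : TwoSidedIdeal (L F Γ)} {β : Set (Cycle (quotientGraph I).E)}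

theorem coeffMap_poly {d : β → ℕ+} (J : stratumDeg I β d) (C : β) :
    (coeffMap I β d J C).poly = canonicalPoly J.1 (baseCycle I C) :=
  (coeffMap I β d J C).poly_eq (isCanonicalPoly_canonicalPoly J.2.1 C).1 (J.2.2 C).le fun _ => rfl

theorem coeffMap_bijective [IsAlgClosed F] (hI : IsGraded I)
    (hβ : β ⊆ (quotientGraph I).noExitCycles) (d : β → ℕ+) :
    Function.Bijective (coeffMap I β d) := by
  constructor
  · intro J K h
    refine Subtype.ext (eq_of_canonicalPoly_eq J.2.1 K.2.1 fun C => ?_)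
    rw [← coeffMap_poly, ← coeffMap_poly, h]
  · intro a
    obtain ⟨J, hJ, hf⟩ := exists_mem_stratum hI hβ (fun C : β => (a C).poly) fun C =>
      ⟨(a C).coeff_zero, by rw [(a C).natDegree_poly]; exact (d C).pos⟩
    have hJ' : ∀ C : β, canonicalPoly J (baseCycle I C) = (a C).poly :=
      fun C => canonicalPoly_eq (hf C)
    refine ⟨⟨J, hJ, fun C => by rw [hJ' C, (a C).natDegree_poly]⟩, funext fun C => Subtype.ext ?_⟩
    funext i
    change (canonicalPoly J (baseCycle I C)).coeff (i + 1) = _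
    rw [hJ' C, (a C).coeff_succ]

end Existence

/-! ### Cutting cycles with no exit -/

namespace DiGraph

variable {Γ : DiGraph.{u, v}} {D : Set Γ.E}

/-- The digraph without the arrows in `D`. -/
def delete (Γ : DiGraph.{u, v}) (D : Set Γ.E) : DiGraph.{u, v} where
  V := Γ.V
  E := {e : Γ.E // e ∉ D}
  src e := Γ.src e.1
  tgt e := Γ.tgt e.1

/-- A vertex of `Γ`, as a vertex of `Γ.delete D`. -/
def delV (D : Set Γ.E) (x : Γ.V) : (Γ.delete D).V := x

/-- An arrow outside `D`, as an arrow of `Γ.delete D`. -/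
def delE (D : Set Γ.E) (e : Γ.E) (he : e ∉ D) : (Γ.delete D).E := ⟨e, he⟩

/-- The inclusion of the arrows of `Γ.delete D`. -/
def ofDelE (D : Set Γ.E) (e : (Γ.delete D).E) : Γ.E := e.1

theorem delV_inj {x y : Γ.V} : delV D x = delV D y ↔ x = y := Iff.rfl

theorem exists_delE (e : (Γ.delete D).E) : ∃ e₀ he, e = delE D e₀ he := ⟨e.1, e.2, rfl⟩

theorem delE_inj {e f : Γ.E} {he : e ∉ D} {hf : f ∉ D} : delE D e he = delE D f hf ↔ e = f :=
  Subtype.ext_iff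

theorem src_delE {e : Γ.E} (he : e ∉ D) : (Γ.delete D).src (delE D e he) = delV D (Γ.src e) := rfl
theorem tgt_delE {e : Γ.E} (he : e ∉ D) : (Γ.delete D).tgt (delE D e he) = delV D (Γ.tgt e) := rfl
theorem ofDelE_delE {e : Γ.E} (he : e ∉ D) : ofDelE D (delE D e he) = e := rfl

/-- Each arrow `e` in `D` lies on a cycle with no exit whose other arrows, which form the path
`l e`, are not in `D`. -/
structure IsCut (D : Set Γ.E) (l : Γ.E → List (Γ.delete D).E) : Prop where
  only : ∀ e ∈ D, ∀ f, Γ.src f = Γ.src e → f = e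
  path : ∀ e ∈ D, (Γ.delete D).IsPath (delV D (Γ.tgt e)) (l e) (delV D (Γ.src e))
  only_path : ∀ e ∈ D, ∀ f ∈ l e, ∀ g, Γ.src g = Γ.src (ofDelE D f) → g = ofDelE D f

end DiGraph

section Cut

open DiGraph

variable {F : Type w} [Field F] {Γ : DiGraph.{u, v}}

theorem arrow_mul_dual_self {e : Γ.E} (he : ∀ f, Γ.src f = Γ.src e → f = e) :
    gen F (.arrow e) * gen F (.dual e) = gen F (.vertex (Γ.src e)) := by
  rw [vertex_eq_sum (Γ.src e) {e} (fun f => ?_) ⟨e, by simp⟩, Finset.sum_singleton]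
  rw [Finset.mem_singleton]
  exact ⟨fun h => h ▸ rfl, he f⟩

theorem pathTo_mul_ghostFrom {x y : Γ.V} {l : List Γ.E} (h : Γ.IsPath x l y)
    (hl : ∀ e ∈ l, ∀ f, Γ.src f = Γ.src e → f = e) :
    pathTo F l y * ghostFrom F l y = gen F (.vertex x) := by
  induction l generalizing x with
  | nil =>
    obtain rfl : x = y := h
    exact vertex_mul_self x
  | cons e l ih =>
    rw [pathTo_cons, ghostFrom_cons, mul_assoc, ← mul_assoc (pathTo F l y),
      ih h.2 fun f hf => hl f (by simp [hf]), tgt_mul_dual, arrow_mul_dual_self (hl e (by simp)),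
      h.1]

theorem ghostFrom_mul_start {x y : Γ.V} {l : List Γ.E} (h : Γ.IsPath x l y) :
    ghostFrom F l y * gen F (.vertex x) = ghostFrom F l y := by
  cases l with
  | nil =>
    obtain rfl : x = y := h
    exact vertex_mul_self x
  | cons e l => rw [ghostFrom_cons, mul_assoc, ← h.1, dual_mul_src]

variable {D : Set Γ.E} {l : Γ.E → List (Γ.delete D).E} (h : IsCut D l) (c : Γ.E → Fˣ)

open Classical in
/-- The image of an arrow: the arrows in `D` become multiples of the inverse of the rest of their
cycle. -/
def cutArrow (l : Γ.E → List (Γ.delete D).E) (c : Γ.E → Fˣ) (e : Γ.E) : L F (Γ.delete D) :=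
  if he : e ∈ D then (c e : F) • ghostFrom F (l e) (delV D (Γ.src e))
  else gen F (.arrow (delE D e he))

open Classical in
/-- The image of a dual arrow. -/
def cutDual (l : Γ.E → List (Γ.delete D).E) (c : Γ.E → Fˣ) (e : Γ.E) : L F (Γ.delete D) :=
  if he : e ∈ D then (↑(c e)⁻¹ : F) • pathTo F (l e) (delV D (Γ.src e))
  else gen F (.dual (delE D e he))

theorem cutArrow_of_mem {e : Γ.E} (he : e ∈ D) :
    cutArrow l c e = (c e : F) • ghostFrom F (l e) (delV D (Γ.src e)) := dif_pos he

theorem cutArrow_of_notMem {e : Γ.E} (he : e ∉ D) :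
    cutArrow l c e = gen F (.arrow (delE D e he)) := dif_neg he

theorem cutDual_of_mem {e : Γ.E} (he : e ∈ D) :
    cutDual l c e = (↑(c e)⁻¹ : F) • pathTo F (l e) (delV D (Γ.src e)) := dif_pos he

theorem cutDual_of_notMem {e : Γ.E} (he : e ∉ D) :
    cutDual l c e = gen F (.dual (delE D e he)) := dif_neg he

include h in
theorem isFamily_cut : IsFamily Γ
    (fun x => ((gen F (.vertex (delV D x)) : L F (Γ.delete D)) : UnitalLPA F (Γ.delete D)))
    (fun e => (cutArrow l c e : UnitalLPA F (Γ.delete D)))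
    (fun e => (cutDual l c e : UnitalLPA F (Γ.delete D))) := by
  classical
  refine ⟨fun x => congrArg Subtype.val (vertex_mul_self _),
    fun x y hxy => congrArg Subtype.val (vertex_mul_of_ne fun h' => hxy (delV_inj.1 h')),
    fun e => congrArg Subtype.val (?_ : gen F (.vertex (delV D (Γ.src e))) * cutArrow l c e = _),
    fun e => congrArg Subtype.val (?_ : cutArrow l c e * gen F (.vertex (delV D (Γ.tgt e))) = _),
    fun e => congrArg Subtype.val (?_ : gen F (.vertex (delV D (Γ.tgt e))) * cutDual l c e = _),
    fun e => congrArg Subtype.val (?_ : cutDual l c e * gen F (.vertex (delV D (Γ.src e))) = _),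
    fun e => congrArg Subtype.val
      (?_ : cutDual l c e * cutArrow l c e = gen F (.vertex (delV D (Γ.tgt e)))),
    fun e f hef hs => congrArg Subtype.val (?_ : cutDual l c e * cutArrow l c f = 0),
    fun x T hT hne => ?_⟩
  · by_cases he : e ∈ D
    · rw [cutArrow_of_mem c he, mul_smul_comm, vertex_mul_ghostFrom]
    · rw [cutArrow_of_notMem c he, ← src_delE he, src_mul_arrow]
  · by_cases he : e ∈ D
    · rw [cutArrow_of_mem c he, smul_mul_assoc, ghostFrom_mul_start (h.path e he)]
    · rw [cutArrow_of_notMem c he, ← tgt_delE he, arrow_mul_tgt]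
  · by_cases he : e ∈ D
    · rw [cutDual_of_mem c he, mul_smul_comm, vertex_mul_pathTo (h.path e he)]
    · rw [cutDual_of_notMem c he, ← tgt_delE he, tgt_mul_dual]
  · by_cases he : e ∈ D
    · rw [cutDual_of_mem c he, smul_mul_assoc, pathTo_mul_vertex]
    · rw [cutDual_of_notMem c he, ← src_delE he, dual_mul_src]
  · by_cases he : e ∈ D
    · rw [cutDual_of_mem c he, cutArrow_of_mem c he, smul_mul_assoc, mul_smul_comm, smul_smul,
        Units.inv_mul, one_smul, pathTo_mul_ghostFrom (h.path e he)]
      intro f hf g hg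
      obtain ⟨f, hfD, rfl⟩ := exists_delE f
      obtain ⟨g, hgD, rfl⟩ := exists_delE g
      exact delE_inj.2 (h.only_path e he _ hf g hg)
    · rw [cutDual_of_notMem c he, cutArrow_of_notMem c he, dual_mul_arrow_self, tgt_delE]
  · by_cases he : e ∈ D
    · exact absurd (h.only e he f hs.symm).symm hef
    · by_cases hf : f ∈ D
      · exact absurd (h.only f hf e hs) hef
      · rw [cutDual_of_notMem c he, cutArrow_of_notMem c hf]
        exact dual_mul_arrow_of_ne fun h' => hef (delE_inj.1 h')
  · have key : gen F (.vertex (delV D x)) = ∑ e ∈ T, cutArrow l c e * cutDual l c e := by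
      by_cases hx : ∃ e ∈ D, Γ.src e = x
      · obtain ⟨e, he, rfl⟩ := hx
        have hTe : T = {e} := by
          ext f
          rw [hT, Finset.mem_singleton]
          exact ⟨h.only e he f, fun h' => h' ▸ rfl⟩
        rw [hTe, Finset.sum_singleton, cutDual_of_mem c he, cutArrow_of_mem c he, smul_mul_assoc,
          mul_smul_comm, smul_smul, Units.mul_inv, one_smul, ghostFrom_mul_pathTo (h.path e he)]
      · have hTD : ∀ e ∈ T, e ∉ D := fun e he heD => hx ⟨e, heD, (hT e).1 he⟩
        rw [vertex_eq_sum (delV D x) (T.attach.image fun e => delE D e.1 (hTD e.1 e.2)),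
          Finset.sum_image, ← Finset.sum_attach T]
        · refine Finset.sum_congr rfl fun e _ => ?_
          rw [cutDual_of_notMem c (hTD e.1 e.2), cutArrow_of_notMem c (hTD e.1 e.2)]
        · intro e _ f _ hef
          exact Subtype.ext (delE_inj.1 hef)
        · intro e
          obtain ⟨e, heD, rfl⟩ := exists_delE e
          rw [src_delE, delV_inj, ← hT]
          simp only [Finset.mem_image, Finset.mem_attach, true_and, Subtype.exists, delE_inj]
          exact ⟨fun ⟨f, hf, hfe⟩ => hfe ▸ hf, fun he => ⟨e, he, rfl⟩⟩
        · obtain ⟨e, he⟩ := hne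
          exact ⟨_, Finset.mem_image_of_mem _ (Finset.mem_attach T ⟨e, he⟩)⟩
    rw [key]
    simp

/-- The homomorphism that maps each cycle through an arrow `e` of `D` to `c e` times a vertex. -/
def cutHom : UnitalLPA F Γ →ₐ[F] UnitalLPA F (Γ.delete D) := (isFamily_cut h c).lift F

theorem cutHom_vertex (x : Γ.V) : cutHom h c (gen F (.vertex x) : L F Γ) =
    (gen F (.vertex (delV D x)) : L F (Γ.delete D)) := (isFamily_cut h c).lift_gen _

theorem cutHom_arrow (e : Γ.E) : cutHom h c (gen F (.arrow e) : L F Γ) = cutArrow l c e :=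
  (isFamily_cut h c).lift_gen _

theorem cutHom_dual (e : Γ.E) : cutHom h c (gen F (.dual e) : L F Γ) = cutDual l c e :=
  (isFamily_cut h c).lift_gen _

theorem cutHom_pathTo (q : List (Γ.delete D).E) (y : Γ.V) :
    cutHom h c (pathTo F (q.map (ofDelE D)) y : L F Γ) =
      (pathTo F q (delV D y) : L F (Γ.delete D)) := by
  induction q with
  | nil => exact cutHom_vertex h c y
  | cons e q ih =>
    obtain ⟨e, he, rfl⟩ := exists_delE e
    rw [List.map_cons, ofDelE_delE, pathTo_cons, pathTo_cons, NonUnitalSubalgebra.coe_mul,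
      NonUnitalSubalgebra.coe_mul, map_mul, ih, cutHom_arrow, cutArrow_of_notMem c he]

theorem cutHom_pathTo_cons {e : Γ.E} (he : e ∈ D) :
    cutHom h c (pathTo F (e :: (l e).map (ofDelE D)) (Γ.src e) : L F Γ) =
      ((c e : F) • gen F (.vertex (delV D (Γ.src e))) : L F (Γ.delete D)) := by
  rw [pathTo_cons, NonUnitalSubalgebra.coe_mul, map_mul, cutHom_pathTo, cutHom_arrow,
    cutArrow_of_mem c he, ← NonUnitalSubalgebra.coe_mul, smul_mul_assoc,
    ghostFrom_mul_pathTo (h.path e he)]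

theorem isPath_ofDelE {x y : Γ.V} {q : List (Γ.delete D).E}
    (hq : (Γ.delete D).IsPath (delV D x) q (delV D y)) : Γ.IsPath x (q.map (ofDelE D)) y := by
  induction q generalizing x with
  | nil => exact hq
  | cons e q ih => exact ⟨hq.1, ih hq.2⟩

theorem cutHom_pathEval {x : Γ.V} {q : List (Γ.delete D).E} (hq0 : q ≠ [])
    (hq : (Γ.delete D).IsPath (delV D x) q (delV D x)) (g : F[X]) :
    cutHom h c (pathEval (q.map (ofDelE D)) g : L F Γ) = (pathEval q g : L F (Γ.delete D)) := by
  have hp := isPath_ofDelE hq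
  rw [coe_pathEval (by simpa using hq0) hp, coe_pathEval hq0 hq, map_mul,
    ← Polynomial.aeval_algHom_apply, pathElem_eq_pathTo (by simpa using hq0) hp, cutHom_pathTo,
    pathElem_eq_pathTo hq0 hq, ← coe_gen, cutHom_vertex, coe_gen]

end Cut

namespace IsCover

variable {F : Type w} [Field F] {Γ Δ : DiGraph.{u, v}} {bV : Δ.V → Γ.V} {bE : Δ.E → Γ.E}
  (h : IsCover bV bE)

theorem hom_vertex_mul (w : Δ.V) : h.hom F (gen F (.vertex (bV w)) : L F Γ) *
    (gen F (.vertex w) : L F Δ) = (gen F (.vertex w) : L F Δ) := by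
  classical
  rw [hom_vertex, ← NonUnitalSubalgebra.coe_mul, vertexSum_mul_vertex, if_pos rfl]

theorem hom_arrow_mul (f : Δ.E) : h.hom F (gen F (.arrow (bE f)) : L F Γ) *
    (gen F (.vertex (Δ.tgt f)) : L F Δ) = (gen F (.arrow f) : L F Δ) := by
  rw [hom_arrow, ← NonUnitalSubalgebra.coe_mul, h.arrowSum_mul_vertex rfl]

theorem mul_hom_dual (f : Δ.E) : (gen F (.vertex (Δ.tgt f)) : L F Δ) *
    h.hom F (gen F (.dual (bE f)) : L F Γ) = (gen F (.dual f) : L F Δ) := by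
  rw [hom_dual, ← NonUnitalSubalgebra.coe_mul, h.vertex_mul_dualSum rfl]

/-- The end of a path of `Δ` selects its lift. -/
theorem hom_pathTo_mul {x y : Δ.V} {q : List Δ.E} (hq : Δ.IsPath x q y) :
    h.hom F (pathTo F (q.map bE) (bV y) : L F Γ) * (gen F (.vertex y) : L F Δ) =
      (pathTo F q y : L F Δ) := by
  induction q generalizing x with
  | nil => exact h.hom_vertex_mul y
  | cons f q ih =>
    rw [List.map_cons, pathTo_cons, NonUnitalSubalgebra.coe_mul, map_mul, mul_assoc, ih hq.2,
      ← vertex_mul_pathTo hq.2, NonUnitalSubalgebra.coe_mul, ← mul_assoc, hom_arrow_mul,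
      ← NonUnitalSubalgebra.coe_mul, pathTo_cons]

end IsCover

/-! ### Images and kernels of homomorphisms -/

section Image

open DiGraph

variable {F : Type w} [Field F] {Γ Λ : DiGraph.{u, v}} {A : Type*} [Ring A] [Algebra F A]

/-- The image of the Leavitt path algebra under a homomorphism of the unital algebra. -/
def image (φ : UnitalLPA F Γ →ₐ[F] A) : NonUnitalSubalgebra F A :=
  (NonUnitalAlgebra.adjoin F (Set.range (unitalGen F Γ))).map (φ : UnitalLPA F Γ →ₙₐ[F] A)

theorem mem_image {φ : UnitalLPA F Γ →ₐ[F] A} {b : A} : b ∈ image φ ↔ ∃ a : L F Γ, φ a = b := by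
  constructor
  · rintro ⟨a, ha, rfl⟩
    exact ⟨⟨a, ha⟩, rfl⟩
  · rintro ⟨a, rfl⟩
    exact ⟨a, a.2, rfl⟩

theorem apply_mem_image (φ : UnitalLPA F Γ →ₐ[F] A) (a : L F Γ) : φ a ∈ image φ :=
  mem_image.2 ⟨a, rfl⟩

theorem apply_mem_of_forall {φ : UnitalLPA F Γ →ₐ[F] A} {W : NonUnitalSubalgebra F A}
    (h : ∀ x, φ (gen F x : L F Γ) ∈ W) (a : L F Γ) : φ a ∈ W := by
  induction a using L_induction with
  | hgen x => exact h x
  | hadd a b ha hb => rw [NonUnitalSubalgebra.coe_add, map_add]; exact W.add_mem ha hb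
  | h0 => rw [NonUnitalSubalgebra.coe_zero, map_zero]; exact W.zero_mem
  | hmul a b ha hb => rw [NonUnitalSubalgebra.coe_mul, map_mul]; exact W.mul_mem ha hb
  | hsmul c a ha => rw [NonUnitalSubalgebra.coe_smul, map_smul]; exact W.smul_mem c ha

/-- The quotient by the kernel of a homomorphism onto a Leavitt path algebra. -/
theorem quotientIsLPA_kerIdeal (φ : UnitalLPA F Γ →ₐ[F] UnitalLPA F Λ)
    (h1 : ∀ x, φ (gen F x : L F Γ) ∈ NonUnitalAlgebra.adjoin F (Set.range (unitalGen F Λ)))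
    (h2 : ∀ y, unitalGen F Λ y ∈ image φ) : QuotientIsLPA (kerIdeal φ) := by
  let ψ : L F Γ → L F Λ := fun a => ⟨φ a, apply_mem_of_forall h1 a⟩
  have hψ : ∀ a b, (kerIdeal φ).ringCon a b ↔ ψ a = ψ b := by
    intro a b
    rw [TwoSidedIdeal.rel_iff, mem_kerIdeal, Subtype.ext_iff]
    change φ (a - b) = 0 ↔ φ a = φ b
    rw [map_sub, sub_eq_zero]
  let f : (kerIdeal φ).ringCon.Quotient →ₙ+* L F Λ :=
    { toFun := Quotient.lift ψ fun a b hab => (hψ a b).1 hab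
      map_mul' := by
        rintro ⟨a⟩ ⟨b⟩
        exact Subtype.ext (map_mul φ (a : UnitalLPA F Γ) b)
      map_add' := by
        rintro ⟨a⟩ ⟨b⟩
        exact Subtype.ext (map_add φ (a : UnitalLPA F Γ) b)
      map_zero' := Subtype.ext (map_zero φ) }
  refine ⟨Λ, RingEquiv.ofBijective f ⟨?_, ?_⟩,
    fun c a => Subtype.ext (map_smul φ c (a : UnitalLPA F Γ))⟩
  · rintro ⟨a⟩ ⟨b⟩ hab
    exact Quotient.sound ((hψ a b).2 hab)
  · rintro ⟨b, hb⟩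
    have hle : NonUnitalAlgebra.adjoin F (Set.range (unitalGen F Λ)) ≤ image φ := by
      rw [NonUnitalAlgebra.adjoin_le_iff]
      rintro _ ⟨y, rfl⟩
      exact h2 y
    obtain ⟨a, ha⟩ := mem_image.1 (hle hb)
    exact ⟨RingCon.toQuotient a, Subtype.ext ha⟩

theorem comp_mem_image {Δ : DiGraph.{u, v}} {π : UnitalLPA F Γ →ₐ[F] UnitalLPA F Δ}
    (hπ : ∀ y, unitalGen F Δ y ∈ image π) (φ : UnitalLPA F Δ →ₐ[F] A) (a : L F Δ) :
    φ a ∈ image (φ.comp π) := by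
  refine apply_mem_of_forall (fun y => ?_) a
  obtain ⟨b, hb⟩ := mem_image.1 (hπ y)
  exact mem_image.2 ⟨b, congrArg φ hb⟩

theorem IsCover.hom_gen_mem {bV : Λ.V → Γ.V} {bE : Λ.E → Γ.E} (h : IsCover bV bE) (x : Gen Γ) :
    h.hom F (gen F x : L F Γ) ∈ NonUnitalAlgebra.adjoin F (Set.range (unitalGen F Λ)) := by
  cases x with
  | vertex x => rw [h.hom_vertex]; exact (h.vertexSum F x).2
  | arrow e => rw [h.hom_arrow]; exact (h.arrowSum F e).2
  | dual e => rw [h.hom_dual]; exact (h.dualSum F e).2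

theorem quotientHom_image (I : TwoSidedIdeal (L F Γ)) (y : Gen (quotientGraph I)) :
    unitalGen F (quotientGraph I) y ∈ image (quotientHom I) := by
  have hc := isCover_quotientGraph I
  have hsink : ∀ x hx, unitalGen F (quotientGraph I) (.vertex (sinkV _ _ x hx)) ∈
      image (quotientHom I) := by
    intro x hx
    have h := quotientHom_breakElem hx.1
    rw [dif_pos hx.2] at h
    rw [← h]
    exact apply_mem_image _ _
  have hvertex : ∀ w, unitalGen F (quotientGraph I) (.vertex w) ∈ image (quotientHom I) := by
    intro w
    rcases quotient_cases_vertex w with ⟨x, hx, rfl⟩ | ⟨x, hx, rfl⟩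
    · have hx1 : quotientHom I (gen F (.vertex x) : L F Γ) ∈ image (quotientHom I) :=
        apply_mem_image _ _
      have hx2 : quotientHom I (gen F (.vertex x) : L F Γ) = hc.vertexSum F x := hc.hom_vertex x
      rw [hx2] at hx1
      by_cases hb : Γ.IsBreaking (vertexSet I) x ∧ x ∉ breakingSet I
      · have h := quotientHom_breakElem hb.1
        have hs := sub_mem hx1 (hsink x hb)
        have hsum : hc.vertexSum F x = gen F (.vertex (keepV _ _ x hx)) +
            gen F (.vertex (sinkV _ _ x hb)) := by
          classical
          rw [IsCover.vertexSum, show (hc.finite x).toFinset =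
            {keepV _ _ x hx, sinkV _ _ x hb} from ?_, Finset.sum_pair keepV_ne_sinkV]
          ext w
          rw [Set.Finite.mem_toFinset, Finset.mem_insert, Finset.mem_singleton]
          constructor
          · intro hw
            rcases quotient_cases_vertex w with ⟨y, hy, rfl⟩ | ⟨y, hy, rfl⟩
            · exact Or.inl (keepV_inj.2 hw)
            · exact Or.inr (sinkV_inj.2 hw)
          · rintro (rfl | rfl) <;> rfl
        rw [hsum, NonUnitalSubalgebra.coe_add, coe_gen, coe_gen, add_sub_cancel_right] at hs
        exact hs
      · rwa [hc.vertexSum_eq (w := keepV _ _ x hx), coe_gen] at hx1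
        intro w
        constructor
        · intro hw
          rcases quotient_cases_vertex w with ⟨y, hy, rfl⟩ | ⟨y, hy, rfl⟩
          · exact keepV_inj.2 hw
          · obtain rfl : y = x := hw
            exact absurd hy hb
        · rintro rfl
          rfl
    · exact hsink x hx
  cases y with
  | vertex w => exact hvertex w
  | arrow f =>
    rw [← coe_gen, ← hc.hom_arrow_mul f]
    exact mul_mem (apply_mem_image (quotientHom I) _) (hvertex _)
  | dual f =>
    rw [← coe_gen, ← hc.mul_hom_dual f]
    exact mul_mem (hvertex _) (apply_mem_image (quotientHom I) _)

end Image

/-! ### Replacing cycles with no exit by copies cut open -/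

namespace DiGraph

variable {Γ : DiGraph.{u, v}} {β : Set (Cycle Γ.E)} {d : Cycle Γ.E → ℕ}

open Classical in
/-- The number `d C` for the vertices on a cycle `C` in `β`, and `1` for other vertices. -/
def mult (β : Set (Cycle Γ.E)) (d : Cycle Γ.E → ℕ) (x : Γ.V) : ℕ :=
  if h : ∃ C ∈ β, x ∈ C.map Γ.src then d h.choose else 1

theorem mult_pos (hd : ∀ C, 0 < d C) (x : Γ.V) : 0 < mult β d x := by
  rw [mult]
  split_ifs
  exacts [hd _, one_pos]

theorem mult_src (hβ : β ⊆ Γ.noExitCycles) {C : Cycle Γ.E} (hC : C ∈ β) {e : Γ.E} (he : e ∈ C) :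
    mult β d (Γ.src e) = d C := by
  have h : ∃ C ∈ β, Γ.src e ∈ C.map Γ.src := ⟨C, hC, Cycle.mem_map.2 ⟨e, he, rfl⟩⟩
  rw [mult, dif_pos h]
  obtain ⟨h1, h2⟩ := h.choose_spec
  obtain ⟨f, hf, hfe⟩ := Cycle.mem_map.1 h2
  have h3 := unique_of_mem (hβ h1) hf e hfe.symm
  rw [noExitCycles_disjoint (hβ h1) (hβ hC) hf (h3 ▸ he)]

theorem exists_src_eq_tgt {C : Cycle Γ.E} (hC : C ∈ Γ.noExitCycles) {e : Γ.E} (he : e ∈ C) :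
    ∃ f ∈ C, Γ.src f = Γ.tgt e := by
  obtain ⟨f, hf, h⟩ := (isPath_head_cons_tail hC).exists_src_eq ((mem_cycle_iff hC e).1 he)
  exact ⟨f, (mem_cycle_iff hC f).2 hf, h⟩

theorem mult_tgt (hβ : β ⊆ Γ.noExitCycles) {C : Cycle Γ.E} (hC : C ∈ β) {e : Γ.E} (he : e ∈ C) :
    mult β d (Γ.tgt e) = d C := by
  obtain ⟨f, hf, h⟩ := exists_src_eq_tgt (hβ hC) he
  rw [← h, mult_src hβ hC hf]

theorem mult_src_of_notMem (hβ : β ⊆ Γ.noExitCycles) {e : Γ.E} (he : ∀ C ∈ β, e ∉ C) :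
    mult β d (Γ.src e) = 1 := by
  rw [mult, dif_neg]
  rintro ⟨C, hC, h⟩
  obtain ⟨f, hf, hfe⟩ := Cycle.mem_map.1 h
  exact he C hC (unique_of_mem (hβ hC) hf e hfe.symm ▸ hf)

theorem mult_src_or (hβ : β ⊆ Γ.noExitCycles) (e : Γ.E) :
    mult β d (Γ.src e) = 1 ∨ mult β d (Γ.src e) = mult β d (Γ.tgt e) := by
  by_cases he : ∃ C ∈ β, e ∈ C
  · obtain ⟨C, hC, he⟩ := he
    exact Or.inr ((mult_src hβ hC he).trans (mult_tgt hβ hC he).symm)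
  · push Not at he
    exact Or.inl (mult_src_of_notMem hβ he)

variable {n : Γ.V → ℕ} {hn : ∀ x, 0 < n x}

/-- The arrows over the first arrows of the cycles in `β`. -/
def cutSet (hβ : β ⊆ Γ.noExitCycles) (hn : ∀ x, 0 < n x) : Set (Γ.copies n hn).E :=
  {f | ∃ C, ∃ hC : C ∈ β, copiesE hn f = headArrow (hβ hC)}

/-- Paths that avoid the first arrows of the cycles in `β` can be lifted to a path between copies
with a given number. -/
theorem exists_lift_path (hβ : β ⊆ Γ.noExitCycles) {i : ℕ} {p : List Γ.E} {x y : Γ.V}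
    (hp : Γ.IsPath x p y) (hh : ∀ e ∈ p, ∀ C (hC : C ∈ β), e ≠ headArrow (hβ hC))
    (hs : ∀ e ∈ p, i < n (Γ.src e) ∧ i < n (Γ.tgt e)) (hx : i < n x) (hy : i < n y) :
    ∃ q : List ((Γ.copies n hn).delete (cutSet hβ hn)).E,
      ((Γ.copies n hn).delete (cutSet hβ hn)).IsPath (delV _ (copyV hn x i hx)) q
        (delV _ (copyV hn y i hy)) ∧ (q.map (ofDelE _)).map (copiesE hn) = p := by
  induction p generalizing x with
  | nil =>
    obtain rfl : x = y := hp
    exact ⟨[], rfl, rfl⟩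
  | cons e p ih =>
    obtain ⟨rfl, hp⟩ := hp
    have he := hs e (by simp)
    obtain ⟨q, hq, hqp⟩ := ih hp (fun f hf => hh f (by simp [hf])) (fun f hf => hs f (by simp [hf]))
      he.2
    refine ⟨delE _ (copyE hn e i he.2) ?_ :: q, ⟨?_, hq⟩, ?_⟩
    · rintro ⟨C, hC, h⟩
      exact hh e (by simp) C hC h
    · rw [src_delE, src_copyE _ he.1]
    · rw [List.map_cons, List.map_cons, hqp]
      rfl

end DiGraph

namespace DiGraph

variable {Γ : DiGraph.{u, v}} {β : Set (Cycle Γ.E)} {d : Cycle Γ.E → ℕ}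

/-- An arrow over a cycle in `β` is the only one from its source. -/
theorem copies_only (hβ : β ⊆ Γ.noExitCycles) (hd : ∀ C, 0 < d C) {C : Cycle Γ.E} (hC : C ∈ β)
    {f : (Γ.copies (mult β d) (mult_pos hd)).E} (hf : copiesE (mult_pos hd) f ∈ C)
    (g : (Γ.copies (mult β d) (mult_pos hd)).E)
    (hgf : (Γ.copies (mult β d) (mult_pos hd)).src g =
      (Γ.copies (mult β d) (mult_pos hd)).src f) : g = f := by
  have h1 : Γ.src (copiesE (mult_pos hd) g) = Γ.src (copiesE (mult_pos hd) f) := by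
    rw [← copiesV_src, ← copiesV_src, hgf]
  have h2 := unique_of_mem (hβ hC) hf _ h1
  obtain ⟨e, i, hi, rfl⟩ := exists_copyE f
  obtain ⟨e', j, hj, rfl⟩ := exists_copyE g
  rw [copiesE_copyE] at hf
  obtain rfl : e' = e := h2
  have hm : mult β d (Γ.src e') = mult β d (Γ.tgt e') :=
    (mult_src hβ hC hf).trans (mult_tgt hβ hC hf).symm
  rw [src_copyE hj (hm ▸ hj), src_copyE hi (hm ▸ hi)] at hgf
  exact copyE_inj.2 ⟨rfl, (copyV_inj.1 hgf).2⟩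

theorem exists_isCut (hβ : β ⊆ Γ.noExitCycles) (hd : ∀ C, 0 < d C) :
    ∃ l, IsCut (cutSet hβ (mult_pos (β := β) (d := d) hd)) l ∧ ∀ f, ∀ C (hC : C ∈ β),
      copiesE (mult_pos hd) f = headArrow (hβ hC) →
        ((l f).map (ofDelE _)).map (copiesE (mult_pos hd)) = tailPath (hβ hC) := by
  have key : ∀ f : (Γ.copies (mult β d) (mult_pos hd)).E, ∃ q, f ∈ cutSet hβ (mult_pos hd) →
      ((Γ.copies (mult β d) (mult_pos hd)).delete (cutSet hβ (mult_pos hd))).IsPath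
        (delV _ ((Γ.copies (mult β d) (mult_pos hd)).tgt f)) q
        (delV _ ((Γ.copies (mult β d) (mult_pos hd)).src f)) ∧
      ∀ C (hC : C ∈ β), copiesE (mult_pos hd) f = headArrow (hβ hC) →
        (q.map (ofDelE _)).map (copiesE (mult_pos hd)) = tailPath (hβ hC) := by
    intro f
    by_cases hf : f ∈ cutSet hβ (mult_pos hd)
    · obtain ⟨C, hC, hfC⟩ := hf
      obtain ⟨e, i, hi, rfl⟩ := exists_copyE f
      obtain rfl : e = headArrow (hβ hC) := hfC
      have hmem : ∀ e ∈ tailPath (hβ hC), e ∈ C := fun e he =>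
        (mem_cycle_iff (hβ hC) e).2 (by simp [he])
      have hid : i < d C := (mult_tgt (d := d) hβ hC (headArrow_mem (hβ hC))) ▸ hi
      have his : i < mult β d (Γ.src (headArrow (hβ hC))) := by
        rwa [mult_src hβ hC (headArrow_mem (hβ hC))]
      obtain ⟨q, hq, hqp⟩ := exists_lift_path (n := mult β d) (hn := mult_pos hd) hβ (i := i)
        (isPath_head_cons_tail (hβ hC)).2 (fun e he C' hC' h => by
          have h1 := eq_of_headArrow_mem (hβ hC') (hβ hC) (h ▸ hmem e he)
          subst h1
          exact headArrow_notMem_tailPath (hβ hC) (h ▸ he))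
        (fun e he => by
          rw [mult_src hβ hC (hmem e he), mult_tgt hβ hC (hmem e he)]
          exact ⟨hid, hid⟩) hi his
      refine ⟨q, fun _ => ⟨?_, fun C' hC' h => ?_⟩⟩
      · rw [src_copyE hi his]
        exact hq
      · rw [copiesE_copyE] at h
        obtain rfl := eq_of_headArrow_mem (hβ hC) (hβ hC') (h ▸ headArrow_mem (hβ hC'))
        exact hqp
    · exact ⟨[], fun h => absurd h hf⟩
  choose l hl using key
  refine ⟨l, ⟨?_, fun f hf => (hl f hf).1, ?_⟩, fun f C hC h => (hl f ⟨C, hC, h⟩).2 C hC h⟩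
  · rintro f ⟨C, hC, h⟩
    exact copies_only hβ hd hC (h ▸ headArrow_mem (hβ hC))
  · rintro f ⟨C, hC, h⟩ g hg
    refine copies_only hβ hd hC ?_
    refine (mem_cycle_iff (hβ hC) _).2 (List.mem_cons_of_mem _ ?_)
    rw [← (hl f ⟨C, hC, h⟩).2 C hC h]
    exact List.mem_map_of_mem (List.mem_map_of_mem hg)

end DiGraph

open DiGraph

section CutCopies

variable {F : Type w} [Field F] {Γ : DiGraph.{u, v}} {β : Set (Cycle Γ.E)} {d : Cycle Γ.E → ℕ}
  (hβ : β ⊆ Γ.noExitCycles) (hd : ∀ C, 0 < d C) (r : Cycle Γ.E → ℕ → Fˣ)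

/-- The digraph in which every cycle `C` in `β` is replaced by `d C` copies, each of which is cut
open at its first arrow. -/
abbrev cutCopies : DiGraph.{u, v} :=
  (Γ.copies (mult β d) (mult_pos hd)).delete (cutSet hβ (mult_pos hd))

open Classical in
/-- The weight of an arrow; that of the first arrow of the copy of `C` with number `i` is
`r C i`. -/
def cutWeight (f : (Γ.copies (mult β d) (mult_pos hd)).E) : Fˣ :=
  if h : ∃ C, ∃ hC : C ∈ β, copiesE (mult_pos hd) f = headArrow (hβ hC) then r h.choose f.1.2 else 1

theorem cutWeight_copyE {C : Cycle Γ.E} (hC : C ∈ β) {i : ℕ} (hi) :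
    cutWeight hβ hd r (copyE (mult_pos hd) (headArrow (hβ hC)) i hi) = r C i := by
  have h : ∃ C', ∃ hC' : C' ∈ β, copiesE (mult_pos hd) (copyE (mult_pos hd)
      (headArrow (hβ hC)) i hi) = headArrow (hβ hC') := ⟨C, hC, rfl⟩
  have hch : h.choose = C := by
    obtain ⟨h1, h2⟩ := h.choose_spec
    exact (eq_of_headArrow_mem (hβ hC) (hβ h1)
      (Eq.mpr (congrArg (· ∈ h.choose) h2) (headArrow_mem (hβ h1)))).symm
  rw [cutWeight, dif_pos h, hch]
  rfl

/-- The homomorphism that maps a cycle `C` in `β` to the sum, over the copies with numbers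
`i < d C`, of `r C i` times a vertex. -/
def cutCopiesHom : UnitalLPA F Γ →ₐ[F] UnitalLPA F (cutCopies hβ hd) :=
  (cutHom (exists_isCut hβ hd).choose_spec.1 (cutWeight hβ hd r)).comp
    ((isCover_copies (mult_src_or hβ)).hom F)

variable (F) in
/-- A vertex of the copies, as an element of the Leavitt path algebra. -/
abbrev cutVertex (w : (Γ.copies (mult β d) (mult_pos hd)).V) : UnitalLPA F (cutCopies hβ hd) :=
  (gen F (.vertex (delV _ w)) : L F (cutCopies hβ hd))

theorem cutVertex_ne_zero (w : (Γ.copies (mult β d) (mult_pos hd)).V) :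
    cutVertex F hβ hd w ≠ 0 := fun h =>
  gen_vertex_ne_zero (F := F) (delV (cutSet hβ (mult_pos hd)) w) (Subtype.ext h)

theorem cutCopiesHom_vertex_mul (w : (Γ.copies (mult β d) (mult_pos hd)).V) :
    cutCopiesHom hβ hd r (gen F (.vertex (copiesV (mult_pos hd) w)) : L F Γ) * cutVertex F hβ hd w =
      cutVertex F hβ hd w := by
  have h := congrArg (cutHom (exists_isCut hβ hd).choose_spec.1 (cutWeight hβ hd r))
    ((isCover_copies (mult_src_or hβ)).hom_vertex_mul (F := F) w)
  rw [map_mul, cutHom_vertex] at h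
  exact h

theorem cutCopiesHom_arrow_mul (f : (Γ.copies (mult β d) (mult_pos hd)).E) :
    cutCopiesHom hβ hd r (gen F (.arrow (copiesE (mult_pos hd) f)) : L F Γ) *
      cutVertex F hβ hd ((Γ.copies (mult β d) (mult_pos hd)).tgt f) =
      (cutArrow (exists_isCut hβ hd).choose (cutWeight hβ hd r) f : L F (cutCopies hβ hd)) := by
  have h := congrArg (cutHom (exists_isCut hβ hd).choose_spec.1 (cutWeight hβ hd r))
    ((isCover_copies (mult_src_or hβ)).hom_arrow_mul (F := F) f)
  rw [map_mul, cutHom_vertex, cutHom_arrow] at h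
  exact h

theorem mul_cutCopiesHom_dual (f : (Γ.copies (mult β d) (mult_pos hd)).E) :
    cutVertex F hβ hd ((Γ.copies (mult β d) (mult_pos hd)).tgt f) *
      cutCopiesHom hβ hd r (gen F (.dual (copiesE (mult_pos hd) f)) : L F Γ) =
      (cutDual (exists_isCut hβ hd).choose (cutWeight hβ hd r) f : L F (cutCopies hβ hd)) := by
  have h := congrArg (cutHom (exists_isCut hβ hd).choose_spec.1 (cutWeight hβ hd r))
    ((isCover_copies (mult_src_or hβ)).mul_hom_dual (F := F) f)
  rw [map_mul, cutHom_vertex, cutHom_dual] at h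
  exact h

theorem cutCopiesHom_vertex (x : Γ.V) :
    cutCopiesHom hβ hd r (gen F (.vertex x) : L F Γ) =
      ∑ i : Fin (mult β d x), cutVertex F hβ hd (copyV (mult_pos hd) x i i.2) := by
  have h1 : cutCopiesHom hβ hd r (gen F (.vertex x) : L F Γ) =
      cutHom (exists_isCut hβ hd).choose_spec.1 (cutWeight hβ hd r)
        ((isCover_copies (hn := mult_pos hd) (mult_src_or hβ)).vertexSum F x :
          L F (Γ.copies (mult β d) (mult_pos hd))) :=
    congrArg _ ((isCover_copies (mult_src_or hβ)).hom_vertex x)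
  rw [h1, IsCover.vertexSum, AddSubmonoidClass.coe_finsetSum, map_sum]
  refine Finset.sum_bij' (fun w hw => ⟨w.1.2, ?_⟩) (fun i _ => copyV (mult_pos hd) x i i.2)
    (fun _ _ => Finset.mem_univ _) (fun i _ => ?_) (fun w hw => ?_) (fun i _ => rfl)
    (fun w hw => ?_)
  · rw [Set.Finite.mem_toFinset] at hw
    obtain rfl : copiesV (mult_pos hd) w = x := hw
    exact w.2
  · rw [Set.Finite.mem_toFinset]
    rfl
  · rw [Set.Finite.mem_toFinset] at hw
    obtain rfl : copiesV (mult_pos hd) w = x := hw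
    rfl
  · rw [Set.Finite.mem_toFinset] at hw
    obtain rfl : copiesV (mult_pos hd) w = x := hw
    exact cutHom_vertex _ _ w

theorem cutCopiesHom_vertex_ne_zero (x : Γ.V) :
    cutCopiesHom hβ hd r (gen F (.vertex x) : L F Γ) ≠ 0 := by
  intro h
  have h1 := cutCopiesHom_vertex_mul hβ hd r (copyV (mult_pos hd) x 0 (mult_pos hd x))
  rw [copiesV_copyV, h, zero_mul] at h1
  exact cutVertex_ne_zero hβ hd _ h1.symm

theorem aeval_mul_of_eigenvector {A : Type*} [Ring A] [Algebra F A] {T b : A} {a : F}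
    (h : T * b = a • b) (g : F[X]) : aeval T g * b = g.eval a • b := by
  have hpow : ∀ k : ℕ, T ^ k * b = a ^ k • b := by
    intro k
    induction k with
    | zero => simp
    | succ k ih => rw [pow_succ, mul_assoc, h, mul_smul_comm, ih, smul_smul, pow_succ']
  rw [aeval_eq_sum_range, eval_eq_sum_range, Finset.sum_mul, Finset.sum_smul]
  refine Finset.sum_congr rfl fun k _ => ?_
  rw [smul_mul_assoc, hpow, smul_smul]

theorem cutCopiesHom_pathElem_mul {C : Cycle Γ.E} (hC : C ∈ β) {i : ℕ} (hi) :
    cutCopiesHom hβ hd r (pathElem F (headArrow (hβ hC) :: tailPath (hβ hC)) : L F Γ) *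
      cutVertex F hβ hd (copyV (mult_pos hd) (Γ.src (headArrow (hβ hC))) i hi) =
      (r C i : F) • cutVertex F hβ hd (copyV (mult_pos hd) (Γ.src (headArrow (hβ hC))) i hi) := by
  have hmem := headArrow_mem (hβ hC)
  have hi' : i < mult β d (Γ.tgt (headArrow (hβ hC))) := by
    rwa [mult_tgt hβ hC hmem, ← mult_src (d := d) hβ hC hmem]
  set f := copyE (mult_pos hd) (headArrow (hβ hC)) i hi' with hf
  have hsrc : (Γ.copies (mult β d) (mult_pos hd)).src f =
      copyV (mult_pos hd) (Γ.src (headArrow (hβ hC))) i hi := src_copyE hi' hi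
  obtain ⟨hcut, htail⟩ := (exists_isCut (d := d) hβ hd).choose_spec
  set l := (exists_isCut (d := d) hβ hd).choose
  have hfD : f ∈ cutSet hβ (mult_pos hd) := ⟨C, hC, rfl⟩
  have hpath : (Γ.copies (mult β d) (mult_pos hd)).IsPath
      (copyV (mult_pos hd) (Γ.src (headArrow (hβ hC))) i hi) (f :: (l f).map (ofDelE _))
      (copyV (mult_pos hd) (Γ.src (headArrow (hβ hC))) i hi) := by
    rw [← hsrc]
    exact ⟨rfl, isPath_ofDelE (hcut.path f hfD)⟩
  have h1 := (isCover_copies (mult_src_or hβ)).hom_pathTo_mul (F := F) hpath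
  rw [List.map_cons, htail f C hC rfl, hf, copiesE_copyE, copiesV_copyV, ← hf,
    ← pathElem_eq_pathTo (by simp) (isPath_head_cons_tail (hβ hC))] at h1
  have h2 := congrArg (cutHom (exists_isCut hβ hd).choose_spec.1 (cutWeight hβ hd r)) h1
  rw [map_mul, cutHom_vertex, ← hsrc, cutHom_pathTo_cons _ _ hfD] at h2
  rw [← hsrc]
  refine Eq.trans h2 ?_
  rw [NonUnitalSubalgebra.coe_smul, hf, cutWeight_copyE hβ hd r hC]

theorem cutCopiesHom_pathEval_mul {C : Cycle Γ.E} (hC : C ∈ β) (g : F[X]) {i : ℕ} (hi) :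
    cutCopiesHom hβ hd r (pathEval (headArrow (hβ hC) :: tailPath (hβ hC)) g : L F Γ) *
      cutVertex F hβ hd (copyV (mult_pos hd) (Γ.src (headArrow (hβ hC))) i hi) =
      g.eval (r C i : F) •
        cutVertex F hβ hd (copyV (mult_pos hd) (Γ.src (headArrow (hβ hC))) i hi) := by
  have h := cutCopiesHom_vertex_mul hβ hd r (copyV (mult_pos hd) (Γ.src (headArrow (hβ hC))) i hi)
  rw [copiesV_copyV, coe_gen] at h
  rw [coe_pathEval (by simp) (isPath_head_cons_tail (hβ hC)), map_mul, mul_assoc, h,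
    ← Polynomial.aeval_algHom_apply,
    aeval_mul_of_eigenvector (cutCopiesHom_pathElem_mul hβ hd r hC hi)]

theorem cutCopiesHom_pathEval {C : Cycle Γ.E} (hC : C ∈ β) (g : F[X]) :
    cutCopiesHom hβ hd r (pathEval (headArrow (hβ hC) :: tailPath (hβ hC)) g : L F Γ) =
      ∑ i : Fin (mult β d (Γ.src (headArrow (hβ hC)))), g.eval (r C i : F) •
        cutVertex F hβ hd (copyV (mult_pos hd) (Γ.src (headArrow (hβ hC))) i i.2) := by
  rw [← pathEval_mul_vertex (by simp) (isPath_head_cons_tail (hβ hC)), NonUnitalSubalgebra.coe_mul,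
    map_mul, cutCopiesHom_vertex, Finset.mul_sum]
  exact Finset.sum_congr rfl fun i _ => cutCopiesHom_pathEval_mul hβ hd r hC g i.2

theorem cutCopiesHom_pathEval_eq_zero_iff {C : Cycle Γ.E} (hC : C ∈ β) (g : F[X]) :
    cutCopiesHom hβ hd r (pathEval (headArrow (hβ hC) :: tailPath (hβ hC)) g : L F Γ) = 0 ↔
      ∀ i < d C, g.eval (r C i : F) = 0 := by
  have hm := mult_src (d := d) hβ hC (headArrow_mem (hβ hC))
  constructor
  · intro h i hi
    have h1 := cutCopiesHom_pathEval_mul hβ hd r hC g (i := i) (hm ▸ hi)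
    rw [h, zero_mul] at h1
    exact (smul_eq_zero.1 h1.symm).resolve_right (cutVertex_ne_zero hβ hd _)
  · intro h
    rw [cutCopiesHom_pathEval hβ hd r hC]
    exact Finset.sum_eq_zero fun i _ => by rw [h i (hm ▸ i.2), zero_smul]

/-- The homomorphism is injective on the polynomials in a cycle with no exit outside `β`. -/
theorem cutCopiesHom_pathEval_eq_zero_iff_of_notMem {C : Cycle Γ.E} (hC : C ∈ Γ.noExitCycles)
    (hCβ : C ∉ β) (g : F[X]) :
    cutCopiesHom hβ hd r (pathEval (headArrow hC :: tailPath hC) g : L F Γ) = 0 ↔ g = 0 := by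
  have hnot : ∀ e ∈ C, ∀ C' ∈ β, e ∉ C' := fun e he C' hC' he' =>
    hCβ (noExitCycles_disjoint hC (hβ hC') he he' ▸ hC')
  have hsrc : ∀ e ∈ C, mult β d (Γ.src e) = 1 := fun e he => mult_src_of_notMem hβ (hnot e he)
  have htgt : ∀ e ∈ C, mult β d (Γ.tgt e) = 1 := fun e he => by
    obtain ⟨f, hf, h⟩ := exists_src_eq_tgt hC he
    rw [← h, hsrc f hf]
  have hmem : ∀ e ∈ headArrow hC :: tailPath hC, e ∈ C := fun e => (mem_cycle_iff hC e).2
  have h0 : 0 < mult β d (Γ.src (headArrow hC)) := mult_pos hd _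
  obtain ⟨q, hq, hqp⟩ := exists_lift_path (n := mult β d) (hn := mult_pos hd) hβ (i := 0)
    (isPath_head_cons_tail hC)
    (fun e he C' hC' h => hnot e (hmem e he) C' hC' (h ▸ headArrow_mem (hβ hC')))
    (fun e _ => ⟨mult_pos hd _, mult_pos hd _⟩) h0 h0
  have hq0 : q ≠ [] := by
    rintro rfl
    exact List.cons_ne_nil _ _ hqp.symm
  have hc := isCover_copies (hn := mult_pos (β := β) (d := d) hd) (mult_src_or hβ)
  have h1 := hc.hom_pathEval (F := F) (by simpa using hq0) (isPath_ofDelE hq)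
    (fun f hf f' hff' => ?_) (fun w hw => ?_)
    (by rw [hqp, copiesV_copyV]; exact isPath_head_cons_tail hC) g
  · rw [hqp] at h1
    have h2 : cutCopiesHom hβ hd r (pathEval (headArrow hC :: tailPath hC) g : L F Γ) =
        (pathEval q g : L F (cutCopies hβ hd)) := by
      refine (congrArg (cutHom (exists_isCut hβ hd).choose_spec.1 (cutWeight hβ hd r)) h1).trans ?_
      exact cutHom_pathEval _ _ hq0 hq g
    rw [h2]
    constructor
    · intro h
      refine eq_zero_of_pathEval_mem isGraded_bot hq0 hq ?_
        ((TwoSidedIdeal.mem_bot _).2 (Subtype.ext h))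
      rw [mem_vertexSet, TwoSidedIdeal.mem_bot]
      exact gen_vertex_ne_zero _
    · rintro rfl
      rw [pathEval_zero]
      rfl
  · obtain ⟨e, i, hi, rfl⟩ := exists_copyE f
    obtain ⟨e', j, hj, rfl⟩ := exists_copyE f'
    obtain rfl : e' = e := hff'
    have he : e' ∈ headArrow hC :: tailPath hC := by
      rw [← hqp]
      exact List.mem_map_of_mem hf
    have := htgt e' (hmem e' he)
    exact copyE_inj.2 ⟨rfl, by omega⟩
  · obtain ⟨x, i, hi, rfl⟩ := exists_copyV w
    obtain rfl : x = Γ.src (headArrow hC) := hw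
    have := hsrc _ (headArrow_mem hC)
    exact copyV_inj.2 ⟨rfl, by omega⟩

theorem cutCopiesHom_gen_mem (x : Gen Γ) : cutCopiesHom hβ hd r (gen F x : L F Γ) ∈
    NonUnitalAlgebra.adjoin F (Set.range (unitalGen F (cutCopies hβ hd))) := by
  have h1 := (isCover_copies (hn := mult_pos (β := β) (d := d) hd)
    (mult_src_or hβ)).hom_gen_mem (F := F) x
  have h2 : ∀ a : L F (Γ.copies (mult β d) (mult_pos hd)),
      cutHom (exists_isCut hβ hd).choose_spec.1 (cutWeight hβ hd r) a ∈
        NonUnitalAlgebra.adjoin F (Set.range (unitalGen F (cutCopies hβ hd))) := by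
    refine apply_mem_of_forall fun y => ?_
    cases y with
    | vertex w => rw [cutHom_vertex]; exact Subtype.prop _
    | arrow f => rw [cutHom_arrow]; exact Subtype.prop _
    | dual f => rw [cutHom_dual]; exact Subtype.prop _
  exact h2 ⟨_, h1⟩

/-- If the numbers `r C i` with `i < d C` are distinct, then the homomorphism is surjective. -/
theorem cutCopiesHom_image (hr : ∀ C ∈ β, Set.InjOn (fun i => (r C i : F)) (Set.Iio (d C)))
    (y : Gen (cutCopies hβ hd)) : unitalGen F (cutCopies hβ hd) y ∈
      image (cutCopiesHom hβ hd r) := by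
  -- interpolation separates the copies of the base vertex of a cycle
  have hbase : ∀ C (hC : C ∈ β) i hi,
      cutVertex F hβ hd (copyV (mult_pos hd) (Γ.src (headArrow (hβ hC))) i hi) ∈
        image (cutCopiesHom hβ hd r) := by
    intro C hC i hi
    have hm := mult_src (d := d) hβ hC (headArrow_mem (hβ hC))
    obtain ⟨g, hg⟩ : ∃ g : F[X], ∀ j < d C, g.eval (r C j : F) = if j = i then 1 else 0 := by
      refine ⟨Lagrange.interpolate (Finset.range (d C)) (fun j => (r C j : F))
        (fun j => if j = i then 1 else 0), fun j hj => ?_⟩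
      refine Lagrange.eval_interpolate_at_node (v := fun j => (r C j : F)) _ ?_
        (Finset.mem_range.2 hj)
      simpa using hr C hC
    have h := cutCopiesHom_pathEval hβ hd r hC g
    rw [Finset.sum_eq_single ⟨i, hi⟩, hg i (hm ▸ hi), if_pos rfl, one_smul] at h
    · rw [← h]
      exact apply_mem_image _ _
    · intro j _ hj
      rw [hg j (hm ▸ j.2), if_neg fun h' => hj (Fin.ext h'), zero_smul]
    · exact fun h' => absurd (Finset.mem_univ _) h'
  -- the other vertices of a copy are obtained by walking back along the cycle
  have hwalk : ∀ C (hC : C ∈ β) (p : List Γ.E) x, (∀ e ∈ p, e ∈ C) →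
      Γ.IsPath x p (Γ.src (headArrow (hβ hC))) → ∀ i hi,
      cutVertex F hβ hd (copyV (mult_pos hd) x i hi) ∈ image (cutCopiesHom hβ hd r) := by
    intro C hC p
    induction p with
    | nil =>
      rintro x - rfl i hi
      exact hbase C hC i hi
    | cons e p ih =>
      rintro x he ⟨rfl, hp⟩ i hi
      have heC := he e (by simp)
      have hi' : i < mult β d (Γ.tgt e) := by
        rwa [mult_tgt hβ hC heC, ← mult_src (d := d) hβ hC heC]
      have h1 := ih _ (fun f hf => he f (by simp [hf])) hp i hi'
      set f := copyE (mult_pos hd) e i hi'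
      have hc := isCover_copies (hn := mult_pos (β := β) (d := d) hd) (mult_src_or hβ)
      have h2 : hc.hom F (gen F (.arrow e) : L F Γ) *
          (gen F (.vertex ((Γ.copies (mult β d) (mult_pos hd)).tgt f)) :
            L F (Γ.copies (mult β d) (mult_pos hd))) * hc.hom F (gen F (.dual e) : L F Γ) =
          (gen F (.vertex (copyV (mult_pos hd) (Γ.src e) i hi)) :
            L F (Γ.copies (mult β d) (mult_pos hd))) := by
        have h3 : hc.hom F (gen F (.arrow e) : L F Γ) *
          (gen F (.vertex ((Γ.copies (mult β d) (mult_pos hd)).tgt f)) :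
            L F (Γ.copies (mult β d) (mult_pos hd))) = _ := hc.hom_arrow_mul f
        rw [h3, ← arrow_mul_tgt, NonUnitalSubalgebra.coe_mul, mul_assoc]
        have h4 : (gen F (.vertex ((Γ.copies (mult β d) (mult_pos hd)).tgt f)) :
            L F (Γ.copies (mult β d) (mult_pos hd))) * hc.hom F (gen F (.dual e) : L F Γ) = _ :=
          hc.mul_hom_dual f
        rw [h4, ← NonUnitalSubalgebra.coe_mul,
          arrow_mul_dual_self (copies_only hβ hd hC (f := f) heC),
          src_copyE hi' hi]
      have h3 := congrArg (cutHom (exists_isCut hβ hd).choose_spec.1 (cutWeight hβ hd r)) h2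
      rw [map_mul, map_mul, cutHom_vertex, cutHom_vertex] at h3
      change (gen F (.vertex (delV _ (copyV (mult_pos hd) (Γ.src e) i hi))) :
        L F (cutCopies hβ hd)).1 ∈ _
      rw [← h3]
      exact mul_mem (mul_mem (apply_mem_image (cutCopiesHom hβ hd r) _) h1)
        (apply_mem_image (cutCopiesHom hβ hd r) _)
  have hvertex : ∀ w, cutVertex F hβ hd w ∈ image (cutCopiesHom hβ hd r) := by
    intro w
    obtain ⟨x, i, hi, rfl⟩ := exists_copyV w
    by_cases hx : ∃ C ∈ β, x ∈ C.map Γ.src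
    · obtain ⟨C, hC, hx⟩ := hx
      obtain ⟨e, he, rfl⟩ := Cycle.mem_map.1 hx
      rw [mem_cycle_iff (hβ hC)] at he
      obtain ⟨k, hk, rfl⟩ := List.getElem_of_mem he
      exact hwalk C hC _ _
        (fun f hf => (mem_cycle_iff (hβ hC) f).2 (List.mem_of_mem_drop hf))
        ((isPath_head_cons_tail (hβ hC)).take_drop k hk).2 i hi
    · have hm : mult β d x = 1 := by rw [mult, dif_neg hx]
      have h1 := apply_mem_image (cutCopiesHom hβ hd r) (gen F (.vertex x))
      rw [cutCopiesHom_vertex, Finset.sum_eq_single ⟨i, hi⟩] at h1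
      · exact h1
      · intro j _ hj
        exact absurd (Fin.ext (by have := j.2; simp only; omega)) hj
      · exact fun h' => absurd (Finset.mem_univ _) h'
  cases y with
  | vertex w => exact hvertex w
  | arrow f =>
    obtain ⟨f, hf, rfl⟩ := exists_delE f
    have h := cutCopiesHom_arrow_mul hβ hd r f
    rw [cutArrow_of_notMem _ hf] at h
    exact Eq.mp (congrArg (· ∈ image (cutCopiesHom hβ hd r)) h)
      (mul_mem (apply_mem_image _ _) (hvertex _))
  | dual f =>
    obtain ⟨f, hf, rfl⟩ := exists_delE f
    have h := mul_cutCopiesHom_dual hβ hd r f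
    rw [cutDual_of_notMem _ hf] at h
    exact Eq.mp (congrArg (· ∈ image (cutCopiesHom hβ hd r)) h)
      (mul_mem (hvertex _) (apply_mem_image _ _))

end CutCopies

/-! ### The quotient by a dlf ideal -/

section Dlf

variable {F : Type w} [Field F]

/-- For a product of distinct linear factors, divisibility can be tested at the roots. -/
theorem HasDistinctLinearFactors.exists_roots {f : F[X]} (hf : HasDistinctLinearFactors f)
    (h0 : f.coeff 0 = 1) : ∃ r : ℕ → Fˣ, Set.InjOn (fun i => (r i : F)) (Set.Iio f.natDegree) ∧
      ∀ g : F[X], (∀ i < f.natDegree, g.eval (r i : F) = 0) ↔ f ∣ g := by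
  have hf0 : f ≠ 0 := by
    rintro rfl
    simp at h0
  have hlen : f.roots.toList.length = f.natDegree := by
    rw [Multiset.length_toList, hf.1.natDegree_eq_card_roots]
  have hnd : f.roots.toList.Nodup := by
    rw [← Multiset.coe_nodup, Multiset.coe_toList]
    exact hf.2
  have hroot : ∀ i (hi : i < f.roots.toList.length), f.eval f.roots.toList[i] = 0 := fun i hi =>
    (mem_roots'.1 (Multiset.mem_toList.1 (List.getElem_mem hi))).2
  have hne : ∀ i (hi : i < f.roots.toList.length), f.roots.toList[i] ≠ 0 := by
    intro i hi h
    have := hroot i hi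
    rw [h, ← coeff_zero_eq_eval_zero, h0] at this
    exact one_ne_zero this
  let r : ℕ → Fˣ := fun i => if hi : i < f.roots.toList.length then Units.mk0 _ (hne i hi) else 1
  have hr : ∀ i (hi : i < f.roots.toList.length), (r i : F) = f.roots.toList[i] := by
    intro i hi
    simp only [r, dif_pos hi, Units.val_mk0]
  rw [← hlen]
  refine ⟨r, fun i hi j hj hij => ?_, fun g => ⟨fun h => ?_, ?_⟩⟩
  · rw [Set.mem_Iio] at hi hj
    beta_reduce at hij
    rw [hr i hi, hr j hj] at hij
    exact (hnd.getElem_inj_iff).1 hij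
  · by_cases hg : g = 0
    · rw [hg]
      exact dvd_zero f
    refine hf.1.dvd_of_roots_le_roots hf0 ((Multiset.le_iff_subset hf.2).2 fun a ha => ?_)
    obtain ⟨i, hi, rfl⟩ := List.getElem_of_mem (Multiset.mem_toList.2 ha)
    rw [mem_roots hg, IsRoot.def, ← hr i hi]
    exact h i hi
  · rintro ⟨k, rfl⟩ i hi
    rw [eval_mul, hr i hi, hroot i hi, zero_mul]

variable {Γ : DiGraph.{u, v}} {I : TwoSidedIdeal (L F Γ)} {β : Set (Cycle (quotientGraph I).E)}

/-- If the copies of a cycle `C` in `β` are weighted by the roots of `f_C`, the kernel of the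
homomorphism to the Leavitt path algebra of the copies cut open has the canonical polynomials
`f_C`, hence it is `J`. -/
theorem IsDlf.quotientIsLPA (hI : IsGraded I) (hβ : β ⊆ (quotientGraph I).noExitCycles)
    {J : TwoSidedIdeal (L F Γ)} (hJ : J ∈ stratum I β) (hdlf : IsDlf J) : QuotientIsLPA J := by
  classical
  let f : Cycle (quotientGraph I).E → F[X] := fun C =>
    if C ∈ β then canonicalPoly J (baseCycle I C) else 0
  let d : Cycle (quotientGraph I).E → ℕ := fun C => if C ∈ β then (f C).natDegree else 1
  have hf : ∀ C ∈ β, f C = canonicalPoly J (baseCycle I C) := fun C hC => if_pos hC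
  have hcan : ∀ C ∈ β, IsCanonicalPoly J (baseCycle I C) (f C) := fun C hC =>
    (hf C hC).symm ▸ isCanonicalPoly_canonicalPoly hJ ⟨C, hC⟩
  have hdeg : ∀ C ∈ β, d C = (f C).natDegree := fun C hC => if_pos hC
  have hd : ∀ C, 0 < d C := by
    intro C
    by_cases hC : C ∈ β
    · rw [hdeg C hC]
      exact (hcan C hC).2.1
    · simp only [d, if_neg hC, one_pos]
  have hroots : ∀ C, ∃ r : ℕ → Fˣ, C ∈ β → Set.InjOn (fun i => (r i : F)) (Set.Iio (d C)) ∧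
      ∀ g : F[X], (∀ i < d C, g.eval (r i : F) = 0) ↔ f C ∣ g := by
    intro C
    by_cases hC : C ∈ β
    · have h := (isDlf_iff hJ hβ).1 hdlf ⟨C, hC⟩
      obtain ⟨r, hr⟩ := HasDistinctLinearFactors.exists_roots ((hf C hC).symm ▸ h) (hcan C hC).1
      exact ⟨r, fun _ => by rw [hdeg C hC]; exact hr⟩
    · exact ⟨fun _ => 1, fun h => absurd h hC⟩
  choose r hr using hroots
  obtain ⟨h1, h2⟩ := kerIdeal_mem_stratum hI hβ (cutCopiesHom hβ hd r)
    (cutCopiesHom_vertex_ne_zero hβ hd r) f (fun C hC => ⟨(hcan C hC).1, (hcan C hC).2.1⟩)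
    (fun C hC => if_neg hC) fun C hC g => by
      by_cases hCβ : C ∈ β
      · exact (cutCopiesHom_pathEval_eq_zero_iff hβ hd r hCβ g).trans ((hr C hCβ).2 g)
      · rw [cutCopiesHom_pathEval_eq_zero_iff_of_notMem hβ hd r hC hCβ]
        simp only [f, if_neg hCβ, zero_dvd_iff]
  have hJK : J = kerIdeal ((cutCopiesHom hβ hd r).comp (quotientHom I)) :=
    eq_of_canonicalPoly_eq hJ h1 fun C => by
      rw [canonicalPoly_eq (h2 C C.2), canonicalPoly_eq (hcan C C.2)]
  rw [hJK]
  refine quotientIsLPA_kerIdeal _ (fun x => ?_) fun y => ?_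
  · exact apply_mem_of_forall (cutCopiesHom_gen_mem hβ hd r)
      ⟨_, (isCover_quotientGraph I).hom_gen_mem (F := F) x⟩
  · obtain ⟨a, ha⟩ := mem_image.1 (cutCopiesHom_image hβ hd r (fun C hC => (hr C hC).1) y)
    rw [← ha]
    exact comp_mem_image (quotientHom_image I) _ a

end Dlf

/-! ### Discriminants on the affine factors -/

section Discriminant

variable {F : Type w} [Field F]

/-- Over a field the discriminant detects inseparability also in positive characteristic, where
the derivative may drop its degree: the resultant with the derivative taken in its formal degree
differs from the actual one by a power of the leading coefficient. -/
theorem discr_ne_zero_iff_separable {f : F[X]} (hf : 0 < f.natDegree) :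
    f.discr ≠ 0 ↔ f.Separable := by
  have h0 : f ≠ 0 := fun h => by simp [h] at hf
  have h1 := resultant_deriv (natDegree_pos_iff_degree_pos.1 hf)
  obtain ⟨k, hk⟩ := Nat.exists_eq_add_of_le (natDegree_derivative_le f)
  rw [hk, resultant_add_right_deg _ _ _ _ _ le_rfl] at h1
  have hl : f.leadingCoeff ≠ 0 := leadingCoeff_ne_zero.2 h0
  have h2 : f.discr = 0 ↔ resultant f (derivative f) = 0 := by
    constructor
    · intro h
      rw [h, mul_zero] at h1
      exact (mul_eq_zero.1 h1).resolve_left (pow_ne_zero _ hl)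
    · intro h
      rw [h, mul_zero] at h1
      exact (mul_eq_zero.1 h1.symm).resolve_left
        (mul_ne_zero (pow_ne_zero _ (neg_ne_zero.2 one_ne_zero)) hl)
  rw [Ne, h2, resultant_eq_zero_iff, Polynomial.Separable]
  simp [h0]

theorem hasDistinctLinearFactors_iff_discr_ne_zero [IsAlgClosed F] {f : F[X]}
    (hf : 0 < f.natDegree) : HasDistinctLinearFactors f ↔ f.discr ≠ 0 := by
  have h0 : f ≠ 0 := fun h => by simp [h] at hf
  rw [discr_ne_zero_iff_separable hf, ← nodup_roots_iff_of_splits h0 (IsAlgClosed.splits f)]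
  exact and_iff_right (IsAlgClosed.splits f)

theorem exists_factor_discr_ne_zero [Infinite F] (n : ℕ) :
    ∃ a : Factor F n, 0 < n → a.poly.discr ≠ 0 := by
  classical
  have : Infinite {x : F // x ≠ 0} := (Set.finite_singleton (0 : F)).infinite_compl.to_subtype
  let r : Fin n → F := fun i => (Infinite.natEmbedding {x : F // x ≠ 0} i).1
  have hr : Function.Injective r := fun i j h =>
    Fin.ext ((Infinite.natEmbedding {x : F // x ≠ 0}).injective (Subtype.ext h))
  have hr0 : ∀ i, r i ≠ 0 := fun i => (Infinite.natEmbedding {x : F // x ≠ 0} i).2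
  let g : F[X] := ∏ i, (X - C (r i))
  have hg : g.coeff 0 ≠ 0 := by
    rw [coeff_zero_eq_eval_zero, eval_prod]
    exact Finset.prod_ne_zero_iff.2 fun i _ => by simpa using hr0 i
  let f : F[X] := C (g.coeff 0)⁻¹ * g
  have hdeg : f.natDegree = n := by
    rw [natDegree_C_mul (inv_ne_zero hg), natDegree_prod_of_monic _ _ fun i _ => monic_X_sub_C _]
    simp
  have hsep : f.Separable :=
    (separable_prod_X_sub_C_iff.2 hr).unit_mul (isUnit_C.2 (inv_ne_zero hg).isUnit)
  have hf0 : f ≠ 0 := hsep.ne_zero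
  let a : Factor F n := ⟨fun i => f.coeff (i + 1), fun i hi => by
    change f.coeff _ ≠ 0
    rw [hi, ← hdeg]
    exact leadingCoeff_ne_zero.2 hf0⟩
  have ha : a.poly = f :=
    a.poly_eq (by simp [f, hg]) hdeg.le fun i => rfl
  refine ⟨a, fun hn => ?_⟩
  rw [ha, discr_ne_zero_iff_separable (hdeg.symm ▸ hn)]
  exact hsep

variable (F) in
/-- The universal polynomial `1 + X₁ x + ⋯ + Xₙ xⁿ` over the polynomial ring in its
coefficients. -/
def universalPoly (n : ℕ) : (MvPolynomial (Fin n) F)[X] :=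
  1 + ∑ i : Fin n, C (MvPolynomial.X i) * X ^ ((i : ℕ) + 1)

theorem Factor.map_universalPoly {n : ℕ} (a : Factor F n) :
    (universalPoly F n).map (MvPolynomial.eval a.1) = a.poly := by
  simp [universalPoly, Factor.poly, Polynomial.map_sum]

variable (F) in
/-- The discriminant on the affine factor is given by a polynomial in the coefficients: a nonzero
polynomial whose nonvanishing locus in `Fⁿ` is the set of points `(a₁, …, aₙ)` with `aₙ ≠ 0` whose
polynomial has nonzero discriminant. -/
theorem exists_discriminant_polynomial [Infinite F] {n : ℕ} (hn : 0 < n) :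
    ∃ P : MvPolynomial (Fin n) F, P ≠ 0 ∧
      (∀ a, MvPolynomial.eval a P ≠ 0 → ∀ i : Fin n, (i : ℕ) + 1 = n → a i ≠ 0) ∧
      ∀ a : Factor F n, MvPolynomial.eval a.1 P ≠ 0 ↔ a.poly.discr ≠ 0 := by
  let l : Fin n := ⟨n - 1, by omega⟩
  let R : MvPolynomial (Fin n) F :=
    resultant (universalPoly F n) (derivative (universalPoly F n)) n (n - 1)
  have hP : ∀ a : Factor F n,
      MvPolynomial.eval a.1 (R * MvPolynomial.X l) ≠ 0 ↔ a.poly.discr ≠ 0 := by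
    intro a
    have hl : a.1 l ≠ 0 := a.2 l (Nat.sub_add_cancel hn)
    have hd : 0 < a.poly.natDegree := a.natDegree_poly.symm ▸ hn
    have h0 : a.poly.leadingCoeff ≠ 0 := leadingCoeff_ne_zero.2 fun h => by simp [h] at hd
    have h1 := resultant_deriv (natDegree_pos_iff_degree_pos.1 hd)
    have h2 : MvPolynomial.eval a.1 R =
        resultant a.poly (derivative a.poly) a.poly.natDegree (a.poly.natDegree - 1) := by
      rw [a.natDegree_poly, ← a.map_universalPoly, derivative_map, resultant_map_map]
    rw [map_mul, MvPolynomial.eval_X, h2, h1]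
    simp [hl, h0]
  refine ⟨R * MvPolynomial.X l, ?_, fun a ha i hi => ?_, hP⟩
  · obtain ⟨a, ha⟩ := exists_factor_discr_ne_zero (F := F) n
    intro h
    exact (hP a).2 (ha hn) (by simp [h])
  · rw [map_mul, MvPolynomial.eval_X] at ha
    rw [show i = l from Fin.ext (by change (i : ℕ) = n - 1; omega)]
    exact right_ne_zero_of_mul ha

end Discriminant

/-! ### Open dense subsets of the affine factors -/

section Topologies

variable {F : Type w} [Field F]

theorem isOpen_zariski {σ : Type*} (p : MvPolynomial σ F) :
    IsOpen[zariski F σ] {a | MvPolynomial.eval a p ≠ 0} :=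
  TopologicalSpace.isOpen_generateFrom_of_mem ⟨p, rfl⟩

/-- The nonvanishing loci of polynomials are a basis, not just a subbasis. -/
theorem exists_eval_ne_zero_of_isOpen_zariski {σ : Type*} {U : Set (σ → F)}
    (hU : IsOpen[zariski F σ] U) {a : σ → F} (ha : a ∈ U) :
    ∃ p : MvPolynomial σ F, MvPolynomial.eval a p ≠ 0 ∧ ∀ b, MvPolynomial.eval b p ≠ 0 → b ∈ U := by
  let := zariski F σ
  have hb := TopologicalSpace.isTopologicalBasis_of_subbasis_of_inter (t := zariski F σ) rfl (by
    rintro _ ⟨p, rfl⟩ _ ⟨q, rfl⟩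
    exact ⟨p * q, by ext; simp⟩)
  obtain ⟨_, (rfl | ⟨p, rfl⟩), h1, h2⟩ := hb.exists_subset_of_mem_open ha hU
  · exact ⟨1, by simp, fun b _ => h2 trivial⟩
  · exact ⟨p, h1, fun b hb => h2 hb⟩

theorem dense_of_forall {X : Type*} {τ : TopologicalSpace X} {s : Set X}
    (h : ∀ U, IsOpen[τ] U → ∀ x ∈ U, ∃ y ∈ U, y ∈ s) : @Dense X τ s :=
  dense_iff_inter_open.2 fun U hU ⟨x, hx⟩ => h U hU x hx

theorem exists_mem_of_dense {X : Type*} {τ : TopologicalSpace X} {s : Set X}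
    (h : @Dense X τ s) {U : Set X} (hU : IsOpen[τ] U) {x : X} (hx : x ∈ U) : ∃ y ∈ U, y ∈ s :=
  dense_iff_inter_open.1 h U hU ⟨x, hx⟩

theorem exists_eval_ne_zero [Infinite F] {σ : Type*} {p : MvPolynomial σ F} (hp : p ≠ 0) :
    ∃ a, MvPolynomial.eval a p ≠ 0 := by
  by_contra! h
  exact hp (MvPolynomial.funext fun a => by simpa using h a)

theorem openDense_factorZariski [Infinite F] {n : ℕ} (hn : 0 < n) :
    OpenDense (factorZariski F n) {a | a.poly.discr ≠ 0} := by
  obtain ⟨P, hP0, hPlast, hP⟩ := exists_discriminant_polynomial F hn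
  constructor
  · exact ⟨_, isOpen_zariski P, Set.ext fun a => hP a⟩
  · apply dense_of_forall
    rintro _ ⟨V, hV, rfl⟩ a ha
    obtain ⟨p, hp, hpV⟩ := exists_eval_ne_zero_of_isOpen_zariski hV ha
    have hp0 : p ≠ 0 := fun h => hp (by simp [h])
    obtain ⟨b, hb⟩ := exists_eval_ne_zero (mul_ne_zero hp0 hP0)
    rw [map_mul] at hb
    exact ⟨⟨b, hPlast b (right_ne_zero_of_mul hb)⟩, hpV b (left_ne_zero_of_mul hb),
      (hP _).1 (right_ne_zero_of_mul hb)⟩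

/-- Density holds because a line through a point with nonzero discriminant contains only finitely
many points where the discriminant polynomial vanishes. -/
theorem openDense_factorEuclidean (ι : F ≃+* ℂ) {n : ℕ} (hn : 0 < n) :
    OpenDense (factorEuclidean ι n) {a | a.poly.discr ≠ 0} := by
  have : Infinite F := Infinite.of_injective ι.symm ι.symm.injective
  obtain ⟨P, hP0, hPlast, hP⟩ := exists_discriminant_polynomial F hn
  constructor
  · refine ⟨{z | MvPolynomial.eval z (MvPolynomial.map (ι : F →+* ℂ) P) ≠ 0},
      isOpen_ne_fun (MvPolynomial.continuous_eval _) continuous_const, Set.ext fun a => ?_⟩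
    refine Iff.trans (not_congr ?_) (hP a)
    have h : MvPolynomial.eval (fun i => ι (a.1 i)) (MvPolynomial.map (ι : F →+* ℂ) P) =
        ι (MvPolynomial.eval a.1 P) := by
      rw [MvPolynomial.eval_map]
      exact (MvPolynomial.eval₂_comp_left (ι : F →+* ℂ) (RingHom.id F) a.1 P).symm
    change MvPolynomial.eval (fun i => ι (a.1 i)) (MvPolynomial.map (ι : F →+* ℂ) P) = 0 ↔ _
    rw [h, map_eq_zero_iff ι ι.injective]
  · apply dense_of_forall
    rintro _ ⟨V, hV, rfl⟩ a ha
    obtain ⟨b, hb⟩ := exists_factor_discr_ne_zero (F := F) n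
    -- the discriminant polynomial along the line from `a` to `b`
    let Q : F[X] := MvPolynomial.aeval (fun i => C (a.1 i) + X * C (b.1 i - a.1 i)) P
    have hQ : ∀ t, Q.eval t = MvPolynomial.eval (fun i => a.1 i + t * (b.1 i - a.1 i)) P := by
      intro t
      rw [← Polynomial.coe_evalRingHom, ← MvPolynomial.coe_aeval_eq_eval]
      change evalRingHom t (MvPolynomial.aeval _ P) = _
      rw [MvPolynomial.aeval_def, MvPolynomial.hom_eval₂, RingHom.coe_coe, MvPolynomial.aeval_def]
      congr 1
      · ext; simp
      · ext i; simp
    have hQ0 : Q ≠ 0 := by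
      intro h
      have h1 := hQ 1
      rw [h, eval_zero] at h1
      simp only [one_mul, add_sub_cancel] at h1
      exact (hP b).2 (hb hn) h1.symm
    have hfin : {s : ℂ | Q.eval (ι.symm s) = 0}.Finite :=
      ((finite_setOfPred_isRoot hQ0).image ι).subset fun s hs => ⟨ι.symm s, hs, by simp⟩
    have hcont : Continuous fun (s : ℂ) (i : Fin n) => ι (a.1 i) + s * ι (b.1 i - a.1 i) := by
      fun_prop
    obtain ⟨s, hsV, hs⟩ := exists_mem_of_dense ((dense_univ (X := ℂ)).sdiff_finite hfin)
      (hV.preimage hcont) (x := 0) (by simpa using ha)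
    have h1 : MvPolynomial.eval (fun i => a.1 i + ι.symm s * (b.1 i - a.1 i)) P ≠ 0 :=
      (hQ _).symm ▸ hs.2
    refine ⟨⟨_, hPlast _ h1⟩, ?_, (hP _).1 h1⟩
    rw [Set.mem_preimage] at hsV
    change (fun i => ι (a.1 i + ι.symm s * (b.1 i - a.1 i))) ∈ V
    simpa only [map_add, map_mul, RingEquiv.apply_symm_apply] using hsV

/-! ### Open dense subsets of box products, preimages and unions of strata -/

theorem exists_pi_subset_of_isOpen_box {ι : Type*} {X : ι → Type*}
    {τ : ∀ i, TopologicalSpace (X i)} {U : Set (∀ i, X i)} (hU : IsOpen[boxTopology τ] U)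
    {x : ∀ i, X i} (hx : x ∈ U) :
    ∃ W : ∀ i, Set (X i), (∀ i, IsOpen[τ i] (W i)) ∧ x ∈ Set.univ.pi W ∧ Set.univ.pi W ⊆ U := by
  let := boxTopology τ
  have hb := TopologicalSpace.isTopologicalBasis_of_subbasis_of_inter (t := boxTopology τ) rfl (by
    rintro _ ⟨W, hW, rfl⟩ _ ⟨W', hW', rfl⟩
    exact ⟨fun i => W i ∩ W' i, fun i => (τ i).isOpen_inter _ _ (hW i) (hW' i),
      Set.pi_inter_distrib.symm⟩)
  obtain ⟨_, (rfl | ⟨W, hW, rfl⟩), h1, h2⟩ := hb.exists_subset_of_mem_open hx hU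
  · exact ⟨fun _ => Set.univ, fun i => (τ i).isOpen_univ, by simp, fun _ _ => h2 trivial⟩
  · exact ⟨W, hW, h1, h2⟩

theorem OpenDense.pi {ι : Type*} {X : ι → Type*} {τ : ∀ i, TopologicalSpace (X i)}
    {W : ∀ i, Set (X i)} (hW : ∀ i, OpenDense (τ i) (W i)) :
    OpenDense (boxTopology τ) (Set.univ.pi W) := by
  refine ⟨TopologicalSpace.isOpen_generateFrom_of_mem ⟨W, fun i => (hW i).1, rfl⟩, ?_⟩
  apply dense_of_forall
  intro U hU x hx
  obtain ⟨Z, hZ, hxZ, hZU⟩ := exists_pi_subset_of_isOpen_box hU hx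
  choose y hyZ hyW using fun i => exists_mem_of_dense (hW i).2 (hZ i) (hxZ i trivial)
  exact ⟨y, hZU fun i _ => hyZ i, fun i _ => hyW i⟩

theorem OpenDense.preimage_of_surjective {X Y : Type*} {τ : TopologicalSpace Y} {W : Set Y}
    (hW : OpenDense τ W) {f : X → Y} (hf : Function.Surjective f) :
    OpenDense (τ.induced f) (f ⁻¹' W) := by
  refine ⟨⟨W, hW.1, rfl⟩, ?_⟩
  apply dense_of_forall
  rintro _ ⟨V, hV, rfl⟩ x hx
  obtain ⟨y, hyV, hyW⟩ := exists_mem_of_dense hW.2 hV hx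
  obtain ⟨z, rfl⟩ := hf y
  exact ⟨z, hyV, hyW⟩

end Topologies

/-! ### The dlf ideals in the strata -/

section Strata

variable {F : Type w} [Field F] {Γ : DiGraph.{u, v}} {I : TwoSidedIdeal (L F Γ)}
  {β : Set (Cycle (quotientGraph I).E)}

theorem isDlf_iff_discr_ne_zero [IsAlgClosed F] (hβ : β ⊆ (quotientGraph I).noExitCycles)
    {d : β → ℕ+} (J : stratumDeg I β d) :
    IsDlf J.1 ↔ ∀ C : β, (coeffMap I β d J C).poly.discr ≠ 0 := by
  rw [isDlf_iff J.2.1 hβ]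
  refine forall_congr' fun C => ?_
  rw [← coeffMap_poly, hasDistinctLinearFactors_iff_discr_ne_zero]
  rw [Factor.natDegree_poly]
  exact (d C).pos

theorem setOf_isDlf [IsAlgClosed F] (hβ : β ⊆ (quotientGraph I).noExitCycles) (d : β → ℕ+) :
    {J : stratumDeg I β d | IsDlf J.1} =
      coeffMap I β d ⁻¹' Set.univ.pi fun _ => {a | a.poly.discr ≠ 0} := by
  ext J
  simpa using isDlf_iff_discr_ne_zero hβ J

theorem image_isDlf [IsAlgClosed F] (hI : IsGraded I) (hβ : β ⊆ (quotientGraph I).noExitCycles)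
    (d : β → ℕ+) (C : β) :
    (fun J => coeffMap I β d J C) '' {J | IsDlf J.1} = {a | a.poly.discr ≠ 0} := by
  classical
  have : Infinite F := IsAlgClosed.instInfinite
  apply Set.Subset.antisymm
  · rintro _ ⟨J, hJ, rfl⟩
    exact (isDlf_iff_discr_ne_zero hβ J).1 hJ C
  · intro a ha
    choose b hb using fun C' : β => exists_factor_discr_ne_zero (F := F) (d C' : ℕ)
    obtain ⟨J, hJ⟩ := (coeffMap_bijective hI hβ d).2 (Function.update b C a)
    refine ⟨J, (isDlf_iff_discr_ne_zero hβ J).2 fun C' => ?_, by simp [hJ]⟩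
    rw [hJ]
    by_cases h : C' = C
    · subst h
      simpa using ha
    · rw [Function.update_of_ne h]
      exact hb C' (d C').pos

theorem openDense_boxStratum [IsAlgClosed F] (hI : IsGraded I)
    (hβ : β ⊆ (quotientGraph I).noExitCycles) {τ : ∀ n, TopologicalSpace (Factor F n)}
    (hτ : ∀ n, 0 < n → OpenDense (τ n) {a | a.poly.discr ≠ 0}) (d : β → ℕ+) :
    OpenDense (boxStratum τ I β d) {J | IsDlf J.1} := by
  rw [setOf_isDlf hβ d]
  exact (OpenDense.pi fun C : β => hτ (d C) (d C).pos).preimage_of_surjective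
    (coeffMap_bijective hI hβ d).2

theorem isOpen_zariskiStratum [IsAlgClosed F] (hβ : β ⊆ (quotientGraph I).noExitCycles)
    (hfin : β.Finite) (d : β → ℕ+) : IsOpen[zariskiStratum I β d] {J | IsDlf J.1} := by
  have : Infinite F := IsAlgClosed.instInfinite
  have : Finite β := hfin
  choose P _ _ hP using fun C : β => exists_discriminant_polynomial F (d C).pos
  let := zariski F (Σ C : β, Fin (d C))
  refine ⟨⋂ C : β, {a | MvPolynomial.eval a (MvPolynomial.rename (Sigma.mk C) (P C)) ≠ 0},
    isOpen_iInter_of_finite fun C => isOpen_zariski _, ?_⟩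
  ext J
  rw [Set.mem_preimage, Set.mem_iInter]
  refine Iff.trans (forall_congr' fun C => ?_) (isDlf_iff_discr_ne_zero hβ J).symm
  rw [← hP, Set.mem_ofPred_eq, MvPolynomial.eval_rename]
  rfl

/-- A polynomial involves only finitely many variables, hence only the canonical polynomials of
finitely many cycles; for these one avoids the product with the discriminants, and the other
canonical polynomials are replaced arbitrarily. -/
theorem dense_zariskiStratum [IsAlgClosed F] (hI : IsGraded I)
    (hβ : β ⊆ (quotientGraph I).noExitCycles) (d : β → ℕ+) :
    @Dense _ (zariskiStratum I β d) {J | IsDlf J.1} := by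
  classical
  have : Infinite F := IsAlgClosed.instInfinite
  choose P hP0 hPlast hP using fun C : β => exists_discriminant_polynomial F (d C).pos
  apply dense_of_forall
  rintro _ ⟨V, hV, rfl⟩ J hJ
  obtain ⟨q, hq, hqV⟩ := exists_eval_ne_zero_of_isOpen_zariski hV hJ
  have hq0 : q ≠ 0 := fun h => hq (by simp [h])
  let t : Finset β := q.vars.image Sigma.fst
  have ht : ∏ C ∈ t, MvPolynomial.rename (Sigma.mk (β := fun C : β => Fin (d C)) C) (P C) ≠ 0 :=
    Finset.prod_ne_zero_iff.2 fun C _ h => hP0 C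
      (MvPolynomial.rename_injective (Sigma.mk (β := fun C : β => Fin (d C)) C) sigma_mk_injective
        (by rw [h, map_zero]))
  obtain ⟨y, hy⟩ := exists_eval_ne_zero (mul_ne_zero hq0 ht)
  rw [map_mul, map_prod] at hy
  have hy1 := left_ne_zero_of_mul hy
  have hy2 : ∀ C ∈ t, MvPolynomial.eval (fun i => y ⟨C, i⟩) (P C) ≠ 0 := fun C hC => by
    have h := Finset.prod_ne_zero_iff.1 (right_ne_zero_of_mul hy) C hC
    rw [MvPolynomial.eval_rename] at h
    exact h
  have hc (C : β) : ∃ c : Factor F (d C), c.poly.discr ≠ 0 ∧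
      (C ∈ t → c.1 = fun i => y ⟨C, i⟩) := by
    by_cases h : C ∈ t
    · exact ⟨⟨_, hPlast C _ (hy2 C h)⟩, (hP C _).1 (hy2 C h), fun _ => rfl⟩
    · obtain ⟨b, hb⟩ := exists_factor_discr_ne_zero (F := F) (d C : ℕ)
      exact ⟨b, hb (d C).pos, fun h' => absurd h' h⟩
  choose c hc hct using hc
  obtain ⟨K, rfl⟩ := (coeffMap_bijective hI hβ d).2 c
  refine ⟨K, hqV _ ?_, (isDlf_iff_discr_ne_zero hβ K).2 hc⟩
  have h : MvPolynomial.eval (fun x => (coeffMap I β d K x.1).1 x.2) q =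
      MvPolynomial.eval y q := by
    refine MvPolynomial.eval₂Hom_congr' rfl (fun x hx _ => ?_) rfl
    rw [hct x.1 (Finset.mem_image_of_mem _ hx)]
  change MvPolynomial.eval (fun x => (coeffMap I β d K x.1).1 x.2) q ≠ 0
  rwa [h]

/-- Every ideal of `𝒥(I, β)` lies in some `𝒥(I, β, d)`. -/
theorem exists_mem_stratumDeg {J : TwoSidedIdeal (L F Γ)} (hJ : J ∈ stratum I β) :
    ∃ d : β → ℕ+, J ∈ stratumDeg I β d :=
  ⟨fun C => ⟨_, (isCanonicalPoly_canonicalPoly hJ C).2.1⟩, hJ, fun _ => rfl⟩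

theorem dense_glue {τ : ∀ d : β → ℕ+, TopologicalSpace (stratumDeg I β d)}
    {p : TwoSidedIdeal (L F Γ) → Prop} (h : ∀ d, @Dense _ (τ d) {J | p J.1}) :
    @Dense _ (glue τ) {J | p J.1} := by
  apply dense_of_forall
  intro U hU J hJ
  obtain ⟨d, hd⟩ := exists_mem_stratumDeg J.2
  obtain ⟨K, hKU, hK⟩ := exists_mem_of_dense (h d) (hU d) (x := ⟨J.1, hd⟩) hJ
  exact ⟨⟨K.1, K.2.1⟩, hKU, hK⟩

theorem OpenDense.glue {τ : ∀ d : β → ℕ+, TopologicalSpace (stratumDeg I β d)}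
    {p : TwoSidedIdeal (L F Γ) → Prop} (h : ∀ d, OpenDense (τ d) {J | p J.1}) :
    OpenDense (LPA.glue τ) {J | p J.1} :=
  ⟨fun d => (h d).1, dense_glue fun d => (h d).2⟩

end Strata

end

end LPA

theorem mainTheorem5 {F : Type w} [Field F] [IsAlgClosed F] (Γ : LPA.DiGraph.{u, v})
    (I : TwoSidedIdeal (LPA.L F Γ)) (hI : LPA.IsGraded I)
    (β : Set (Cycle (LPA.quotientGraph I).E)) (hβ : β ⊆ (LPA.quotientGraph I).noExitCycles) :
    -- the strata with fixed degrees are parametrized by the coefficients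
    (∀ d : β → ℕ+, Function.Bijective (LPA.coeffMap I β d)) ∧
    -- being dlf is the nonvanishing of the discriminants
    (∀ (d : β → ℕ+) (J : LPA.stratumDeg I β d),
      LPA.IsDlf J.1 ↔ ∀ C : β, (LPA.coeffMap I β d J C).poly.discr ≠ 0) ∧
    -- the dlf ideals in each affine factor
    (∀ (d : β → ℕ+) (C : β),
      (fun J => LPA.coeffMap I β d J C) '' {J | LPA.IsDlf J.1} = {a | a.poly.discr ≠ 0} ∧
      LPA.OpenDense (LPA.factorZariski F (d C))
        ((fun J => LPA.coeffMap I β d J C) '' {J | LPA.IsDlf J.1}) ∧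
      ∀ ι : F ≃+* ℂ, LPA.OpenDense (LPA.factorEuclidean ι (d C))
        ((fun J => LPA.coeffMap I β d J C) '' {J | LPA.IsDlf J.1})) ∧
    -- the dlf ideals in the strata with fixed degrees
    (∀ d : β → ℕ+,
      LPA.OpenDense (LPA.boxStratum (LPA.factorZariski F) I β d) {J | LPA.IsDlf J.1} ∧
      @Dense _ (LPA.zariskiStratum I β d) {J | LPA.IsDlf J.1} ∧
      (β.Finite → IsOpen[LPA.zariskiStratum I β d] {J | LPA.IsDlf J.1}) ∧
      ∀ ι : F ≃+* ℂ,
        LPA.OpenDense (LPA.boxStratum (LPA.factorEuclidean ι) I β d) {J | LPA.IsDlf J.1}) ∧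
    -- the dlf ideals in the whole stratum
    (LPA.OpenDense (LPA.glue (LPA.boxStratum (LPA.factorZariski F) I β)) {J | LPA.IsDlf J.1} ∧
      @Dense _ (LPA.glue (LPA.zariskiStratum I β)) {J | LPA.IsDlf J.1} ∧
      (β.Finite → IsOpen[LPA.glue (LPA.zariskiStratum I β)] {J | LPA.IsDlf J.1}) ∧
      ∀ ι : F ≃+* ℂ,
        LPA.OpenDense (LPA.glue (LPA.boxStratum (LPA.factorEuclidean ι) I β))
          {J | LPA.IsDlf J.1}) ∧
    -- the quotient by a dlf ideal is a Leavitt path algebra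
    (∀ J ∈ LPA.stratum I β, LPA.IsDlf J → LPA.QuotientIsLPA J) := by
  have : Infinite F := IsAlgClosed.instInfinite
  have hZ (n : ℕ) (hn : 0 < n) := LPA.openDense_factorZariski (F := F) hn
  have hE (ι : F ≃+* ℂ) (n : ℕ) (hn : 0 < n) := LPA.openDense_factorEuclidean ι hn
  refine ⟨LPA.coeffMap_bijective hI hβ, fun d J => LPA.isDlf_iff_discr_ne_zero hβ J,
    fun d C => ?_, fun d => ⟨LPA.openDense_boxStratum hI hβ hZ d, LPA.dense_zariskiStratum hI hβ d,
      fun hfin => LPA.isOpen_zariskiStratum hβ hfin d,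
      fun ι => LPA.openDense_boxStratum hI hβ (hE ι) d⟩,
    ⟨LPA.OpenDense.glue (LPA.openDense_boxStratum hI hβ hZ),
      LPA.dense_glue (LPA.dense_zariskiStratum hI hβ),
      fun hfin => LPA.isOpen_zariskiStratum hβ hfin,
      fun ι => LPA.OpenDense.glue (LPA.openDense_boxStratum hI hβ (hE ι))⟩,
    fun J hJ hdlf => hdlf.quotientIsLPA hI hβ hJ⟩
  rw [LPA.image_isDlf hI hβ d C]
  exact ⟨rfl, hZ _ (d C).pos, fun ι => hE ι _ (d C).pos⟩
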